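/- Let $\mathrm{sim}$ be an LSHable similarity measure on a set $X$: there is a random hash function $h$ on $X$ with $\Pr[h(x)=h(y)]=\mathrm{sim}(x,y)$ for all $x,y\in X$. Fix constants $\lambda,\varphi\in(0,1)$ and an integer constant $\mathtt{limit}\ge 1$; the constants in $O(\cdot)$ and $\tilde O(\cdot)$ below depend only on these, and $\tilde O(f)$ means $O(f\cdot(1+\log n)^{c})$ for a constant $c$ (read $\log n$ as $1+\log n$ when $n=1$). **Algorithm.** The input is a set $S\subseteq X$ of $n\ge 1$ points. Draw $h_1,\dots,h_t$ independently with the law of $h$ and replace every point $x$ by the token set $f(x)=\{(i,h_i(x)) : 1\le i\le t\}$. Put $\varepsilon=\log(1/\lambda)/\log n$. Then run $R$ independent repetitions of the recursive procedure $\mathrm{CPSJoin}$, started on $S$. A call $\mathrm{CPSJoin}(S')$ does the following. 1. Brute force: while $|S'|>\mathtt{limit}$ and some $x\in S'$ satisfies $\frac{1}{|S'|-1}\sum_{y\in S'\setminus\{x\}}|f(x)\cap f(y)|/t>(1-\varepsilon)\lambda$, compute $\mathrm{sim}(x,y)$ for all other $y\in S'$, report the pairs with similarity at least $\lambda$ (and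 $(x,x)$), and remove $x$ from $S'$. As soon as $|S'|\le\mathtt{limit}$, compare all pairs in $S'$, report those with similarity at least $\lambda$, and return. 2. Splitting: draw a fresh random function $r$ from tokens to $[0,1]$ with independent uniform values, and for every token $j$ with $r(j)<\frac{1}{\lambda t}$ that lies in $f(x)$ for some remaining $x\in S'$, call $\mathrm{CPSJoin}(\{x\in S' : j\in f(x)\})$. Time is the number of elementary steps; evaluating a hash function, computing one similarity, one arithmetic or dictionary operation, and reporting a pair are one step each. Working space is the peak number of memory words in use, not counting the input and the output. **Theorem.** There are choices $t=t(n)\ge 1$ with $t=\tilde O(1)$ and $R=R(n)=O(\log^2 n)$, depending only on $n,\lambda,\varphi,\mathtt{limit}$, such that for every LSHable $\mathrm{sim}$ and every set $S$ of $n\ge1$ points the algorithm solves the $(\lambda,\varphi)$-similarity self-join problem on $S$: its output $L$ always satisfies $L\subseteq S\bowtie_\lambda S=\{(x,y)\in S\times S : \mathrm{sim}(x,y)\ge\lambda\}$, and $\Pr[(x,y)\in L]\ge\varphi$ for every $(x,y)\in S\bowtie_\lambda S$. Moreover, with $$W=\sum_{x\in S}\min_{k_x\in\{0,1,2,\dots\}}\Bigl(\sum_{y\in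 S\setminus\{x\}}(\mathrm{sim}(x,y)/\lambda)^{k_x}+(1/\lambda)^{k_x}\Bigr),$$ the cost of the best strategy with an individual stopping depth $k_x$ for every point $x$: * the expected running time is $\tilde O(W)$; * the expected number of similarity computations is $O(W)$ per repetition, that is, at most $O(R\cdot W)$ in total; * the working space is $\tilde O(n)$ with high probability: for every $a>0$ there is a constant $D_a$, depending only on $a,\lambda,\varphi,\mathtt{limit}$, such that the working space exceeds $D_a\,n\,(1+\log n)^c$ with probability at most $n^{-a}$, where $c$ does not depend on $a$. -/

import Mathlib

open MeasureTheory
open scoped ENNReal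

noncomputable section

namespace CPSJoin

/-! ### Computations with a cost account -/

/-- A computation over records named by references of type `ι`, together with what it costs:
`time` is the number of elementary steps, `cmps` the number of similarity computations (each of
them is also an elementary step), `space` the peak number of words of working memory in use, and
`out` the set of pairs written to the output. -/
structure Exec (ι : Type*) (α : Type*) where
  val : α
  time : ℕ
  cmps : ℕ
  space : ℕ
  out : Set (ι × ι)

namespace Exec

variable {ι α σ : Type*}

/-- Return a value at no cost. -/
def ret (a : α) : Exec ι α := ⟨a, 0, 0, 0, ∅⟩

/-- Sequential composition: times add up, and the peak memory is the larger of the two peaks.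
Memory that stays occupied while the second computation runs is accounted for by `hold`. -/
def bind (e : Exec ι α) (f : α → Exec ι σ) : Exec ι σ :=
  ⟨(f e.val).val, e.time + (f e.val).time, e.cmps + (f e.val).cmps,
    max e.space (f e.val).space, e.out ∪ (f e.val).out⟩

/-- `m` elementary steps (arithmetic on words and reals, dictionary look-up or update, evaluation
of a hash function, copying of a word). -/
def ticks (m : ℕ) : Exec ι Unit := ⟨(), m, 0, 0, ∅⟩

/-- Compute one similarity, whose value is `s`. -/
def similarity (s : ℝ) : Exec ι ℝ := ⟨s, 1, 1, 0, ∅⟩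

/-- Write one pair to the output. -/
def report (q : ι × ι) : Exec ι Unit := ⟨(), 1, 0, 0, {q}⟩

/-- Run `e` while `w` further words of working memory are occupied. -/
def hold (w : ℕ) (e : Exec ι α) : Exec ι α := { e with space := w + e.space }

/-- A loop over a list that carries a state. -/
def foldE (f : σ → α → Exec ι σ) : List α → σ → Exec ι σ
  | [], s => ret s
  | a :: l, s => (f s a).bind fun s' => foldE f l s'

/-- A loop over a list. -/
def forEach (l : List α) (f : α → Exec ι Unit) : Exec ι Unit :=
  foldE (fun _ a => f a) l ()

end Exec

open Exec

/-! ### The algorithm -/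

/-- The data and the global parameters: `tok x` lists the tokens of the record with reference `x`,
all records have `t` tokens, `sim` is the similarity that decides which pairs are reported, `lam`
is the threshold, and `limit`, `eps` are the parameters of the brute force step. -/
structure Input (ι τ : Type*) where
  tok : ι → List τ
  t : ℕ
  sim : ι → ι → ℝ
  lam : ℝ
  limit : ℕ
  eps : ℝ

variable {ι τ : Type*} (I : Input ι τ)

open scoped Classical in
/-- `BruteForcePoint(S, x, λ)`: compare `x` with every other point of `S` and report the pairs of
similarity at least `λ`, in both orders; the pair `(x, x)` is reported without a comparison. -/
def bruteForcePoint (S : List ι) (x : ι) : Exec ι Unit :=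
  forEach S fun y =>
    if y = x then report (x, x)
    else (similarity (I.sim x y)).bind fun s =>
      if I.lam ≤ s then (report (x, y)).bind fun _ => report (y, x) else ret ()

/-- `BruteForcePairs(S, λ)`. -/
def bruteForcePairs (S : List ι) : Exec ι Unit :=
  forEach S fun x => bruteForcePoint I S x

open scoped Classical in
/-- The dictionary `count`: for every token the number of its occurrences in `S`. -/
def countTokens (S : List ι) : Exec ι (τ → ℕ) :=
  foldE (fun c x =>
    foldE (fun c j => (ticks 1).bind fun _ => ret (Function.update c j (c j + 1))) (I.tok x) c)
    S (fun _ => 0)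

open scoped Classical in
/-- Look for the first `x` in a list with
`(1 / (m - 1)) * ∑ j ∈ x, (count j - 1) / t > (1 - ε) λ`. -/
def findHeavy (count : τ → ℕ) (m : ℕ) : List ι → Exec ι (Option ι)
  | [] => ret none
  | x :: l =>
    (foldE (fun (s : ℝ) j => (ticks 1).bind fun _ => ret (s + ((count j : ℝ) - 1) / I.t))
      (I.tok x) 0).bind fun s =>
    (ticks 1).bind fun _ =>
    if (1 - I.eps) * I.lam < 1 / ((m : ℝ) - 1) * s then ret (some x)
    else findHeavy count m l

open scoped Classical in
/-- The recursion of `BruteForce`; the first argument bounds `|S|` (the recursive call is on a set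
with one point less). The dictionary `count` occupies at most two words per token occurrence and
is released before the recursive call. -/
def bruteForceAux : ℕ → List ι → Exec ι (List ι)
  | 0, S => (ticks 1).bind fun _ => (bruteForcePairs I S).bind fun _ => ret []
  | m + 1, S => (ticks 1).bind fun _ =>
    if S.length ≤ I.limit then (bruteForcePairs I S).bind fun _ => ret []
    else
      (hold (2 * (S.map fun x => (I.tok x).length).sum)
        ((countTokens I S).bind fun count => findHeavy I count S.length S)).bind fun found =>
      match found with
      | none => ret S
      | some x =>
        (bruteForcePoint I S x).bind fun _ =>
        (ticks S.length).bind fun _ =>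
        bruteForceAux m (S.erase x)

/-- `BruteForce(S, λ)`: the value is the set of points that have not been removed. -/
def bruteForce (S : List ι) : Exec ι (List ι) := bruteForceAux I S.length S

open scoped Classical in
/-- `S_j ← S_j ∪ {x}` in a dictionary that stores the nonempty sets `S_j` only. -/
def addToBucket (j : τ) (x : ι) : List (τ × List ι) → List (τ × List ι)
  | [] => [(j, [x])]
  | b :: B => if b.1 = j then (j, x :: b.2) :: B else b :: addToBucket j x B

open scoped Classical in
/-- The splitting step with hash function `r`. -/
def split (r : τ → ℝ) (S : List ι) : Exec ι (List (τ × List ι)) :=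
  foldE (fun B x =>
    foldE (fun B j => (ticks 1).bind fun _ =>
      if r j < 1 / (I.lam * (I.tok x).length) then
        (ticks 1).bind fun _ => ret (addToBucket j x B)
      else ret B) (I.tok x) B) S []

/-- `CPSJoin(S, λ)` at the node with path `p` of the recursion tree, where `r p` is the hash
function drawn at that node. The first argument bounds the recursion depth: calls below that depth
are cut off. The algorithm without cut-off is recovered by letting the bound tend to infinity, see
`totalTime` and the definitions after it. A call occupies memory for its own copy of `S`, the seed
of its hash function, and the sets `S_j`, until it returns. -/
def cpsJoin (r : List τ → τ → ℝ) : ℕ → List τ → List ι → Exec ι Unit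
  | 0, _, _ => ret ()
  | k + 1, p, S =>
    hold (S.length + 1) <|
      (ticks (S.length + 1)).bind fun _ =>
      (bruteForce I S).bind fun S' =>
      (split I (r p) S').bind fun B =>
      hold (B.map fun b => b.2.length + 1).sum
        (forEach B fun b => (ticks 1).bind fun _ => cpsJoin r k (p ++ [b.1]) b.2)

/-! ### LSHable similarity measures and the join algorithm -/

/-- A random hash function `h`, drawn from `ν`, with `Pr[h(x) = h(y)] = sim(x, y)` for all points
`x`, `y`. A similarity is LSHable if such a family exists. -/
def IsLSHFamily {X H β : Type*} [MeasurableSpace H] (ν : Measure H) (hash : H → X → β)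
    (sim : X → X → ℝ) : Prop :=
  ∀ x y, MeasurableSet {h | hash h x = hash h y} ∧ ν.real {h | hash h x = hash h y} = sim x y

section Join

variable {X H β : Type*}

/-- The input for `CPSJoin` on the points `pts 0, …, pts (n - 1)` after the embedding
`f(x) = {(i, h_i(x)) | i = 1, …, t}`, with `ε = log(1/λ) / log n`. -/
def embeddedInput (hash : H → X → β) (sim : X → X → ℝ) (lam : ℝ) (limit : ℕ) {n t : ℕ}
    (pts : Fin n → X) (g : Fin t → H) : Input (Fin n) (Fin t × β) where
  tok x := (List.finRange t).map fun i => (i, hash (g i) (pts x))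
  t := t
  sim x y := sim (pts x) (pts y)
  lam := lam
  limit := limit
  eps := Real.log (1 / lam) / Real.log n

/-- The random choices of the repetitions of `CPSJoin`: for every repetition, every node of the
recursion tree and every token, a number in `[0, 1]`. -/
abbrev Seeds (τ : Type*) : Type _ := ℕ × List τ × τ → unitInterval

/-- The seeds are independent and uniform. -/
def seedMeasure (τ : Type*) : Measure (Seeds τ) :=
  Measure.infinitePi fun _ => (volume : Measure unitInterval)

/-- Embed the points by the hash functions `g` (`n * t` hash evaluations, `n * t` words), then run
`R` repetitions of `CPSJoin`, all cut off at recursion depth `k`. -/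
def simJoin (hash : H → X → β) (sim : X → X → ℝ) (lam : ℝ) (limit : ℕ) (R : ℕ) {n t : ℕ}
    (pts : Fin n → X) (g : Fin t → H) (ω : Seeds (Fin t × β)) (k : ℕ) : Exec (Fin n) Unit :=
  hold (n * t) <|
    (ticks (n * t)).bind fun _ =>
    forEach (List.range R) fun i => (ticks 1).bind fun _ =>
      cpsJoin (embeddedInput hash sim lam limit pts g) (fun p j => (ω (i, p, j) : ℝ)) k []
        (List.finRange n)

end Join

/-- The running time without cut-off (`⊤` if the recursion does not terminate). -/
def totalTime {ι : Type*} (e : ℕ → Exec ι Unit) : ℝ≥0∞ := ⨆ k, ((e k).time : ℝ≥0∞)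

/-- The number of similarity computations without cut-off. -/
def totalCmps {ι : Type*} (e : ℕ → Exec ι Unit) : ℝ≥0∞ := ⨆ k, ((e k).cmps : ℝ≥0∞)

/-- The working space without cut-off. -/
def totalSpace {ι : Type*} (e : ℕ → Exec ι Unit) : ℝ≥0∞ := ⨆ k, ((e k).space : ℝ≥0∞)

/-- The output without cut-off. -/
def totalOut {ι : Type*} (e : ℕ → Exec ι Unit) : Set (ι × ι) := ⋃ k, (e k).out

/-- Expectation of a quantity that depends on `t` independent hash functions with law `ν` and on
the seeds, which are independent of the hash functions. -/
def expect {H : Type*} [MeasurableSpace H] (ν : Measure H) (t : ℕ) (τ : Type*)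
    (F : (Fin t → H) → Seeds τ → ℝ≥0∞) : ℝ≥0∞ :=
  ∫⁻ g, ∫⁻ ω, F g ω ∂(seedMeasure τ) ∂(Measure.pi fun _ => ν)

/-- Probability of an event in the same setting. -/
def prob {H : Type*} [MeasurableSpace H] (ν : Measure H) (t : ℕ) (τ : Type*)
    (E : (Fin t → H) → Seeds τ → Prop) : ℝ≥0∞ :=
  ∫⁻ g, seedMeasure τ {ω | E g ω} ∂(Measure.pi fun _ => ν)

/-- The self-join: all pairs of points with similarity at least `lam`. -/
def joinSet {X : Type*} (sim : X → X → ℝ) (lam : ℝ) {n : ℕ} (pts : Fin n → X) :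
    Set (Fin n × Fin n) :=
  {q | lam ≤ sim (pts q.1) (pts q.2)}

/-- The cost `∑ x, min_k (∑ y ≠ x, (sim(x, y) / λ) ^ k + (1 / λ) ^ k)` of the best choice of
individual stopping depths. -/
def individualCost {X : Type*} (sim : X → X → ℝ) (lam : ℝ) {n : ℕ} (pts : Fin n → X) : ℝ :=
  ∑ x, ⨅ k : ℕ,
    (∑ y ∈ Finset.univ.erase x, (sim (pts x) (pts y) / lam) ^ k + (1 / lam) ^ k)

end CPSJoin

end

noncomputable section

namespace CPSJoin

open Exec
open scoped Classical

/-! ### Cost accounting -/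

namespace Exec

variable {ι α σ : Type*}

/-! Write L = λt. A token is drawn at a node with probability 1/L, so a record has on average 1/λ
copies among the children of its call, and two records with m common tokens meet again in m/L
children. Tokens may recur on a path, so progress is measured by the number D of distinct tokens on
it. Absent removals, the expected number of nodes that hold both records when D first reaches k is
∏_{j<k} (m-j)/(L-j), a multiple of the binomial coefficient of m over k. Here m counts the indices i
with h_i(x) = h_i(y), so it is binomial, and its factorial moments bound the expectation over the
embedding by 2(sim/λ)^k, without any concentration.

Cost. Fix a stopping depth k for each record x. `pointPotential` charges to x its calls up to the
stage D = k, about (1/λ)^k of them, and a constant for every companion expected at that stage. If x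
is removed earlier, it is compared with |S|-1 points; heaviness and Jensen's inequality show that at
least a fraction exp(-4) of that many companions is expected at stage k (`heavy_sum_pairWeight`).
From stage k on, a record that is not heavy loses in expectation a fraction ε of its companions per
level, and this drift pays for its calls (`pointPotential_split`). Such a potential is a
supersolution of the recursion and so bounds the expected cost (`lintegral_treeCost_le`). The depths
are nearly optimal ones below log n / log(1/λ) (`exists_depth`). For the running time the drift must
pay for every call, which costs a factor 1/ε, of order log n.

Recall. By Chebyshev's inequality, a pair of similarity at least λ has overlap at least (1-1/K)L
with good probability once t is of order K². The calls that contain both points then behave like a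
branching process that is almost critical, which reaches generation K with probability at least
exp(-2)/(K+1) (`seedMeasure_missed_le`). On the other hand the expected number of pairs that are
together shrinks by 1-ε per level, so for K of order log² n it is unlikely that any call at depth K
has two points. Outside this event a pair that stays together has been reported, and R of order K
repetitions reach φ.

Space. The same bound on the depth limits the number of stack frames, each of O(nt) words
(`cpsJoin_space_le`). -/

@[simp] lemma ret_val (a : α) : (ret a : Exec ι α).val = a := rfl
@[simp] lemma ret_time (a : α) : (ret a : Exec ι α).time = 0 := rfl
@[simp] lemma ret_cmps (a : α) : (ret a : Exec ι α).cmps = 0 := rfl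
@[simp] lemma ret_space (a : α) : (ret a : Exec ι α).space = 0 := rfl
@[simp] lemma ret_out (a : α) : (ret a : Exec ι α).out = ∅ := rfl
@[simp] lemma bind_val (e : Exec ι α) (f : α → Exec ι σ) : (e.bind f).val = (f e.val).val := rfl
@[simp] lemma bind_time (e : Exec ι α) (f : α → Exec ι σ) :
    (e.bind f).time = e.time + (f e.val).time := rfl
@[simp] lemma bind_cmps (e : Exec ι α) (f : α → Exec ι σ) :
    (e.bind f).cmps = e.cmps + (f e.val).cmps := rfl
@[simp] lemma bind_space (e : Exec ι α) (f : α → Exec ι σ) :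
    (e.bind f).space = max e.space (f e.val).space := rfl
@[simp] lemma bind_out (e : Exec ι α) (f : α → Exec ι σ) :
    (e.bind f).out = e.out ∪ (f e.val).out := rfl
@[simp] lemma ticks_val (m : ℕ) : (ticks m : Exec ι Unit).val = () := rfl
@[simp] lemma ticks_time (m : ℕ) : (ticks m : Exec ι Unit).time = m := rfl
@[simp] lemma ticks_cmps (m : ℕ) : (ticks m : Exec ι Unit).cmps = 0 := rfl
@[simp] lemma ticks_space (m : ℕ) : (ticks m : Exec ι Unit).space = 0 := rfl
@[simp] lemma ticks_out (m : ℕ) : (ticks m : Exec ι Unit).out = ∅ := rfl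
@[simp] lemma similarity_val (s : ℝ) : (similarity s : Exec ι ℝ).val = s := rfl
@[simp] lemma similarity_time (s : ℝ) : (similarity s : Exec ι ℝ).time = 1 := rfl
@[simp] lemma similarity_cmps (s : ℝ) : (similarity s : Exec ι ℝ).cmps = 1 := rfl
@[simp] lemma similarity_space (s : ℝ) : (similarity s : Exec ι ℝ).space = 0 := rfl
@[simp] lemma similarity_out (s : ℝ) : (similarity s : Exec ι ℝ).out = ∅ := rfl
@[simp] lemma report_time (q : ι × ι) : (report q).time = 1 := rfl
@[simp] lemma report_cmps (q : ι × ι) : (report q).cmps = 0 := rfl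
@[simp] lemma report_space (q : ι × ι) : (report q).space = 0 := rfl
@[simp] lemma report_out (q : ι × ι) : (report q).out = {q} := rfl
@[simp] lemma hold_val (w : ℕ) (e : Exec ι α) : (hold w e).val = e.val := rfl
@[simp] lemma hold_time (w : ℕ) (e : Exec ι α) : (hold w e).time = e.time := rfl
@[simp] lemma hold_cmps (w : ℕ) (e : Exec ι α) : (hold w e).cmps = e.cmps := rfl
@[simp] lemma hold_space (w : ℕ) (e : Exec ι α) : (hold w e).space = w + e.space := rfl
@[simp] lemma hold_out (w : ℕ) (e : Exec ι α) : (hold w e).out = e.out := rfl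

lemma forEach_nil (f : α → Exec ι Unit) : forEach [] f = ret () := rfl

lemma forEach_cons (a : α) (l : List α) (f : α → Exec ι Unit) :
    forEach (a :: l) f = (f a).bind fun _ => forEach l f := rfl

lemma forEach_time (l : List α) (f : α → Exec ι Unit) :
    (forEach l f).time = (l.map fun a => (f a).time).sum := by
  induction l with
  | nil => rfl
  | cons a l ih => simp [forEach_cons, ih]

lemma forEach_cmps (l : List α) (f : α → Exec ι Unit) :
    (forEach l f).cmps = (l.map fun a => (f a).cmps).sum := by
  induction l with
  | nil => rfl
  | cons a l ih => simp [forEach_cons, ih]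

lemma mem_forEach_out (l : List α) (f : α → Exec ι Unit) (q : ι × ι) :
    q ∈ (forEach l f).out ↔ ∃ a ∈ l, q ∈ (f a).out := by
  induction l with
  | nil => simp [forEach_nil]
  | cons a l ih => simp [forEach_cons, ih]

lemma forEach_space_le {l : List α} {f : α → Exec ι Unit} {N : ℕ}
    (h : ∀ a ∈ l, (f a).space ≤ N) : (forEach l f).space ≤ N := by
  induction l with
  | nil => simp [forEach_nil]
  | cons a l ih =>
    simp only [forEach_cons, bind_space, max_le_iff]
    exact ⟨h a (by simp), ih fun b hb => h b (by simp [hb])⟩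

/-- When the cost of the body does not depend on the state, a loop is a `List.foldl` plus a sum of
costs; counting, scoring and splitting are all of this kind. -/
lemma foldE_eq {f : σ → α → Exec ι σ} {g : σ → α → σ} {T : α → ℕ}
    (h : ∀ s a, f s a = ⟨g s a, T a, 0, 0, ∅⟩) (l : List α) (s : σ) :
    foldE f l s = ⟨l.foldl g s, (l.map T).sum, 0, 0, ∅⟩ := by
  induction l generalizing s with
  | nil => rfl
  | cons a l ih => simp [foldE, h, bind, ih]

end Exec

/-! ### Regular inputs: token sets, overlaps, buckets -/

variable {ι τ : Type*}

/-- Every record has exactly `t` distinct tokens. -/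
structure Input.Regular (I : Input ι τ) : Prop where
  length_tok : ∀ x, (I.tok x).length = I.t
  nodup_tok : ∀ x, (I.tok x).Nodup

/-- The token set of a record. -/
def Input.tokens (I : Input ι τ) (x : ι) : Finset τ := (I.tok x).toFinset

/-- The number of common tokens of two records. -/
def Input.overlap (I : Input ι τ) (x y : ι) : ℕ := (I.tokens x ∩ I.tokens y).card

/-- All tokens that occur in a list of records. -/
def Input.tokensOf (I : Input ι τ) (S : List ι) : Finset τ := S.toFinset.biUnion I.tokens

/-- The records of `S` with token `j`, in the order in which the splitting step stores them. -/
def Input.bucket (I : Input ι τ) (S : List ι) (j : τ) : List ι :=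
  (S.filter fun x => j ∈ I.tok x).reverse

/-- The condition under which the brute force step removes `x` from `S`. -/
def Input.Heavy (I : Input ι τ) (S : List ι) (x : ι) : Prop :=
  (1 - I.eps) * I.lam <
    1 / ((S.length : ℝ) - 1) * ((∑ y ∈ S.toFinset.erase x, (I.overlap x y : ℝ)) / I.t)

variable {I : Input ι τ}

lemma Input.mem_tokens {x : ι} {j : τ} : j ∈ I.tokens x ↔ j ∈ I.tok x := by
  simp [Input.tokens]

lemma Input.Regular.card_tokens (hI : I.Regular) (x : ι) : (I.tokens x).card = I.t := by
  rw [Input.tokens, List.toFinset_card_of_nodup (hI.nodup_tok x), hI.length_tok]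

lemma Input.mem_bucket {S : List ι} {j : τ} {x : ι} :
    x ∈ I.bucket S j ↔ x ∈ S ∧ j ∈ I.tok x := by
  simp [Input.bucket]

lemma Input.nodup_bucket {S : List ι} (hS : S.Nodup) (j : τ) : (I.bucket S j).Nodup := by
  simpa [Input.bucket] using hS.filter _

lemma Input.length_bucket_le (S : List ι) (j : τ) : (I.bucket S j).length ≤ S.length := by
  simpa [Input.bucket] using List.length_filter_le _ S

/-! ### The brute force step -/

/-- Exactly one entry of a duplicate-free list is `x` itself, and only that one is skipped. -/
lemma bruteForcePoint_cmps_eq {S : List ι} {x : ι} (hS : S.Nodup) (hx : x ∈ S) :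
    (bruteForcePoint I S x).cmps + 1 = S.length := by
  have h0 : ∀ y, ((if y = x then report (x, x) else (similarity (I.sim x y)).bind fun s =>
      if I.lam ≤ s then (report (x, y)).bind fun _ => report (y, x) else ret () :
        Exec ι Unit)).cmps = if y = x then 0 else 1 := by
    intro y
    by_cases h1 : y = x <;> by_cases h2 : I.lam ≤ I.sim x y <;> simp [h1, h2]
  rw [bruteForcePoint, forEach_cmps]
  simp only [h0]
  have h1 : ∀ l : List ι, (l.map fun y => if y = x then 0 else 1).sum + l.count x = l.length := by
    intro l
    induction l with
    | nil => rfl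
    | cons a l ih =>
      simp only [List.map_cons, List.sum_cons, List.count_cons, List.length_cons, ← ih]
      by_cases h : a = x <;> simp [h] <;> omega
  rw [← h1 S, List.count_eq_one_of_mem hS hx]

lemma bruteForcePoint_time_le (S : List ι) (x : ι) :
    (bruteForcePoint I S x).time ≤ 3 * S.length := by
  rw [bruteForcePoint, forEach_time]
  refine (List.sum_le_card_nsmul _ 3 ?_).trans (by simp [mul_comm])
  simp only [List.mem_map]
  rintro _ ⟨y, -, rfl⟩
  by_cases h1 : y = x <;> by_cases h2 : I.lam ≤ I.sim x y <;> simp [h1, h2]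

lemma bruteForcePoint_space (S : List ι) (x : ι) : (bruteForcePoint I S x).space = 0 := by
  refine Nat.le_zero.1 (forEach_space_le fun y _ => ?_)
  by_cases h1 : y = x <;> by_cases h2 : I.lam ≤ I.sim x y <;> simp [h1, h2]

lemma mem_bruteForcePoint_out {S : List ι} {x : ι} {q : ι × ι} :
    q ∈ (bruteForcePoint I S x).out ↔
      (q = (x, x) ∧ x ∈ S) ∨
        ∃ y ∈ S, y ≠ x ∧ I.lam ≤ I.sim x y ∧ (q = (x, y) ∨ q = (y, x)) := by
  rw [bruteForcePoint, mem_forEach_out]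
  constructor
  · rintro ⟨y, hy, h⟩
    split_ifs at h with hyx
    · subst hyx
      exact Or.inl ⟨by simpa using h, hy⟩
    · right
      refine ⟨y, hy, hyx, ?_⟩
      simp only [bind_out, similarity_out, similarity_val] at h
      by_cases hl : I.lam ≤ I.sim x y
      · simp only [hl, if_true, bind_out, report_out, Set.empty_union, Set.mem_union,
          Set.mem_singleton_iff] at h
        exact ⟨hl, h⟩
      · simp [hl] at h
  · rintro (⟨rfl, hx⟩ | ⟨y, hy, hyx, hl, h⟩)
    · exact ⟨x, hx, by simp⟩
    · exact ⟨y, hy, by simpa [hyx, hl, or_comm] using h⟩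

lemma mem_bruteForcePairs_out {S : List ι} {q : ι × ι} :
    q ∈ (bruteForcePairs I S).out ↔ ∃ x ∈ S, q ∈ (bruteForcePoint I S x).out :=
  mem_forEach_out _ _ _

lemma bruteForcePairs_cmps {S : List ι} (hS : S.Nodup) :
    (bruteForcePairs I S).cmps = S.length * (S.length - 1) := by
  rw [bruteForcePairs, forEach_cmps, List.map_congr_left (g := fun _ => S.length - 1)]
  · simp
  · intro x hx
    have := bruteForcePoint_cmps_eq (I := I) hS hx
    omega

lemma bruteForcePairs_time_le (S : List ι) :
    (bruteForcePairs I S).time ≤ 3 * S.length * S.length := by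
  rw [bruteForcePairs, forEach_time]
  refine (List.sum_le_card_nsmul _ (3 * S.length) ?_).trans (by simp; nlinarith)
  simp only [List.mem_map]
  rintro _ ⟨y, -, rfl⟩
  exact bruteForcePoint_time_le _ _

lemma bruteForcePairs_space (S : List ι) : (bruteForcePairs I S).space = 0 :=
  Nat.le_zero.1 (forEach_space_le fun _ _ => (bruteForcePoint_space _ _).le)

lemma countTokens_eq (S : List ι) :
    countTokens I S = ⟨fun j => (S.map fun x => (I.tok x).count j).sum,
      (S.map fun x => (I.tok x).length).sum, 0, 0, ∅⟩ := by
  have hin : ∀ (l : List τ) (c : τ → ℕ),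
      l.foldl (fun c j => Function.update c j (c j + 1)) c = fun j => c j + l.count j := by
    intro l
    induction l with
    | nil => simp
    | cons a l ih =>
      intro c
      rw [List.foldl_cons, ih]
      funext j
      by_cases h : j = a
      · subst h; simp; omega
      · simp [h, Ne.symm h]
  have hout : ∀ (S : List ι) (c : τ → ℕ),
      S.foldl (fun c x => fun j => c j + (I.tok x).count j) c =
        fun j => c j + (S.map fun x => (I.tok x).count j).sum := by
    intro S
    induction S with
    | nil => simp
    | cons a l ih =>
      intro c
      rw [List.foldl_cons, ih]
      funext j
      simp [add_assoc]
  rw [countTokens, foldE_eq (g := fun c x => fun j => c j + (I.tok x).count j)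
    (T := fun x => (I.tok x).length), hout]
  · simp
  · intro c x
    rw [foldE_eq (g := fun c j => Function.update c j (c j + 1)) (T := fun _ => 1), hin]
    · simp
    · intro s a; simp [Exec.bind, ticks, ret]

/-- The quantity compared with the threshold by `findHeavy`. -/
def heavyScore (I : Input ι τ) (count : τ → ℕ) (x : ι) : ℝ :=
  ((I.tok x).map fun j => ((count j : ℝ) - 1) / I.t).sum

lemma findHeavy_cons (count : τ → ℕ) (m : ℕ) (x : ι) (l : List ι) :
    findHeavy I count m (x :: l) = (⟨(), (I.tok x).length + 1, 0, 0, ∅⟩ : Exec ι Unit).bind fun _ =>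
      if (1 - I.eps) * I.lam < 1 / ((m : ℝ) - 1) * heavyScore I count x then ret (some x)
      else findHeavy I count m l := by
  have hf : ∀ (l : List τ) (s : ℝ), l.foldl (fun s j => s + ((count j : ℝ) - 1) / I.t) s =
      s + (l.map fun j => ((count j : ℝ) - 1) / I.t).sum := by
    intro l
    induction l with
    | nil => simp
    | cons a l ih => intro s; simp [ih, add_assoc]
  rw [findHeavy, foldE_eq (g := fun s j => s + ((count j : ℝ) - 1) / I.t) (T := fun _ => 1), hf]
  · simp [heavyScore, Exec.bind, ticks, add_assoc]
  · intro s a; simp [Exec.bind, ticks, ret]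

lemma findHeavy_spec (count : τ → ℕ) (m : ℕ) (l : List ι) :
    (findHeavy I count m l).cmps = 0 ∧ (findHeavy I count m l).space = 0 ∧
    (findHeavy I count m l).out = ∅ ∧
    (findHeavy I count m l).time ≤ (l.map fun x => (I.tok x).length + 1).sum ∧
    ((findHeavy I count m l).val = none →
      ∀ x ∈ l, ¬ (1 - I.eps) * I.lam < 1 / ((m : ℝ) - 1) * heavyScore I count x) ∧
    (∀ x, (findHeavy I count m l).val = some x →
      x ∈ l ∧ (1 - I.eps) * I.lam < 1 / ((m : ℝ) - 1) * heavyScore I count x) := by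
  induction l with
  | nil => simp [findHeavy]
  | cons a l ih =>
    rw [findHeavy_cons]
    obtain ⟨h1, h2, h3, h4, h5, h6⟩ := ih
    by_cases h : (1 - I.eps) * I.lam < 1 / ((m : ℝ) - 1) * heavyScore I count a
    · simp only [h, if_true]
      refine ⟨by simp, by simp, by simp, by simp, by simp, ?_⟩
      simp only [bind_val, ret_val, Option.some.injEq, forall_eq', List.mem_cons, true_or, true_and]
      exact h
    · simp only [h, if_false]
      refine ⟨by simp [h1], by simp [h2], by simp [h3], ?_, ?_, ?_⟩
      · simp only [bind_time, List.map_cons, List.sum_cons]; omega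
      · intro hn x hx
        rcases List.mem_cons.1 hx with rfl | hx
        · exact h
        · exact h5 hn x hx
      · intro x hx
        exact ⟨List.mem_cons_of_mem _ (h6 x hx).1, (h6 x hx).2⟩

/-- Double counting: for a token `j` of `x`, `count j - 1` is the number of other records with `j`,
because no record lists a token twice. -/
lemma heavyScore_eq (hI : I.Regular) {S : List ι} (hS : S.Nodup) {x : ι} (hx : x ∈ S) :
    heavyScore I (fun j => (S.map fun x => (I.tok x).count j).sum) x =
      (∑ y ∈ S.toFinset.erase x, (I.overlap x y : ℝ)) / I.t := by
  have hc : ∀ j, (S.map fun x => (I.tok x).count j).sum =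
      ∑ y ∈ S.toFinset, if j ∈ I.tokens y then 1 else 0 := by
    intro j
    rw [← List.sum_toFinset _ hS]
    refine Finset.sum_congr rfl fun y _ => ?_
    rw [(hI.nodup_tok y).count]
    simp [Input.mem_tokens]
  have hxS : x ∈ S.toFinset := List.mem_toFinset.2 hx
  rw [heavyScore, ← List.sum_toFinset _ (hI.nodup_tok x), Finset.sum_div]
  change ∑ j ∈ I.tokens x, _ = _
  calc _ = ∑ j ∈ I.tokens x, ∑ y ∈ S.toFinset.erase x,
        (if j ∈ I.tokens y then (1 : ℝ) else 0) / I.t := by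
        refine Finset.sum_congr rfl fun j hj => ?_
        rw [← Finset.sum_div, hc, ← Finset.add_sum_erase _ _ hxS, if_pos hj]
        push_cast
        ring
    _ = _ := by
        rw [Finset.sum_comm]
        refine Finset.sum_congr rfl fun y _ => ?_
        rw [← Finset.sum_div, Finset.sum_boole, Input.overlap, Finset.filter_mem_eq_inter]

/-- One pass of the brute force step over `S` in search of a point to remove. -/
def search (I : Input ι τ) (S : List ι) : Exec ι (Option ι) :=
  hold (2 * (S.map fun x => (I.tok x).length).sum)
    ((countTokens I S).bind fun count => findHeavy I count S.length S)

lemma search_cmps (S : List ι) : (search I S).cmps = 0 := by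
  simp [search, countTokens_eq, (findHeavy_spec _ _ _).1]

lemma search_out (S : List ι) : (search I S).out = ∅ := by
  simp [search, countTokens_eq, (findHeavy_spec _ _ _).2.2.1]

lemma search_space (hI : I.Regular) (S : List ι) : (search I S).space = 2 * (S.length * I.t) := by
  simp [search, countTokens_eq, (findHeavy_spec _ _ _).2.1, hI.length_tok]

lemma search_time_le (hI : I.Regular) (S : List ι) :
    (search I S).time ≤ S.length * (2 * I.t + 1) := by
  have := (findHeavy_spec (I := I) (fun j => (S.map fun x => (I.tok x).count j).sum) S.length
    S).2.2.2.1
  simp only [hI.length_tok, List.map_const', List.sum_replicate, smul_eq_mul] at this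
  simp only [search, countTokens_eq, hold_time, bind_time, hI.length_tok, List.map_const',
    List.sum_replicate, smul_eq_mul]
  linarith

lemma search_none (hI : I.Regular) {S : List ι} (hS : S.Nodup) (h : (search I S).val = none) :
    ∀ x ∈ S, ¬ I.Heavy S x := by
  intro x hx
  have := (findHeavy_spec (I := I) (fun j => (S.map fun x => (I.tok x).count j).sum) S.length
    S).2.2.2.2.1
    (by simpa [search, countTokens_eq] using h) x hx
  rwa [heavyScore_eq hI hS hx] at this

lemma search_some (hI : I.Regular) {S : List ι} (hS : S.Nodup) {x : ι}
    (h : (search I S).val = some x) : x ∈ S ∧ I.Heavy S x := by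
  have := (findHeavy_spec (I := I) (fun j => (S.map fun x => (I.tok x).count j).sum) S.length
    S).2.2.2.2.2
    x (by simpa [search, countTokens_eq] using h)
  rw [heavyScore_eq hI hS this.1] at this
  exact this

/-- Induction along a run of the brute force step. -/
theorem bruteForce_induction (hI : I.Regular) {motive : List ι → Exec ι (List ι) → Prop}
    (base : ∀ S : List ι, S.Nodup → S.length ≤ I.limit →
      motive S ((ticks 1).bind fun _ => (bruteForcePairs I S).bind fun _ => ret []))
    (none : ∀ S : List ι, S.Nodup → I.limit < S.length → (∀ x ∈ S, ¬ I.Heavy S x) →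
      motive S ((ticks 1).bind fun _ => (search I S).bind fun _ => ret S))
    (remove : ∀ (S : List ι) (x : ι) (e : Exec ι (List ι)), S.Nodup → I.limit < S.length → x ∈ S →
      I.Heavy S x → motive (S.erase x) e →
      motive S ((ticks 1).bind fun _ => (search I S).bind fun _ =>
        (bruteForcePoint I S x).bind fun _ => (ticks S.length).bind fun _ => e))
    (S : List ι) (hS : S.Nodup) : motive S (bruteForce I S) := by
  -- The fuel equals the length throughout, so fuel `0` means an empty list, an instance of the base
  -- case and not a cut-off.
  suffices h : ∀ (m : ℕ) (S : List ι), S.length = m → S.Nodup → motive S (bruteForceAux I m S) from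
    h _ S rfl hS
  intro m
  induction m with
  | zero =>
    intro S hm hS
    exact base S hS (by omega)
  | succ m ih =>
    intro S hm hS
    rw [bruteForceAux]
    by_cases hl : S.length ≤ I.limit
    · simp only [hl, if_true]
      exact base S hS hl
    · simp only [hl, if_false]
      push Not at hl
      change motive S ((ticks 1).bind fun _ => (search I S).bind _)
      rcases hv : (search I S).val with _ | x
      · have := none S hS hl (search_none hI hS hv)
        simpa only [Exec.bind, hv] using this
      · obtain ⟨hx, hh⟩ := search_some hI hS hv
        have := remove S x _ hS hl hx hh (ih (S.erase x) (by
          rw [List.length_erase_of_mem hx]; omega) (hS.erase x))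
        simpa only [Exec.bind, hv] using this

/-- The loop ends either in the limit case, with no survivor, or with a pass that finds no heavy
point in a list above the limit. All estimates on survivors start from this dichotomy. -/
lemma bruteForce_val (hI : I.Regular) {S : List ι} (hS : S.Nodup) :
    (bruteForce I S).val.Sublist S ∧ ((bruteForce I S).val = [] ∨
      (I.limit < (bruteForce I S).val.length ∧
        ∀ x ∈ (bruteForce I S).val, ¬ I.Heavy (bruteForce I S).val x)) := by
  refine bruteForce_induction hI (motive := fun S e => e.val.Sublist S ∧ (e.val = [] ∨
    (I.limit < e.val.length ∧ ∀ x ∈ e.val, ¬ I.Heavy e.val x))) ?_ ?_ ?_ S hS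
  · intro S _ _
    simp
  · intro S _ hl h
    exact ⟨List.Sublist.refl _, Or.inr ⟨hl, h⟩⟩
  · intro S x e _ _ _ _ h
    exact ⟨h.1.trans List.erase_sublist, h.2⟩

/-- The dictionary of a pass is released before the next pass, so the passes contribute a maximum
and not a sum. -/
lemma bruteForce_space_le (hI : I.Regular) {S : List ι} (hS : S.Nodup) :
    (bruteForce I S).space ≤ 2 * (S.length * I.t) := by
  refine bruteForce_induction hI (motive := fun S e => e.space ≤ 2 * (S.length * I.t))
    ?_ ?_ ?_ S hS
  · intro S _ _
    simp [bruteForcePairs_space]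
  · intro S _ hl h
    simp [search_space hI]
  · intro S x e _ _ hx _ h
    have : (S.erase x).length ≤ S.length := List.length_erase_le
    have := Nat.mul_le_mul_right I.t this
    simp only [bind_space, ticks_space, search_space hI, bruteForcePoint_space]
    omega

/-- A removal lowers the number of points plus the outstanding comparisons by exactly `S.length`, in
proportion to the steps of the search before it. A last pass without removal is charged to the
points. -/
lemma bruteForce_time_le (hI : I.Regular) {S : List ι} (hS : S.Nodup) :
    (bruteForce I S).time ≤ (2 * I.t + 6) * (S.length + (bruteForce I S).cmps) + 1 := by
  refine bruteForce_induction hI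
    (motive := fun S e => e.time ≤ (2 * I.t + 6) * (S.length + e.cmps) + 1) ?_ ?_ ?_ S hS
  · intro S hS _
    have := bruteForcePairs_time_le (I := I) S
    have h2 : (bruteForcePairs I S).time ≤ 6 * (S.length + S.length * (S.length - 1)) := by
      refine this.trans ?_
      rcases S.length with _ | l
      · simp
      · simp only [Nat.add_sub_cancel]; nlinarith
    simp only [bind_time, ticks_time, ret_time, bind_cmps, ticks_cmps, bruteForcePairs_cmps hS,
      ret_cmps, zero_add, add_zero]
    nlinarith [Nat.zero_le (I.t * (S.length + S.length * (S.length - 1)))]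
  · intro S _ hl h
    have := search_time_le hI S
    simp only [bind_time, ticks_time, ret_time, bind_cmps, ticks_cmps, search_cmps, ret_cmps]
    nlinarith
  · intro S x e hS hl hx _ h
    have h1 := search_time_le hI S
    have h2 := bruteForcePoint_time_le (I := I) S x
    have h3 := bruteForcePoint_cmps_eq (I := I) hS hx
    have h4 : (S.erase x).length + 1 = S.length := by
      rw [List.length_erase_of_mem hx]; have := List.length_pos_of_mem hx; omega
    simp only [bind_time, ticks_time, bind_cmps, ticks_cmps, search_cmps]
    nlinarith

/-- Every pair reported by the brute force step passed the comparison or is a point paired with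
itself. -/
lemma bruteForce_out_sound (hI : I.Regular) {S : List ι} (hS : S.Nodup) {q : ι × ι}
    (hq : q ∈ (bruteForce I S).out) :
    q.1 = q.2 ∨ I.lam ≤ I.sim q.1 q.2 ∨ I.lam ≤ I.sim q.2 q.1 := by
  have hpt : ∀ {S : List ι} {x : ι}, q ∈ (bruteForcePoint I S x).out →
      q.1 = q.2 ∨ I.lam ≤ I.sim q.1 q.2 ∨ I.lam ≤ I.sim q.2 q.1 := by
    intro S x h
    rcases mem_bruteForcePoint_out.1 h with ⟨rfl, _⟩ | ⟨y, _, _, hl, rfl | rfl⟩ <;> simp [*]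
  revert hq
  refine bruteForce_induction hI (motive := fun S e => q ∈ e.out →
    q.1 = q.2 ∨ I.lam ≤ I.sim q.1 q.2 ∨ I.lam ≤ I.sim q.2 q.1) ?_ ?_ ?_ S hS
  · intro S _ _ h
    simp only [bind_out, ticks_out, ret_out, Set.empty_union, Set.union_empty] at h
    obtain ⟨x, _, h⟩ := mem_bruteForcePairs_out.1 h
    exact hpt h
  · intro S _ hl _ h
    simp [search_out] at h
  · intro S x e _ _ hx _ ih h
    simp only [bind_out, ticks_out, search_out, Set.empty_union, Set.mem_union] at h
    rcases h with h | h
    · exact hpt h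
    · exact ih h

/-- A similar pair in `S` is reported by the brute force step unless both points survive it. -/
lemma bruteForce_out_complete (hI : I.Regular) {S : List ι} (hS : S.Nodup) {x y : ι}
    (hx : x ∈ S) (hy : y ∈ S) (hxy : I.lam ≤ I.sim x y) (hyx : I.lam ≤ I.sim y x) :
    (x, y) ∈ (bruteForce I S).out ∨ (x ∈ (bruteForce I S).val ∧ y ∈ (bruteForce I S).val) := by
  have hpt : ∀ {S : List ι}, x ∈ S → y ∈ S → (x, y) ∈ (bruteForcePoint I S x).out ∧
      (x, y) ∈ (bruteForcePoint I S y).out := by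
    intro S hx hy
    simp only [mem_bruteForcePoint_out]
    by_cases h : y = x
    · subst h; simp [hx]
    · exact ⟨Or.inr ⟨y, hy, h, hxy, Or.inl rfl⟩, Or.inr ⟨x, hx, Ne.symm h, hyx, Or.inr rfl⟩⟩
  revert hx hy
  refine bruteForce_induction hI (motive := fun S e => x ∈ S → y ∈ S →
    (x, y) ∈ e.out ∨ (x ∈ e.val ∧ y ∈ e.val)) ?_ ?_ ?_ S hS
  · intro S _ _ hx hy
    left
    simp only [bind_out, ticks_out, ret_out, Set.empty_union, Set.union_empty]
    exact mem_bruteForcePairs_out.2 ⟨x, hx, (hpt hx hy).1⟩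
  · intro S _ hl _ hx hy
    exact Or.inr ⟨hx, hy⟩
  · intro S z e hS _ hz _ ih hx hy
    simp only [bind_out, ticks_out, search_out, Set.empty_union, Set.mem_union, bind_val]
    by_cases hzx : x = z
    · subst hzx; exact Or.inl (Or.inl (hpt hx hy).1)
    by_cases hzy : y = z
    · subst hzy; exact Or.inl (Or.inl (hpt hx hy).2)
    rcases ih ((List.mem_erase_of_ne hzx).2 hx) ((List.mem_erase_of_ne hzy).2 hy) with h | h
    · exact Or.inl (Or.inr h)
    · exact Or.inr h

/-! ### The splitting step -/

/-- The set stored under key `j`, empty if there is none. -/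
def lookupBucket (j : τ) : List (τ × List ι) → List ι
  | [] => []
  | b :: B => if b.1 = j then b.2 else lookupBucket j B

lemma lookupBucket_addToBucket (j j' : τ) (x : ι) (B : List (τ × List ι)) :
    lookupBucket j' (addToBucket j x B) =
      if j' = j then x :: lookupBucket j B else lookupBucket j' B := by
  induction B with
  | nil =>
    by_cases h : j' = j
    · subst h; simp [addToBucket, lookupBucket]
    · simp [addToBucket, lookupBucket, h, Ne.symm h]
  | cons b B ih =>
    rw [addToBucket]
    by_cases hb : b.1 = j
    · subst hb
      by_cases h : j' = b.1
      · subst h; simp [lookupBucket]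
      · simp [lookupBucket, h, Ne.symm h]
    · simp only [hb, if_false, lookupBucket, ih]
      by_cases h : j' = j
      · subst h; simp [hb]
      · simp [h]

lemma keys_addToBucket (j : τ) (x : ι) (B : List (τ × List ι)) :
    (addToBucket j x B).map Prod.fst =
      if j ∈ B.map Prod.fst then B.map Prod.fst else B.map Prod.fst ++ [j] := by
  induction B with
  | nil => simp [addToBucket]
  | cons b B ih =>
    rw [addToBucket]
    by_cases hb : b.1 = j
    · subst hb; simp
    · simp only [hb, if_false, List.map_cons, ih, List.mem_cons, Ne.symm hb, false_or]
      split_ifs <;> simp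

lemma eq_lookupBucket {B : List (τ × List ι)} (hB : (B.map Prod.fst).Nodup) {b : τ × List ι}
    (hb : b ∈ B) : b.2 = lookupBucket b.1 B := by
  induction B with
  | nil => simp at hb
  | cons a B ih =>
    rw [List.map_cons, List.nodup_cons] at hB
    rcases List.mem_cons.1 hb with rfl | hb
    · simp [lookupBucket]
    · have : a.1 ≠ b.1 := fun h => hB.1 (h ▸ List.mem_map_of_mem hb)
      simp [lookupBucket, this, ih hB.2 hb]

/-- The effect of one record on the dictionary of the splitting step. -/
def splitRecord (I : Input ι τ) (r : τ → ℝ) (B : List (τ × List ι)) (x : ι) : List (τ × List ι) :=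
  (I.tok x).foldl (fun B j => if r j < 1 / (I.lam * (I.tok x).length) then addToBucket j x B else B) B

lemma split_eq (r : τ → ℝ) (S : List ι) :
    split I r S = ⟨S.foldl (splitRecord I r) [], (S.map fun x => ((I.tok x).map fun j =>
      if r j < 1 / (I.lam * (I.tok x).length) then 2 else 1).sum).sum, 0, 0, ∅⟩ := by
  rw [split, foldE_eq]
  intro B x
  rw [foldE_eq (g := fun B j =>
    if r j < 1 / (I.lam * (I.tok x).length) then addToBucket j x B else B)
    (T := fun j => if r j < 1 / (I.lam * (I.tok x).length) then 2 else 1)]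
  · rfl
  · intro B j
    split_ifs <;> simp [Exec.bind, ticks, ret]

lemma splitRecord_spec (hI : I.Regular) (r : τ → ℝ) (B : List (τ × List ι)) (x : ι)
    (hB : (B.map Prod.fst).Nodup) :
    ((splitRecord I r B x).map Prod.fst).Nodup ∧
    (∀ j, j ∈ (splitRecord I r B x).map Prod.fst ↔
      j ∈ B.map Prod.fst ∨ (j ∈ I.tok x ∧ r j < 1 / (I.lam * I.t))) ∧
    ∀ j, lookupBucket j (splitRecord I r B x) =
      if j ∈ I.tok x ∧ r j < 1 / (I.lam * I.t) then x :: lookupBucket j B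
      else lookupBucket j B := by
  rw [splitRecord, hI.length_tok]
  have hnd := hI.nodup_tok x
  revert hnd
  generalize I.tok x = l, 1 / (I.lam * (I.t : ℝ)) = c
  induction l generalizing B with
  | nil => simp [hB]
  | cons a l ih =>
    intro hnd
    rw [List.nodup_cons] at hnd
    rw [List.foldl_cons]
    by_cases ha : r a < c
    · simp only [ha, if_true]
      obtain ⟨h1, h2, h3⟩ := ih (addToBucket a x B) (by
        rw [keys_addToBucket]
        split_ifs with h
        · exact hB
        · exact List.nodup_append.2 ⟨hB, by simp, by
            intro c hc d hd; simp at hd; subst hd; exact fun e => h (e ▸ hc)⟩) hnd.2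
      refine ⟨h1, fun j => ?_, fun j => ?_⟩
      · rw [h2, keys_addToBucket]
        by_cases hj : j = a
        · subst hj; split_ifs with h <;> simp [ha, h]
        · split_ifs with h <;> simp [hj]
      · rw [h3, lookupBucket_addToBucket]
        by_cases hj : j = a
        · subst hj; simp [hnd.1, ha]
        · simp [hj]
    · simp only [ha, if_false]
      obtain ⟨h1, h2, h3⟩ := ih B hB hnd.2
      refine ⟨h1, fun j => ?_, fun j => ?_⟩
      · rw [h2]
        by_cases hj : j = a
        · subst hj; simp [ha]
        · simp [hj]
      · rw [h3]
        by_cases hj : j = a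
        · subst hj; simp [ha]
        · simp [hj]

lemma split_spec (hI : I.Regular) (r : τ → ℝ) (S : List ι) :
    ((split I r S).val.map Prod.fst).Nodup ∧
    (∀ j, j ∈ (split I r S).val.map Prod.fst ↔ j ∈ I.tokensOf S ∧ r j < 1 / (I.lam * I.t)) ∧
    ∀ b ∈ (split I r S).val, b.2 = I.bucket S b.1 := by
  -- Generalized over the initial dictionary. The contents are claimed for drawn tokens only, since
  -- `I.bucket` does not look at `r`.
  have key : ∀ (S : List ι) (B : List (τ × List ι)), (B.map Prod.fst).Nodup →
      ((S.foldl (splitRecord I r) B).map Prod.fst).Nodup ∧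
      (∀ j, j ∈ (S.foldl (splitRecord I r) B).map Prod.fst ↔ j ∈ B.map Prod.fst ∨
        ((∃ x ∈ S, j ∈ I.tok x) ∧ r j < 1 / (I.lam * I.t))) ∧
      ∀ j, r j < 1 / (I.lam * I.t) → lookupBucket j (S.foldl (splitRecord I r) B) =
        I.bucket S j ++ lookupBucket j B := by
    intro S
    induction S with
    | nil => intro B hB; simp [hB, Input.bucket]
    | cons x S ih =>
      intro B hB
      obtain ⟨k1, k2, k3⟩ := splitRecord_spec hI r B x hB
      obtain ⟨h1, h2, h3⟩ := ih _ k1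
      refine ⟨h1, fun j => ?_, fun j hj => ?_⟩
      · rw [List.foldl_cons, h2, k2]
        simp only [List.mem_cons, exists_eq_or_imp]
        tauto
      · rw [List.foldl_cons, h3 j hj, k3]
        revert hj
        generalize 1 / (I.lam * (I.t : ℝ)) = c
        intro hj
        by_cases hx : j ∈ I.tok x <;> simp [Input.bucket, hx, hj]
  obtain ⟨h1, h2, h3⟩ := key S [] (by simp)
  rw [split_eq]
  refine ⟨h1, fun j => ?_, fun b hb => ?_⟩
  · rw [h2]; simp [Input.tokensOf, Input.mem_tokens]
  · have hk := (h2 b.1).1 (List.mem_map_of_mem hb)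
    simp only [List.map_nil, List.not_mem_nil, false_or] at hk
    rw [eq_lookupBucket h1 hb, h3 _ hk.2]
    simp [lookupBucket]

/-- The sum runs over a token set that does not depend on `r`; the randomness sits in the
indicators, ready for linearity of expectation. -/
lemma sum_split (hI : I.Regular) {M : Type*} [AddCommMonoid M] (r : τ → ℝ) (S : List ι)
    (F : τ × List ι → M) :
    ((split I r S).val.map F).sum =
      ∑ j ∈ I.tokensOf S, if r j < 1 / (I.lam * I.t) then F (j, I.bucket S j) else 0 := by
  obtain ⟨h1, h2, h3⟩ := split_spec hI r S
  rw [← Finset.sum_filter]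
  have e : (split I r S).val.map F =
      ((split I r S).val.map Prod.fst).map fun j => F (j, I.bucket S j) := by
    rw [List.map_map]
    refine List.map_congr_left fun b hb => ?_
    simp only [Function.comp]
    rw [← h3 b hb]
  rw [e, ← List.sum_toFinset _ h1]
  refine Finset.sum_congr ?_ fun _ _ => rfl
  ext j
  rw [List.mem_toFinset, h2, Finset.mem_filter]

lemma mem_split (hI : I.Regular) (r : τ → ℝ) (S : List ι) (b : τ × List ι) :
    b ∈ (split I r S).val ↔
      b.1 ∈ I.tokensOf S ∧ r b.1 < 1 / (I.lam * I.t) ∧ b.2 = I.bucket S b.1 := by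
  obtain ⟨h1, h2, h3⟩ := split_spec hI r S
  constructor
  · intro hb
    have := (h2 b.1).1 (List.mem_map_of_mem hb)
    exact ⟨this.1, this.2, h3 b hb⟩
  · rintro ⟨a, c, d⟩
    obtain ⟨b', hb', e⟩ := List.mem_map.1 ((h2 b.1).2 ⟨a, c⟩)
    have : b' = b := Prod.ext e (by rw [h3 b' hb', d, e])
    exact this ▸ hb'

lemma split_time_le (hI : I.Regular) (r : τ → ℝ) (S : List ι) :
    (split I r S).time ≤ 2 * (S.length * I.t) := by
  rw [split_eq]
  refine (List.sum_le_card_nsmul _ (2 * I.t) ?_).trans (by simp; nlinarith)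
  simp only [List.mem_map]
  rintro _ ⟨x, -, rfl⟩
  refine (List.sum_le_card_nsmul _ 2 ?_).trans (by simp [hI.length_tok, mul_comm])
  simp only [List.mem_map]
  rintro _ ⟨j, -, rfl⟩
  split_ifs <;> simp

lemma split_space (r : τ → ℝ) (S : List ι) : (split I r S).space = 0 := by
  rw [split_eq]

lemma split_out (r : τ → ℝ) (S : List ι) : (split I r S).out = ∅ := by
  rw [split_eq]

lemma split_cmps (r : τ → ℝ) (S : List ι) : (split I r S).cmps = 0 := by
  rw [split_eq]

/-- Exchange of summation between tokens and records. -/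
lemma sum_tokensOf_bucket {M : Type*} [AddCommMonoid M] (S : List ι)
    (F : τ → ι → M) :
    ∑ j ∈ I.tokensOf S, ∑ x ∈ (I.bucket S j).toFinset, F j x =
      ∑ x ∈ S.toFinset, ∑ j ∈ I.tokens x, F j x := by
  refine Finset.sum_comm' fun j x => ?_
  simp only [List.mem_toFinset, Input.mem_bucket, Input.tokensOf, Finset.mem_biUnion,
    Input.mem_tokens]
  constructor
  · rintro ⟨-, h1, h2⟩; exact ⟨h2, h1⟩
  · rintro ⟨h2, h1⟩; exact ⟨⟨x, h1, h2⟩, h1, h2⟩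

lemma sum_length_bucket (hI : I.Regular) {S : List ι} (hS : S.Nodup) :
    ∑ j ∈ I.tokensOf S, (I.bucket S j).length = S.length * I.t := by
  have := sum_tokensOf_bucket (I := I) S (fun _ _ => 1)
  simp only [Finset.sum_const, smul_eq_mul, mul_one, hI.card_tokens,
    List.toFinset_card_of_nodup hS, List.toFinset_card_of_nodup (Input.nodup_bucket hS _)] at this
  exact this

lemma length_bucket_pos {S : List ι} {j : τ} (hj : j ∈ I.tokensOf S) :
    0 < (I.bucket S j).length := by
  simp only [Input.tokensOf, Finset.mem_biUnion, List.mem_toFinset, Input.mem_tokens] at hj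
  obtain ⟨x, hx, hj⟩ := hj
  exact List.length_pos_of_mem (Input.mem_bucket.2 ⟨hx, hj⟩)

/-- Only nonempty buckets are stored, so one extra word per bucket at most doubles the total. -/
lemma sum_split_le (hI : I.Regular) {S : List ι} (hS : S.Nodup) (r : τ → ℝ) :
    ((split I r S).val.map fun b => b.2.length + 1).sum ≤ 2 * (S.length * I.t) := by
  rw [sum_split hI]
  calc _ ≤ ∑ j ∈ I.tokensOf S, 2 * (I.bucket S j).length := by
        refine Finset.sum_le_sum fun j hj => ?_
        have := length_bucket_pos hj
        split_ifs <;> simp only [zero_le]; omega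
    _ = _ := by rw [← Finset.mul_sum, sum_length_bucket hI hS]

lemma length_split_le (hI : I.Regular) {S : List ι} (hS : S.Nodup) (r : τ → ℝ) :
    (split I r S).val.length ≤ S.length * I.t := by
  have h : (split I r S).val.length = ((split I r S).val.map fun _ => 1).sum := by simp
  rw [h, sum_split hI, ← sum_length_bucket hI hS]
  refine Finset.sum_le_sum fun j hj => ?_
  have := length_bucket_pos hj
  split_ifs <;> omega

/-! ### The recursion tree -/

/-- The total weight of the recursion tree cut off at depth `k`, where a call on `S` weighs
`node S` and a call that is cut off weighs `leaf S`. -/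
def treeCost (I : Input ι τ) (node leaf : List ι → ℕ) (r : List τ → τ → ℝ) :
    ℕ → List τ → List ι → ℕ
  | 0, _, S => leaf S
  | k + 1, p, S => node S +
      ∑ j ∈ I.tokensOf (bruteForce I S).val, if r p j < 1 / (I.lam * I.t) then
        treeCost I node leaf r k (p ++ [j]) (I.bucket (bruteForce I S).val j) else 0

/-- Comparisons in the brute force step of a call. -/
def callCmps (I : Input ι τ) (S : List ι) : ℕ := (bruteForce I S).cmps

/-- Number of points of a call plus the comparisons in its brute force step. -/
def callWork (I : Input ι τ) (S : List ι) : ℕ := S.length + (bruteForce I S).cmps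

/-- Number of ordered pairs of distinct points. -/
def orderedPairs (S : List ι) : ℕ := S.length * (S.length - 1)

lemma Input.Regular.nodup_bruteForce (hI : I.Regular) {S : List ι} (hS : S.Nodup) :
    (bruteForce I S).val.Nodup :=
  (bruteForce_val hI hS).1.nodup hS

/-- Leaves of weight zero make the cut-off costs increase with the depth, as monotone convergence
requires. -/
lemma treeCost_mono_depth (node : List ι → ℕ) (r : List τ → τ → ℝ) (k : ℕ) (p : List τ)
    (S : List ι) :
    treeCost I node (fun _ => 0) r k p S ≤ treeCost I node (fun _ => 0) r (k + 1) p S := by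
  induction k generalizing p S with
  | zero => simp [treeCost]
  | succ k ih =>
    rw [treeCost, treeCost]
    gcongr with j hj
    split_ifs
    · exact ih _ _
    · exact le_rfl

lemma cpsJoin_cmps (hI : I.Regular) (r : List τ → τ → ℝ) (k : ℕ) (p : List τ) (S : List ι) :
    (cpsJoin I r k p S).cmps = treeCost I (callCmps I) (fun _ => 0) r k p S := by
  induction k generalizing p S with
  | zero => rfl
  | succ k ih =>
    simp only [cpsJoin, treeCost, callCmps, hold_cmps, bind_cmps, ticks_cmps, split_cmps,
      forEach_cmps, ih, zero_add]
    rw [sum_split hI]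

/-- The constant is `2 t + 6` for the brute force step, `2 t` for splitting, `t` for the loop over
the buckets and `3` for copying and additive terms, which are charged to the points because there is
at least one. -/
lemma cpsJoin_time_le (hI : I.Regular) (r : List τ → τ → ℝ) (k : ℕ) (p : List τ) {S : List ι}
    (hS : S.Nodup) (hne : S ≠ []) :
    (cpsJoin I r k p S).time ≤ (5 * I.t + 9) * treeCost I (callWork I) (fun _ => 0) r k p S := by
  induction k generalizing p S with
  | zero => simp [cpsJoin, treeCost]
  | succ k ih =>
    simp only [cpsJoin, treeCost, callWork, hold_time, bind_time, ticks_time, forEach_time]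
    have hS' := hI.nodup_bruteForce hS
    have h1 := bruteForce_time_le hI hS
    have h2 := split_time_le hI (r p) (bruteForce I S).val
    have h3 := length_split_le hI hS' (r p)
    have hlen : (bruteForce I S).val.length ≤ S.length := (bruteForce_val hI hS).1.length_le
    have hlen' := Nat.mul_le_mul_right I.t hlen
    have hpos : 1 ≤ S.length := List.length_pos_of_ne_nil hne
    have h4 : ((split I (r p) (bruteForce I S).val).val.map fun b =>
        1 + (cpsJoin I r k (p ++ [b.1]) b.2).time).sum ≤
        (split I (r p) (bruteForce I S).val).val.length + (5 * I.t + 9) *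
        ∑ j ∈ I.tokensOf (bruteForce I S).val, if r p j < 1 / (I.lam * I.t) then
          treeCost I (callWork I) (fun _ => 0) r k (p ++ [j]) (I.bucket (bruteForce I S).val j)
          else 0 := by
      rw [List.sum_map_add]
      simp only [List.map_const', List.sum_replicate, smul_eq_mul, mul_one]
      rw [sum_split hI, Finset.mul_sum]
      gcongr with j hj
      split_ifs
      · exact ih _ (Input.nodup_bucket hS' j)
          (List.ne_nil_of_length_pos (length_bucket_pos hj))
      · simp
    set rest := ∑ j ∈ I.tokensOf (bruteForce I S).val, if r p j < 1 / (I.lam * I.t) then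
          treeCost I (callWork I) (fun _ => 0) r k (p ++ [j]) (I.bucket (bruteForce I S).val j)
          else 0
    change _ ≤ (5 * I.t + 9) * (S.length + (bruteForce I S).cmps + rest)
    have h5 : 0 ≤ I.t * (bruteForce I S).cmps := Nat.zero_le _
    nlinarith

lemma mem_cpsJoin_out_succ (hI : I.Regular) (r : List τ → τ → ℝ) (k : ℕ) (p : List τ)
    (S : List ι) (q : ι × ι) :
    q ∈ (cpsJoin I r (k + 1) p S).out ↔ q ∈ (bruteForce I S).out ∨
      ∃ j ∈ I.tokensOf (bruteForce I S).val, r p j < 1 / (I.lam * I.t) ∧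
        q ∈ (cpsJoin I r k (p ++ [j]) (I.bucket (bruteForce I S).val j)).out := by
  simp only [cpsJoin, hold_out, bind_out, ticks_out, split_out, Set.empty_union, Set.mem_union,
    mem_forEach_out, mem_split hI, Prod.exists]
  refine or_congr Iff.rfl ⟨?_, ?_⟩
  · rintro ⟨j, _, ⟨h1, h2, rfl⟩, h⟩
    exact ⟨j, h1, h2, h⟩
  · rintro ⟨j, h1, h2, h⟩
    exact ⟨j, _, ⟨h1, h2, rfl⟩, h⟩

lemma cpsJoin_out_sound (hI : I.Regular) (r : List τ → τ → ℝ) (k : ℕ) (p : List τ)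
    {S : List ι} (hS : S.Nodup) {q : ι × ι} (hq : q ∈ (cpsJoin I r k p S).out) :
    q.1 = q.2 ∨ I.lam ≤ I.sim q.1 q.2 ∨ I.lam ≤ I.sim q.2 q.1 := by
  induction k generalizing p S with
  | zero => simp [cpsJoin] at hq
  | succ k ih =>
    rcases (mem_cpsJoin_out_succ hI r k p S q).1 hq with h | ⟨j, _, _, h⟩
    · exact bruteForce_out_sound hI hS h
    · exact ih _ (Input.nodup_bucket (hI.nodup_bruteForce hS) j) h

/-- As `limit ≥ 1`, a call with at most one point has no children; recursion stops once no call has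
two points. -/
lemma bruteForce_val_eq_nil (hI : I.Regular) (hl : 1 ≤ I.limit) {S : List ι} (hS : S.Nodup)
    (h : S.length ≤ 1) : (bruteForce I S).val = [] := by
  obtain ⟨h1, h2 | h2⟩ := bruteForce_val hI hS
  · exact h2
  · have := h1.length_le
    omega

lemma treeCost_orderedPairs_eq_zero {r : List τ → τ → ℝ} {K : ℕ} {p : List τ}
    {S : List ι} (h : treeCost I (fun _ => 0) orderedPairs r (K + 1) p S = 0) {j : τ}
    (hj : j ∈ I.tokensOf (bruteForce I S).val) (hr : r p j < 1 / (I.lam * I.t)) :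
    treeCost I (fun _ => 0) orderedPairs r K (p ++ [j]) (I.bucket (bruteForce I S).val j) = 0 := by
  rw [treeCost, zero_add, Finset.sum_eq_zero_iff] at h
  exact (if_pos hr).symm.trans (h j hj)

/-- If no call at depth `K` has two points, the stack never has more than `K + 1` frames. -/
lemma cpsJoin_space_le (hI : I.Regular) (hl : 1 ≤ I.limit) (r : List τ → τ → ℝ) (n : ℕ) (K : ℕ)
    (k : ℕ) (p : List τ) {S : List ι} (hS : S.Nodup) (hn : S.length ≤ n)
    (h : treeCost I (fun _ => 0) orderedPairs r K p S = 0) :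
    (cpsJoin I r k p S).space ≤ (K + 1) * (n + 1 + 4 * (n * I.t)) := by
  induction K generalizing k p S with
  | zero =>
    cases k with
    | zero => simp [cpsJoin]
    | succ k =>
      have hS1 : S.length ≤ 1 := by
        simp only [treeCost, orderedPairs, mul_eq_zero] at h
        omega
      have h1 := bruteForce_space_le hI hS
      have h2 := Nat.mul_le_mul_right I.t hn
      simp only [cpsJoin, hold_space, bind_space, ticks_space, split_space,
        bruteForce_val_eq_nil hI hl hS hS1]
      simp only [split_eq, List.foldl_nil, forEach_nil, List.map_nil, List.sum_nil, ret_space]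
      omega
  | succ K ih =>
    cases k with
    | zero => simp [cpsJoin]
    | succ k =>
      have h1 := bruteForce_space_le hI hS
      have h2 := Nat.mul_le_mul_right I.t hn
      have hS' := hI.nodup_bruteForce hS
      have h3 := sum_split_le hI hS' (r p)
      have hlen : (bruteForce I S).val.length ≤ S.length := (bruteForce_val hI hS).1.length_le
      have hlen' := Nat.mul_le_mul_right I.t hlen
      have h4 : (forEach (split I (r p) (bruteForce I S).val).val fun b =>
          (ticks 1).bind fun _ => cpsJoin I r k (p ++ [b.1]) b.2).space ≤
          (K + 1) * (n + 1 + 4 * (n * I.t)) := by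
        refine forEach_space_le fun b hb => ?_
        obtain ⟨hj, hr, hb2⟩ := (mem_split hI _ _ _).1 hb
        simp only [bind_space, ticks_space, hb2, Nat.zero_max]
        exact ih k _ (Input.nodup_bucket hS' _)
          ((Input.length_bucket_le _ _).trans (hlen.trans hn))
          (treeCost_orderedPairs_eq_zero h hj hr)
      -- A frame has `n + 1` words for the copy and the seed, and at most `2 n t` for the brute
      -- force dictionary or, while the children run, for the buckets.
      simp only [cpsJoin, hold_space, bind_space, ticks_space, split_space]
      rw [add_mul (K + 1)]
      omega

/-! ### Product measures -/

section Product

variable {κ U : Type*} [MeasurableSpace U] (μ : Measure U) [IsProbabilityMeasure μ]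

/-- Merging two independent samples along a set of coordinates gives a sample. -/
lemma measurePreserving_piecewise (B : Set κ) :
    MeasurePreserving (fun z : (κ → U) × (κ → U) => B.piecewise z.1 z.2)
      ((Measure.infinitePi fun _ => μ).prod (Measure.infinitePi fun _ => μ))
      (Measure.infinitePi fun _ => μ) := by
  have hm : Measurable (fun z : (κ → U) × (κ → U) => B.piecewise z.1 z.2) := by
    refine measurable_pi_lambda _ fun a => ?_
    by_cases h : a ∈ B
    · simpa [h, Function.comp_def] using (measurable_pi_apply a).comp measurable_fst
    · simpa [h, Function.comp_def] using (measurable_pi_apply a).comp measurable_snd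
  refine ⟨hm, Measure.eq_infinitePi _ fun s t ht => ?_⟩
  rw [Measure.map_apply hm (MeasurableSet.pi s.countable_toSet fun i _ => ht i)]
  -- The preimage of a box is a product of two boxes, over the coordinates inside and outside `B`.
  have : (fun z : (κ → U) × (κ → U) => B.piecewise z.1 z.2) ⁻¹' (Set.pi s t) =
      (Set.pi (s.filter (· ∈ B)) t) ×ˢ (Set.pi (s.filter (· ∉ B)) t) := by
    ext z
    simp only [Set.mem_preimage, Set.mem_pi, Finset.mem_coe, Set.mem_prod, Finset.mem_filter]
    constructor
    · intro h
      refine ⟨fun i hi => ?_, fun i hi => ?_⟩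
      · simpa [hi.2] using h i hi.1
      · simpa [hi.2] using h i hi.1
    · rintro ⟨h1, h2⟩ i hi
      by_cases hB : i ∈ B
      · simpa [hB] using h1 i ⟨hi, hB⟩
      · simpa [hB] using h2 i ⟨hi, hB⟩
  rw [this, Measure.prod_prod, Measure.infinitePi_pi, Measure.infinitePi_pi,
    Finset.prod_filter_mul_prod_filter_not]
  · exact fun i _ => ht i
  · exact fun i _ => ht i

/-- On a sample merged along `B`, `f` sees only the first copy and `g` only the second, so the
integral over the product factorizes. -/
lemma lintegral_mul_of_dependsOn {B C : Set κ} (hBC : Disjoint B C) {f g : (κ → U) → ℝ≥0∞}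
    (hf : Measurable f) (hg : Measurable g) (hfB : DependsOn f B) (hgC : DependsOn g C) :
    ∫⁻ ω, f ω * g ω ∂(Measure.infinitePi fun _ => μ) =
      (∫⁻ ω, f ω ∂(Measure.infinitePi fun _ => μ)) *
        ∫⁻ ω, g ω ∂(Measure.infinitePi fun _ => μ) := by
  rw [← (measurePreserving_piecewise μ B).lintegral_comp
      (show Measurable fun ω => f ω * g ω from hf.mul hg),
    ← lintegral_prod_mul hf.aemeasurable hg.aemeasurable]
  refine lintegral_congr fun z => ?_
  congr 1
  · exact hfB fun i hi => by simp [hi]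
  · exact hgC fun i hi => by simp [Set.disjoint_right.1 hBC hi]

lemma lintegral_prod_of_dependsOn {J : Type*} (s : Finset J) {B : J → Set κ}
    (hB : ∀ i ∈ s, ∀ j ∈ s, i ≠ j → Disjoint (B i) (B j)) {f : J → (κ → U) → ℝ≥0∞}
    (hf : ∀ j ∈ s, Measurable (f j)) (hfB : ∀ j ∈ s, DependsOn (f j) (B j)) :
    ∫⁻ ω, ∏ j ∈ s, f j ω ∂(Measure.infinitePi fun _ => μ) =
      ∏ j ∈ s, ∫⁻ ω, f j ω ∂(Measure.infinitePi fun _ => μ) := by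
  induction s using Finset.induction_on with
  | empty => simp
  | insert a s ha ih =>
    simp only [Finset.prod_insert ha]
    rw [← ih (fun i hi j hj => hB i (by simp [hi]) j (by simp [hj]))
      (fun j hj => hf j (by simp [hj])) (fun j hj => hfB j (by simp [hj]))]
    refine lintegral_mul_of_dependsOn μ (B := B a) (C := ⋃ j ∈ s, B j) ?_ (hf a (by simp))
      (Finset.measurable_prod s fun j hj => hf j (by simp [hj])) (hfB a (by simp)) ?_
    · simp only [Set.disjoint_iUnion_right]
      intro j hj
      exact hB a (by simp) j (by simp [hj]) (fun h => ha (h ▸ hj))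
    · intro x y hxy
      refine Finset.prod_congr rfl fun j hj => hfB j (by simp [hj]) fun i hi => ?_
      exact hxy i (Set.mem_biUnion hj hi)

end Product

/-! ### The seeds of subtrees and repetitions -/

instance (τ : Type*) : IsProbabilityMeasure (seedMeasure τ) := by
  unfold seedMeasure; infer_instance

/-- The hash functions of repetition `i`. -/
def seedHash (i : ℕ) (ω : Seeds τ) : List τ → τ → ℝ := fun p j => (ω (i, p, j) : ℝ)

/-- The seeds used by repetition `i` in the subtree of node `p`. -/
def subtreeSeeds (i : ℕ) (p : List τ) : Set (ℕ × List τ × τ) := {s | s.1 = i ∧ p <+: s.2.1}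

lemma measurable_seedHash (i : ℕ) (p : List τ) (j : τ) :
    Measurable fun ω : Seeds τ => seedHash i ω p j :=
  measurable_subtype_coe.comp (measurable_pi_apply _)

lemma measurableSet_seedHash_lt (i : ℕ) (p : List τ) (j : τ) (c : ℝ) :
    MeasurableSet {ω : Seeds τ | seedHash i ω p j < c} :=
  measurableSet_lt (measurable_seedHash i p j) measurable_const

lemma seedMeasure_seedHash_lt (i : ℕ) (p : List τ) (j : τ) {c : ℝ} (h0 : 0 ≤ c) (h1 : c ≤ 1) :
    seedMeasure τ {ω : Seeds τ | seedHash i ω p j < c} = ENNReal.ofReal c := by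
  have := (measurePreserving_eval_infinitePi
    (fun _ : ℕ × List τ × τ => (volume : Measure unitInterval)) (i, p, j)).measure_preimage
    (s := Set.Iio ⟨c, h0, h1⟩) measurableSet_Iio.nullMeasurableSet
  rw [unitInterval.volume_Iio] at this
  exact this

lemma dependsOn_seedHash (i : ℕ) (p : List τ) (j : τ) (c : ℝ) :
    DependsOn (fun ω : Seeds τ => seedHash i ω p j < c) {(i, p, j)} := by
  intro x y h
  simp only [seedHash]
  rw [h _ rfl]

lemma subtreeSeeds_append_subset (i : ℕ) (p q : List τ) :
    subtreeSeeds i (p ++ q) ⊆ subtreeSeeds i p :=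
  fun _ h => ⟨h.1, (List.prefix_append p q).trans h.2⟩

lemma disjoint_singleton_subtreeSeeds (i : ℕ) (p : List τ) (j j' : τ) :
    Disjoint {(i, p, j)} (subtreeSeeds i (p ++ [j'])) := by
  rw [Set.disjoint_singleton_left]
  intro h
  have := h.2.length_le
  simp at this

lemma disjoint_subtreeSeeds (i : ℕ) (p : List τ) {j j' : τ} (hj : j ≠ j') :
    Disjoint (subtreeSeeds i (p ++ [j])) (subtreeSeeds i (p ++ [j'])) := by
  rw [Set.disjoint_left]
  rintro s ⟨-, h1⟩ ⟨-, h2⟩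
  have := List.prefix_of_prefix_length_le h1 h2 (by simp)
  have := this.eq_of_length (by simp)
  simp at this
  exact hj this

/-- Only seeds at extensions of `p` are read. With the disjointness lemmas above this makes the draw
at a node independent of the subtrees below it. -/
lemma treeCost_dependsOn (node leaf : List ι → ℕ) (i k : ℕ) (p : List τ) (S : List ι) :
    DependsOn (fun ω : Seeds τ => treeCost I node leaf (seedHash i ω) k p S)
      (subtreeSeeds i p) := by
  induction k generalizing p S with
  | zero => intro x y _; rfl
  | succ k ih =>
    intro x y h
    simp only [treeCost]
    congr 1
    refine Finset.sum_congr rfl fun j _ => ?_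
    have h1 : seedHash i x p j = seedHash i y p j := by
      simp only [seedHash]; rw [h (i, p, j) ⟨rfl, List.prefix_refl p⟩]
    have h2 := ih (p ++ [j]) (I.bucket (bruteForce I S).val j)
      (fun s hs => h s (subtreeSeeds_append_subset i p [j] hs))
    simp only at h2
    rw [h1, h2]

lemma measurable_treeCost (node leaf : List ι → ℕ) (i k : ℕ) (p : List τ) (S : List ι) :
    Measurable fun ω : Seeds τ => treeCost I node leaf (seedHash i ω) k p S := by
  induction k generalizing p S with
  | zero => exact measurable_const
  | succ k ih =>
    simp only [treeCost]
    refine measurable_const.add (Finset.measurable_sum _ fun j _ => ?_)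
    exact Measurable.ite (measurableSet_seedHash_lt i p j _) (ih _ _) measurable_const

/-! ### Expected weight of the recursion tree -/

/-- All records of the call at node `p` contain all tokens of `p`. -/
def ValidCall (I : Input ι τ) (p : List τ) (S : List ι) : Prop :=
  S.Nodup ∧ ∀ x ∈ S, ∀ j ∈ p, j ∈ I.tok x

lemma ValidCall.child (hI : I.Regular) {p : List τ} {S : List ι} (h : ValidCall I p S) (j : τ) :
    ValidCall I (p ++ [j]) (I.bucket (bruteForce I S).val j) := by
  refine ⟨Input.nodup_bucket (hI.nodup_bruteForce h.1) j, fun x hx j' hj' => ?_⟩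
  obtain ⟨hx, hj⟩ := Input.mem_bucket.1 hx
  rcases List.mem_append.1 hj' with hj' | hj'
  · exact h.2 x ((bruteForce_val hI h.1).1.subset hx) j' hj'
  · rw [List.mem_singleton] at hj'
    subst hj'
    exact hj

/-- A potential that dominates the leaves and pays for a call and, in expectation, for its children
dominates the expected weight of the recursion tree. -/
theorem lintegral_treeCost_le (hI : I.Regular) (hlt : 1 ≤ I.lam * I.t)
    (node leaf : List ι → ℕ) (Pot : ℕ → List τ → List ι → ℝ)
    (hPot : ∀ k p S, 0 ≤ Pot k p S)
    (hleaf : ∀ p S, ValidCall I p S → (leaf S : ℝ) ≤ Pot 0 p S)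
    (hstep : ∀ k p S, ValidCall I p S → (node S : ℝ) + 1 / (I.lam * I.t) *
      ∑ j ∈ I.tokensOf (bruteForce I S).val, Pot k (p ++ [j]) (I.bucket (bruteForce I S).val j) ≤
        Pot (k + 1) p S)
    (i k : ℕ) (p : List τ) (S : List ι) (h : ValidCall I p S) :
    ∫⁻ ω, (treeCost I node leaf (seedHash i ω) k p S : ℝ≥0∞) ∂(seedMeasure τ) ≤
      ENNReal.ofReal (Pot k p S) := by
  have hc0 : 0 ≤ 1 / (I.lam * I.t) := by positivity
  have hc1 : 1 / (I.lam * I.t) ≤ 1 := by rw [div_le_one (by linarith)]; exact hlt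
  induction k generalizing p S with
  | zero =>
    simp only [treeCost, lintegral_const, measure_univ, mul_one]
    rw [← ENNReal.ofReal_natCast]
    exact ENNReal.ofReal_le_ofReal (hleaf p S h)
  | succ k ih =>
    set S' := (bruteForce I S).val with hS'
    set c := 1 / (I.lam * I.t) with hc
    have hm : ∀ j, Measurable fun ω : Seeds τ =>
        (treeCost I node leaf (seedHash i ω) k (p ++ [j]) (I.bucket S' j) : ℝ≥0∞) :=
      fun j => (measurable_of_countable _).comp (measurable_treeCost _ _ _ _ _ _)
    have hind : ∀ j, Measurable
        ({ω : Seeds τ | seedHash i ω p j < c}.indicator (1 : Seeds τ → ℝ≥0∞)) :=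
      fun j => measurable_one.indicator (measurableSet_seedHash_lt i p j c)
    have hsum : ∀ ω : Seeds τ, (treeCost I node leaf (seedHash i ω) (k + 1) p S : ℝ≥0∞) =
        node S + ∑ j ∈ I.tokensOf S',
          {ω : Seeds τ | seedHash i ω p j < c}.indicator 1 ω *
            (treeCost I node leaf (seedHash i ω) k (p ++ [j]) (I.bucket S' j) : ℝ≥0∞) := by
      intro ω
      rw [treeCost]
      push_cast
      congr 1
      refine Finset.sum_congr rfl fun j _ => ?_
      by_cases hj : seedHash i ω p j < c
      · simp only [← hc, hj, if_true, Set.indicator, Set.mem_ofPred_eq, Pi.one_apply, one_mul]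
        rfl
      · simp only [← hc, hj, if_false, Set.indicator, Set.mem_ofPred_eq, zero_mul]
    simp only [hsum]
    rw [lintegral_add_left measurable_const, lintegral_finsetSum _ fun j _ =>
      (show Measurable fun ω => _ * _ from (hind j).mul (hm j))]
    simp only [lintegral_const, measure_univ, mul_one]
    calc _ ≤ ENNReal.ofReal (node S) + ∑ j ∈ I.tokensOf S',
          ENNReal.ofReal (c * Pot k (p ++ [j]) (I.bucket S' j)) := by
          rw [ENNReal.ofReal_natCast]
          gcongr with j hj
          -- Only the draw for `j` and the subtree below `p ++ [j]` have to be independent; siblings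
          -- are handled by linearity.
          have := lintegral_mul_of_dependsOn (volume : Measure unitInterval)
            (disjoint_singleton_subtreeSeeds i p j j) (hind j) (hm j) (by
              intro x y hxy
              have := dependsOn_seedHash i p j c hxy
              simp only [Set.indicator, Set.mem_ofPred_eq, this, Pi.one_apply]) (by
              intro x y hxy
              have := treeCost_dependsOn (I := I) node leaf i k (p ++ [j]) (I.bucket S' j) hxy
              simp only at this ⊢
              rw [this])
          rw [seedMeasure, this, ← seedMeasure,
            lintegral_indicator_one (measurableSet_seedHash_lt i p j c),
            seedMeasure_seedHash_lt i p j hc0 hc1, ENNReal.ofReal_mul hc0]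
          gcongr
          exact ih _ _ (h.child hI j)
      _ = ENNReal.ofReal (node S + c * ∑ j ∈ I.tokensOf S', Pot k (p ++ [j]) (I.bucket S' j)) := by
          rw [← ENNReal.ofReal_sum_of_nonneg (fun j _ => mul_nonneg hc0 (hPot _ _ _)),
            ← ENNReal.ofReal_add (by positivity)
              (Finset.sum_nonneg fun j _ => mul_nonneg hc0 (hPot _ _ _)), Finset.mul_sum]
      _ ≤ _ := ENNReal.ofReal_le_ofReal (hstep k p S h)

/-! ### The potential of a point -/

/-- Expected number of nodes below a given node, among those reached when the path has `k` distinct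
tokens for the first time, that contain both of two records with `m` common tokens, if the path of
the given node has `D` distinct tokens. Here `L = λ t`. -/
def pairWeight (L : ℝ) (k D m : ℕ) : ℝ := ∏ j ∈ Finset.Ico D k, ((m - j : ℕ) : ℝ) / (L - j)

lemma pairWeight_of_le (L : ℝ) {k D : ℕ} (h : k ≤ D) (m : ℕ) : pairWeight L k D m = 1 := by
  simp [pairWeight, Finset.Ico_eq_empty_of_le h]

lemma pairWeight_nonneg {L : ℝ} {k : ℕ} (hk : (k : ℝ) < L) (D m : ℕ) : 0 ≤ pairWeight L k D m := by
  refine Finset.prod_nonneg fun j hj => div_nonneg (Nat.cast_nonneg _) ?_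
  have : (j : ℝ) < k := by exact_mod_cast (Finset.mem_Ico.1 hj).2
  linarith

/-- Of the `m` common tokens, `D` repeat a token of the path and `m - D` advance it. This balance
determines the factor `(m - D) / (L - D)`. -/
lemma pairWeight_step {L : ℝ} {k D m : ℕ} (hk : (k : ℝ) < L) (hD : D < k) (hm : D ≤ m) :
    D * pairWeight L k D m + (m - D : ℝ) * pairWeight L k (D + 1) m = L * pairWeight L k D m := by
  have hDk : (D : ℝ) < k := by exact_mod_cast hD
  have h : pairWeight L k D m = ((m - D : ℝ) / (L - D)) * pairWeight L k (D + 1) m := by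
    rw [pairWeight, Finset.prod_eq_prod_Ico_succ_bot hD, Nat.cast_sub hm]
    rfl
  have hne : L - D ≠ 0 := by linarith
  rw [h]
  field_simp
  ring

/-- The number of distinct tokens on a path. -/
def distinct (p : List τ) : ℕ := p.toFinset.card

lemma distinct_append (p : List τ) (j : τ) :
    distinct (p ++ [j]) = if j ∈ p then distinct p else distinct p + 1 := by
  unfold distinct
  have : (p ++ [j]).toFinset = insert j p.toFinset := by ext; simp
  rw [this]
  split_ifs with h
  · rw [Finset.insert_eq_of_mem (List.mem_toFinset.2 h)]
  · rw [Finset.card_insert_of_notMem (by simpa using h)]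

/-- Children along a token that is already on the path stay at stage `D`, all others move to stage
`D + 1`. -/
lemma sum_distinct_append {p : List τ} {T : Finset τ} (hp : p.toFinset ⊆ T) (f : ℕ → ℝ) :
    ∑ j ∈ T, f (distinct (p ++ [j])) =
      distinct p * f (distinct p) + ((T.card : ℝ) - distinct p) * f (distinct p + 1) := by
  rw [← Finset.sum_sdiff hp, add_comm]
  congr 1
  · rw [Finset.sum_congr rfl (g := fun _ => f (distinct p))]
    · simp [distinct]
    · intro j hj
      rw [distinct_append, if_pos (List.mem_toFinset.1 hj)]
  · rw [Finset.sum_congr rfl (g := fun _ => f (distinct p + 1))]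
    · rw [Finset.sum_const, Finset.card_sdiff_of_subset hp, nsmul_eq_mul,
        Nat.cast_sub (Finset.card_le_card hp)]
      rfl
    · intro j hj
      rw [distinct_append, if_neg]
      simpa using (Finset.mem_sdiff.1 hj).2

/-- The potential of the record `x` in the call on `S` at node `p`: `a` pays for the calls that
contain `x`, the sum for the comparisons of `x` with other records. -/
def pointPotential (I : Input ι τ) (k : ℕ) (a : ℕ → ℝ) (c : ℝ) (p : List τ) (S : Finset ι)
    (x : ι) : ℝ :=
  a (distinct p) + c * ∑ y ∈ S.erase x, pairWeight (I.lam * I.t) k (distinct p) (I.overlap x y)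

/-- Conditions under which `pointPotential` pays for `w` units of work per record and call and for
all comparisons. -/
structure IsPotential (I : Input ι τ) (w : ℝ) (k : ℕ) (a : ℕ → ℝ) (c : ℝ) : Prop where
  lt_size : (k : ℝ) < I.lam * I.t
  weight_nonneg : 0 ≤ w
  one_le : 1 ≤ c
  weight_le : ∀ D, w ≤ a D
  eventually_const : ∀ D, k ≤ D → a D = a k
  split_lt : ∀ D < k, w + (D * a D + (I.t - D) * a (D + 1)) / (I.lam * I.t) ≤ a D
  split_ge : w + a k / I.lam ≤ a k + c * I.eps
  limit_le : ∀ D < k, w + (I.limit - 1) ≤ a D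
  heavy_le : ∀ (S : List ι) (x : ι) (D : ℕ), S.Nodup → x ∈ S → I.limit < S.length → I.Heavy S x →
    D < k → (S.length : ℝ) - 1 ≤
      c * ∑ y ∈ S.toFinset.erase x, pairWeight (I.lam * I.t) k D (I.overlap x y)

lemma ValidCall.toFinset_subset_tokens {p : List τ} {S : List ι} (h : ValidCall I p S) {x : ι}
    (hx : x ∈ S) : p.toFinset ⊆ I.tokens x := by
  intro j hj
  exact Input.mem_tokens.2 (h.2 x hx j (List.mem_toFinset.1 hj))

lemma card_toFinset_erase {S : List ι} (hS : S.Nodup) {x : ι} (hx : x ∈ S) :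
    ((S.toFinset.erase x).card : ℝ) = S.length - 1 := by
  rw [Finset.card_erase_of_mem (List.mem_toFinset.2 hx), List.toFinset_card_of_nodup hS,
    Nat.cast_sub (List.length_pos_of_mem hx), Nat.cast_one]

/-- The left side is the expected number of companions of `x`, summed over the child calls that
contain `x`. -/
lemma sum_overlap_le_of_not_heavy (hlt : 0 < I.lam * I.t) {S : List ι} {x : ι}
    (hlen : 1 < S.length) (h : ¬ I.Heavy S x) :
    (∑ y ∈ S.toFinset.erase x, (I.overlap x y : ℝ)) / (I.lam * I.t) ≤
      (1 - I.eps) * (S.length - 1) := by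
  have hlen' : (0 : ℝ) < S.length - 1 := by
    have : (1 : ℝ) < S.length := by exact_mod_cast hlen
    linarith
  have hlam : I.lam ≠ 0 := left_ne_zero_of_mul hlt.ne'
  have ht : (0 : ℝ) < I.t := lt_of_le_of_ne (Nat.cast_nonneg _) (right_ne_zero_of_mul hlt.ne').symm
  have hlam' : 0 < I.lam := pos_of_mul_pos_left hlt ht.le
  rw [Input.Heavy, not_lt, one_div, inv_mul_eq_div, div_le_iff₀ hlen', div_le_iff₀ ht] at h
  rw [div_le_iff₀ hlt]
  linarith

/-- The potential of a surviving record decreases in expectation by the weight of the call. -/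
lemma pointPotential_split (hI : I.Regular) (hl : 1 ≤ I.limit) {w : ℝ} {k : ℕ} {a : ℕ → ℝ} {c : ℝ}
    (hP : IsPotential I w k a c) (heps : 0 ≤ I.eps) {p : List τ} {S : List ι}
    (h : ValidCall I p S) {x : ι} (hx : x ∈ S) (hlen : I.limit < S.length)
    (hh : ¬ I.Heavy S x) :
    w + 1 / (I.lam * I.t) *
      ∑ j ∈ I.tokens x, pointPotential I k a c (p ++ [j]) (I.bucket S j).toFinset x ≤
        pointPotential I k a c p S.toFinset x := by
  set L := I.lam * I.t with hL
  have hL0 : 0 < L := lt_of_le_of_lt (Nat.cast_nonneg _) hP.lt_size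
  have hxp := h.toFinset_subset_tokens hx
  have hy : ∀ y ∈ S.toFinset.erase x, p.toFinset ⊆ I.tokens x ∩ I.tokens y := fun y hy =>
    Finset.subset_inter hxp (h.toFinset_subset_tokens
      (List.mem_toFinset.1 (Finset.mem_of_mem_erase hy)))
  have e : ∑ j ∈ I.tokens x, pointPotential I k a c (p ++ [j]) (I.bucket S j).toFinset x =
      (distinct p * a (distinct p) + ((I.t : ℝ) - distinct p) * a (distinct p + 1)) +
      c * ∑ y ∈ S.toFinset.erase x,
        (distinct p * pairWeight L k (distinct p) (I.overlap x y) +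
          ((I.overlap x y : ℝ) - distinct p) * pairWeight L k (distinct p + 1) (I.overlap x y)) := by
    simp only [pointPotential]
    rw [Finset.sum_add_distrib, sum_distinct_append hxp, hI.card_tokens, ← Finset.mul_sum]
    congr 2
    -- `y` is with `x` in the bucket of `j` exactly if `j` is a common token.
    rw [Finset.sum_comm' (t' := S.toFinset.erase x) (s' := fun y => I.tokens x ∩ I.tokens y)]
    · refine Finset.sum_congr rfl fun y hy' => ?_
      exact sum_distinct_append (hy y hy') fun D => pairWeight L k D (I.overlap x y)
    · intro j y
      simp only [Finset.mem_erase, List.mem_toFinset, Input.mem_bucket, Finset.mem_inter,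
        Input.mem_tokens]
      tauto
  rw [e, pointPotential]
  -- Before stage `k` the companion terms are preserved in expectation and only `a` has to pay `w`.
  -- From stage `k` on they are all `1`, and their sum shrinks by `1 - ε` because `x` is not heavy.
  rcases lt_or_ge (distinct p) k with hD | hD
  · rw [Finset.sum_congr rfl (g := fun y => L * pairWeight L k (distinct p) (I.overlap x y)),
      ← Finset.mul_sum]
    · have := hP.split_lt _ hD
      rw [← hL] at this
      have h2 : ∀ u v : ℝ, w + 1 / L * (u + c * (L * v)) = w + u / L + c * v := by
        intro u v; field_simp
        ring
      rw [h2]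
      linarith
    · intro y hy'
      exact pairWeight_step hP.lt_size hD (Finset.card_le_card (hy y hy'))
  · have hD1 : k ≤ distinct p + 1 := by omega
    simp only [pairWeight_of_le _ hD, pairWeight_of_le _ hD1, hP.eventually_const _ hD,
      hP.eventually_const _ hD1, mul_one]
    have hlen1 : 1 < S.length := by omega
    have h1 := sum_overlap_le_of_not_heavy hL0 hlen1 hh
    rw [← hL] at h1
    have hcard := card_toFinset_erase h.1 hx
    rw [Finset.sum_const, nsmul_eq_mul, hcard, mul_one]
    have h2 := hP.split_ge
    have hlen' : (2 : ℝ) ≤ S.length := by exact_mod_cast hlen1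
    have e2 : ∑ y ∈ S.toFinset.erase x, ((distinct p : ℝ) + ((I.overlap x y : ℝ) - distinct p)) =
        ∑ y ∈ S.toFinset.erase x, (I.overlap x y : ℝ) :=
      Finset.sum_congr rfl fun y _ => by ring
    have ht : (I.t : ℝ) ≠ 0 := right_ne_zero_of_mul hL0.ne'
    have hlam : I.lam ≠ 0 := left_ne_zero_of_mul hL0.ne'
    have e3 : 1 / L * ((distinct p * a k + ((I.t : ℝ) - distinct p) * a k) +
        c * ∑ y ∈ S.toFinset.erase x, (I.overlap x y : ℝ)) = a k / I.lam +
        c * ((∑ y ∈ S.toFinset.erase x, (I.overlap x y : ℝ)) / L) := by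
      rw [hL]; field_simp; ring
    rw [e2, e3]
    have hc : 0 ≤ c := by linarith [hP.one_le]
    have h3 := mul_le_mul_of_nonneg_left h1 hc
    -- The gain `c ε (|S| - 1)` covers the `c ε` of `split_ge` because `|S| ≥ 2`.
    nlinarith [mul_nonneg (mul_nonneg hc heps) (by linarith : (0 : ℝ) ≤ S.length - 2)]

/-- The sum of the potentials of the records of a call, each with its own parameters. -/
def callPotential (I : Input ι τ) (k : ι → ℕ) (a : ι → ℕ → ℝ) (c : ι → ℝ) (p : List τ)
    (S : List ι) : ℝ :=
  ∑ x ∈ S.toFinset, pointPotential I (k x) (a x) (c x) p S.toFinset x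

lemma pointPotential_mono {w : ℝ} {k : ℕ} {a : ℕ → ℝ} {c : ℝ} (hP : IsPotential I w k a c)
    (p : List τ) {S T : Finset ι} (h : S ⊆ T) (x : ι) :
    pointPotential I k a c p S x ≤ pointPotential I k a c p T x := by
  have hc : 0 ≤ c := by linarith [hP.one_le]
  unfold pointPotential
  gcongr
  exact fun y _ _ => pairWeight_nonneg hP.lt_size _ _

lemma pointPotential_nonneg {w : ℝ} {k : ℕ} {a : ℕ → ℝ} {c : ℝ} (hP : IsPotential I w k a c)
    (p : List τ) (S : Finset ι) (x : ι) : 0 ≤ pointPotential I k a c p S x := by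
  have hc : 0 ≤ c := by linarith [hP.one_le]
  exact add_nonneg (hP.weight_nonneg.trans (hP.weight_le _))
    (mul_nonneg hc (Finset.sum_nonneg fun y _ => pairWeight_nonneg hP.lt_size _ _))

/-- The potential pays for the brute force step. -/
lemma callPotential_bruteForce (hI : I.Regular) {w : ℝ} {k : ι → ℕ} {a : ι → ℕ → ℝ} {c : ι → ℝ}
    (hP : ∀ x, IsPotential I w (k x) (a x) (c x)) (p : List τ) {S : List ι} (hS : S.Nodup) :
    w * S.length + (bruteForce I S).cmps +
      (callPotential I k a c p (bruteForce I S).val - w * (bruteForce I S).val.length) ≤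
      callPotential I k a c p S := by
  refine bruteForce_induction hI (motive := fun S e => w * S.length + e.cmps +
      (callPotential I k a c p e.val - w * e.val.length) ≤ callPotential I k a c p S) ?_ ?_ ?_ S hS
  · intro S hS hl
    simp only [bind_cmps, ticks_cmps, bruteForcePairs_cmps hS, ret_cmps, bind_val, ret_val,
      List.length_nil, callPotential, List.toFinset_nil, Finset.sum_empty, zero_add, add_zero]
    have hcmp : ((S.length * (S.length - 1) : ℕ) : ℝ) = ∑ x ∈ S.toFinset, ((S.length : ℝ) - 1) := by
      rw [Finset.sum_const, List.toFinset_card_of_nodup hS, nsmul_eq_mul]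
      rcases S.length with _ | l <;> simp
    have hw : w * S.length = ∑ x ∈ S.toFinset, w := by
      rw [Finset.sum_const, List.toFinset_card_of_nodup hS, nsmul_eq_mul, mul_comm]
    rw [hcmp, hw, Nat.cast_zero, mul_zero, sub_zero, add_zero, ← Finset.sum_add_distrib]
    refine Finset.sum_le_sum fun x hx => ?_
    have hx := List.mem_toFinset.1 hx
    have hc : 0 ≤ c x := by linarith [(hP x).one_le]
    -- A call within the limit is paid by `a` before stage `k x`; afterwards every companion has
    -- weight `1` and `c x ≥ 1`.
    rcases lt_or_ge (distinct p) (k x) with hD | hD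
    · have h1 := (hP x).limit_le _ hD
      have h2 : 0 ≤ c x * ∑ y ∈ S.toFinset.erase x,
          pairWeight (I.lam * I.t) (k x) (distinct p) (I.overlap x y) :=
        mul_nonneg hc (Finset.sum_nonneg fun y _ => pairWeight_nonneg (hP x).lt_size _ _)
      have h3 : (S.length : ℝ) ≤ I.limit := by exact_mod_cast hl
      unfold pointPotential
      linarith
    · simp only [pointPotential, pairWeight_of_le _ hD, Finset.sum_const, nsmul_eq_mul, mul_one,
        card_toFinset_erase hS hx]
      have h1 := (hP x).weight_le (distinct p)
      have h3 : (1 : ℝ) ≤ S.length := by exact_mod_cast List.length_pos_of_mem hx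
      nlinarith [(hP x).one_le]
  · intro S hS hl h
    simp [search_cmps]
  · intro S x e hS hl hx hh ih
    have h1 : ((bruteForcePoint I S x).cmps : ℝ) = S.length - 1 := by
      rw [← bruteForcePoint_cmps_eq (I := I) hS hx]; push_cast; ring
    have h2 : ((S.erase x).length : ℝ) = S.length - 1 := by
      rw [List.length_erase_of_mem hx, Nat.cast_sub (List.length_pos_of_mem hx), Nat.cast_one]
    have hset : (S.erase x).toFinset = S.toFinset.erase x := by
      ext y; simp [hS.mem_erase_iff]
    -- The removal gives up the potential of `x` and, by monotonicity, does not raise that of the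
    -- others.
    have h3 : callPotential I k a c p (S.erase x) +
        pointPotential I (k x) (a x) (c x) p S.toFinset x ≤ callPotential I k a c p S := by
      rw [callPotential, callPotential, hset,
        ← Finset.add_sum_erase _ _ (List.mem_toFinset.2 hx), add_comm]
      gcongr with y hy
      exact pointPotential_mono (hP y) p (Finset.erase_subset _ _) y
    have h4 : w + ((S.length : ℝ) - 1) ≤ pointPotential I (k x) (a x) (c x) p S.toFinset x := by
      rcases lt_or_ge (distinct p) (k x) with hD | hD
      · have := (hP x).heavy_le S x _ hS hx hl hh hD
        have h1 := (hP x).weight_le (distinct p)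
        unfold pointPotential
        linarith
      · simp only [pointPotential, pairWeight_of_le _ hD, Finset.sum_const, nsmul_eq_mul, mul_one,
          card_toFinset_erase hS hx]
        have h1 := (hP x).weight_le (distinct p)
        have h3 : (1 : ℝ) ≤ S.length := by exact_mod_cast List.length_pos_of_mem hx
        nlinarith [(hP x).one_le]
    simp only [bind_cmps, ticks_cmps, search_cmps, bind_val]
    push_cast
    rw [h2] at ih
    linarith

/-- Expected weight of the recursion tree, in terms of the potential of the root. -/
theorem lintegral_treeCost_le_callPotential (hI : I.Regular) (hl : 1 ≤ I.limit)
    (hlt : 1 ≤ I.lam * I.t) (heps : 0 ≤ I.eps) {w : ℝ} {k : ι → ℕ} {a : ι → ℕ → ℝ} {c : ι → ℝ}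
    (hP : ∀ x, IsPotential I w (k x) (a x) (c x)) {node : List ι → ℕ}
    (hnode : ∀ S, (node S : ℝ) = w * S.length + (bruteForce I S).cmps)
    (i d : ℕ) {S : List ι} (hS : S.Nodup) :
    ∫⁻ ω, (treeCost I node (fun _ => 0) (seedHash i ω) d [] S : ℝ≥0∞) ∂(seedMeasure τ) ≤
      ENNReal.ofReal (callPotential I k a c [] S) := by
  have h0 : ∀ p S, 0 ≤ callPotential I k a c p S := fun p S =>
    Finset.sum_nonneg fun x _ => pointPotential_nonneg (hP x) _ _ _
  refine lintegral_treeCost_le hI hlt node (fun _ => 0) (fun _ => callPotential I k a c)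
    (fun _ => h0) (fun p S _ => by simpa using h0 p S) ?_ i d [] S ⟨hS, by simp⟩
  intro _ p S h
  have h1 := callPotential_bruteForce hI hP p h.1
  obtain ⟨hsub, hval⟩ := bruteForce_val hI h.1
  have hS' := hI.nodup_bruteForce h.1
  rw [hnode]
  -- Removed points and all comparisons are already paid; the splitting has to pay one `w` per
  -- survivor.
  suffices hs : w * (bruteForce I S).val.length + 1 / (I.lam * I.t) *
      ∑ j ∈ I.tokensOf (bruteForce I S).val,
        callPotential I k a c (p ++ [j]) (I.bucket (bruteForce I S).val j) ≤
        callPotential I k a c p (bruteForce I S).val by linarith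
  have h' : ValidCall I p (bruteForce I S).val := ⟨hS', fun x hx => h.2 x (hsub.subset hx)⟩
  generalize (bruteForce I S).val = T at *
  have e : ∑ j ∈ I.tokensOf T, callPotential I k a c (p ++ [j]) (I.bucket T j) =
      ∑ x ∈ T.toFinset, ∑ j ∈ I.tokens x,
        pointPotential I (k x) (a x) (c x) (p ++ [j]) (I.bucket T j).toFinset x :=
    sum_tokensOf_bucket T fun j x =>
      pointPotential I (k x) (a x) (c x) (p ++ [j]) (I.bucket T j).toFinset x
  have hw : w * T.length = ∑ x ∈ T.toFinset, w := by
    rw [Finset.sum_const, List.toFinset_card_of_nodup hS', nsmul_eq_mul, mul_comm]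
  rw [e, hw, Finset.mul_sum, ← Finset.sum_add_distrib, callPotential]
  refine Finset.sum_le_sum fun x hx => ?_
  have hx := List.mem_toFinset.1 hx
  rcases hval with rfl | ⟨hlen, hh⟩
  · simp at hx
  · exact pointPotential_split hI hl (hP x) heps h' hx hlen (hh x hx)

/-! ### Two potentials -/

lemma exp_neg_two_mul_le {u : ℝ} (h0 : 0 ≤ u) (h1 : u ≤ 1 / 2) : Real.exp (-(2 * u)) ≤ 1 - u := by
  rw [Real.exp_neg]
  have h2 : 1 + 2 * u ≤ Real.exp (2 * u) := by linarith [Real.add_one_le_exp (2 * u)]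
  calc (Real.exp (2 * u))⁻¹ ≤ (1 + 2 * u)⁻¹ := by gcongr
    _ ≤ 1 - u := by
      rw [inv_le_iff_one_le_mul₀ (by linarith)]
      nlinarith

/-- By convexity, the comparisons of a heavy point are paid for by what they would cost later. -/
lemma heavy_sum_pairWeight (hl : 1 ≤ I.limit) (heps : 0 ≤ I.eps) (heps' : I.eps ≤ 1 / 4) {k : ℕ}
    (hk : (k : ℝ) * I.eps ≤ 1) (hkt : 4 * (k : ℝ) ^ 2 < I.lam * I.t)
    {S : List ι} {x : ι} {D : ℕ} (hS : S.Nodup) (hx : x ∈ S) (hlen : I.limit < S.length)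
    (hh : I.Heavy S x) (hD : D < k) :
    (S.length : ℝ) - 1 ≤ Real.exp 4 *
      ∑ y ∈ S.toFinset.erase x, pairWeight (I.lam * I.t) k D (I.overlap x y) := by
  set L := I.lam * I.t with hL
  have hk1 : (1 : ℝ) ≤ k := by exact_mod_cast (by omega : 1 ≤ k)
  have hL0 : 0 < L := by nlinarith
  have hkL : (k : ℝ) < L := by nlinarith
  have ht : (0 : ℝ) < I.t := lt_of_le_of_ne (Nat.cast_nonneg _) (right_ne_zero_of_mul hL0.ne').symm
  have hlam : 0 < I.lam := pos_of_mul_pos_left hL0 ht.le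
  have hN : (0 : ℝ) < (S.length : ℝ) - 1 := by
    have : (1 : ℝ) < S.length := by exact_mod_cast (by omega : 1 < S.length)
    linarith
  have hcard := card_toFinset_erase hS hx
  set T := S.toFinset.erase x with hT
  set N := (S.length : ℝ) - 1 with hNdef
  -- Every factor `(m - j) / (L - j)` with `j < k` is at least `(m - k) / L` (truncated at `0`). A
  -- power of a single number replaces the product, so that convexity applies.
  set z : ι → ℝ := fun y => ((I.overlap x y - k : ℕ) : ℝ) / L with hz
  have hz0 : ∀ y, 0 ≤ z y := fun y => by positivity
  have hzG : ∀ y, z y ^ (k - D) ≤ pairWeight L k D (I.overlap x y) := by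
    intro y
    rw [pairWeight, ← Nat.card_Ico, ← Finset.prod_const]
    refine Finset.prod_le_prod (fun _ _ => hz0 y) fun j hj => ?_
    have hj := (Finset.mem_Ico.1 hj).2
    have hjk : (j : ℝ) < k := by exact_mod_cast hj
    simp only [hz]
    have h1 : ((I.overlap x y - k : ℕ) : ℝ) ≤ ((I.overlap x y - j : ℕ) : ℝ) := by
      exact_mod_cast (by omega : I.overlap x y - k ≤ I.overlap x y - j)
    have h2 : (0 : ℝ) ≤ j := Nat.cast_nonneg j
    exact div_le_div₀ (Nat.cast_nonneg _) h1 (by linarith) (by linarith)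
  -- The mean of `z` is at least `1 - u`: `ε` is due to heaviness, `k / L` to the shift by `k`. From
  -- `k ε ≤ 1` and `k² ≤ L` follows `k u ≤ 2`, hence the constant `exp 4`.
  set u := I.eps + k / L with hu
  have hkL' : (k : ℝ) / L ≤ 1 / 4 := by
    rw [div_le_iff₀ hL0]; nlinarith
  have hu0 : 0 ≤ u := by positivity
  have hu1 : u ≤ 1 / 2 := by linarith
  have hku : k * u ≤ 2 := by
    have : (k : ℝ) * (k / L) ≤ 1 := by
      rw [← mul_div_assoc, div_le_one hL0]; nlinarith
    rw [hu, mul_add]; linarith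
  have hmean : 1 - u ≤ ∑ y ∈ T, N⁻¹ * z y := by
    rw [Input.Heavy, one_div, inv_mul_eq_div, lt_div_iff₀ hN, lt_div_iff₀ ht] at hh
    have h1 : ∑ y ∈ T, ((I.overlap x y : ℝ) - k) / L ≤ ∑ y ∈ T, z y := by
      refine Finset.sum_le_sum fun y _ => ?_
      simp only [hz]
      gcongr
      rw [sub_le_iff_le_add]
      exact_mod_cast (by omega : I.overlap x y ≤ I.overlap x y - k + k)
    rw [← Finset.sum_div, Finset.sum_sub_distrib, Finset.sum_const, nsmul_eq_mul, hcard] at h1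
    rw [← Finset.mul_sum, inv_mul_eq_div, le_div_iff₀ hN]
    refine le_trans ?_ h1
    rw [le_div_iff₀ hL0, hu]
    have : (1 - (I.eps + k / L)) * N * L = (1 - I.eps) * N * L - N * k := by
      field_simp
      ring
    rw [this, hL]
    nlinarith
  have hjensen := Real.pow_arith_mean_le_arith_mean_pow T (fun _ => N⁻¹) z
    (fun _ _ => inv_nonneg.2 hN.le) (by rw [Finset.sum_const, nsmul_eq_mul, hcard]; field_simp)
    (fun y _ => hz0 y) (k - D)
  have hpow : Real.exp (-4) ≤ (∑ y ∈ T, N⁻¹ * z y) ^ (k - D) := by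
    calc Real.exp (-4) ≤ Real.exp (-(2 * u)) ^ k := by
          rw [← Real.exp_nat_mul]
          refine Real.exp_le_exp.2 ?_
          nlinarith
      _ ≤ (1 - u) ^ k := by
          gcongr
          exact exp_neg_two_mul_le hu0 hu1
      _ ≤ (1 - u) ^ (k - D) := pow_le_pow_of_le_one (by linarith) (by linarith) (by omega)
      _ ≤ _ := by
          gcongr
          linarith
  have h5 : Real.exp (-4) * N ≤ ∑ y ∈ T, pairWeight L k D (I.overlap x y) := by
    have h6 := hpow.trans hjensen
    rw [← Finset.mul_sum, inv_mul_eq_div, le_div_iff₀ hN] at h6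
    exact h6.trans (Finset.sum_le_sum fun y _ => hzG y)
  calc N = Real.exp 4 * (Real.exp (-4) * N) := by
        rw [← mul_assoc, ← Real.exp_add]; simp
    _ ≤ _ := by gcongr

/-- The pairs `(k, I)` for which the stopping depth `k` is analysed. -/
structure Admissible (I : Input ι τ) (k : ℕ) : Prop where
  lam_mem : I.lam ∈ Set.Ioo (0 : ℝ) 1
  limit_pos : 1 ≤ I.limit
  eps_nonneg : 0 ≤ I.eps
  size : 4 * (k : ℝ) ^ 2 < I.lam * I.t
  depth : k = 0 ∨ (I.eps ≤ 1 / 4 ∧ (k : ℝ) * I.eps ≤ 1)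

lemma Admissible.lt_size {k : ℕ} (h : Admissible I k) : (k : ℝ) < I.lam * I.t := by
  rcases Nat.eq_zero_or_pos k with rfl | hk
  · simpa using h.size
  · have hk1 : (1 : ℝ) ≤ k := by exact_mod_cast hk
    nlinarith [h.size]

lemma Admissible.heavy_le {k : ℕ} (h : Admissible I k) {c : ℝ} (hc : Real.exp 4 ≤ c)
    (S : List ι) (x : ι) (D : ℕ) (hS : S.Nodup) (hx : x ∈ S) (hlen : I.limit < S.length)
    (hh : I.Heavy S x) (hD : D < k) : (S.length : ℝ) - 1 ≤
      c * ∑ y ∈ S.toFinset.erase x, pairWeight (I.lam * I.t) k D (I.overlap x y) := by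
  rcases h.depth with rfl | ⟨h1, h2⟩
  · omega
  · refine (heavy_sum_pairWeight h.limit_pos h.eps_nonneg h1 h2 h.size hS hx hlen hh hD).trans ?_
    gcongr
    exact Finset.sum_nonneg fun y _ => pairWeight_nonneg h.lt_size _ _

/-- The expected number of children that contain a given record, corrected for repeated tokens. -/
def branching (I : Input ι τ) (k : ℕ) : ℝ := I.t / (I.lam * I.t - k)

lemma Admissible.one_le_branching {k : ℕ} (h : Admissible I k) : 1 ≤ branching I k := by
  have h1 := h.lt_size
  rw [branching, one_le_div (by linarith)]
  have : (0 : ℝ) ≤ k := Nat.cast_nonneg k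
  nlinarith [h.lam_mem.2, Nat.cast_nonneg (α := ℝ) I.t]

lemma Admissible.sub_mul_branching {k : ℕ} (h : Admissible I k) :
    (I.lam * I.t - k) * branching I k = I.t :=
  mul_div_cancel₀ _ (by linarith [h.lt_size])

/-- By Bernoulli's inequality `(1 - k / L) ^ k ≥ 1 - k² / L ≥ 1 / 2`: repeated tokens cost a factor
of two. -/
lemma Admissible.branching_pow_le {k : ℕ} (h : Admissible I k) :
    branching I k ^ k ≤ 2 * (1 / I.lam) ^ k := by
  have h1 := h.lt_size
  have hL0 : 0 < I.lam * I.t := lt_of_le_of_lt (Nat.cast_nonneg _) h1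
  have ht : (0 : ℝ) < I.t := lt_of_le_of_ne (Nat.cast_nonneg _) (right_ne_zero_of_mul hL0.ne').symm
  have hlam := h.lam_mem.1
  have hk1 : (k : ℝ) / (I.lam * I.t) < 1 := by rwa [div_lt_one hL0]
  have e : branching I k = (1 / I.lam) * (1 - k / (I.lam * I.t))⁻¹ := by
    rw [branching, ← one_div, div_mul_div_comm, one_mul,
      div_eq_div_iff (by linarith) (mul_pos hlam (by linarith)).ne']
    field_simp
  have hb : 1 / 2 ≤ (1 - k / (I.lam * I.t)) ^ k := by
    have := one_add_mul_le_pow (a := -((k : ℝ) / (I.lam * I.t))) (by linarith) k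
    rw [← sub_eq_add_neg] at this
    refine le_trans ?_ this
    have : (k : ℝ) * (k / (I.lam * I.t)) ≤ 1 / 2 := by
      rw [← mul_div_assoc, div_le_iff₀ hL0]; nlinarith [h.size]
    linarith
  rw [e, mul_pow, mul_comm, inv_pow]
  gcongr
  rw [inv_le_comm₀ (by linarith) (by norm_num)]
  linarith

/-- With `w = 0`, `a` only has to supply the fewer than `limit` comparisons of a record in a call
within the limit, and it grows by `branching` per stage back from `k`. It vanishes from stage `k`
on, where companions pay for comparisons, so `c` needs no factor `1 / ε`. -/
lemma Admissible.isPotential_cmps {k : ℕ} (h : Admissible I k) :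
    IsPotential I 0 k (fun D => if D < k then I.limit * branching I k ^ (k - D) else 0)
      (Real.exp 4) := by
  have hB := h.one_le_branching
  have hk := h.lt_size
  have hL0 : 0 < I.lam * I.t := lt_of_le_of_lt (Nat.cast_nonneg _) hk
  have hlim : (1 : ℝ) ≤ I.limit := by exact_mod_cast h.limit_pos
  have ht : (0 : ℝ) ≤ I.t := Nat.cast_nonneg _
  refine ⟨hk, le_rfl, Real.one_le_exp (by norm_num), fun D => ?_, fun D hD => ?_, fun D hD => ?_,
    ?_, fun D hD => ?_, h.heavy_le le_rfl⟩
  · split_ifs <;> positivity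
  · simp [hD.not_gt]
  · have hDk : (D : ℝ) < k := by exact_mod_cast hD
    simp only [hD, if_true, zero_add]
    rw [div_le_iff₀ hL0]
    obtain ⟨m, hm⟩ : ∃ m, k - D = m + 1 := ⟨k - D - 1, by omega⟩
    have h1 : (if D + 1 < k then (I.limit : ℝ) * branching I k ^ (k - (D + 1)) else 0) ≤
        I.limit * branching I k ^ m := by
      split_ifs
      · rw [show k - (D + 1) = m by omega]
      · positivity
    have h2 : (I.t : ℝ) * (I.limit * branching I k ^ m) =
        (I.lam * I.t - k) * (I.limit * branching I k ^ (m + 1)) := by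
      rw [pow_succ]
      linear_combination (-(I.limit * branching I k ^ m)) * h.sub_mul_branching
    rw [hm]
    have h3 : (0 : ℝ) ≤ if D + 1 < k then (I.limit : ℝ) * branching I k ^ (k - (D + 1)) else 0 := by
      split_ifs <;> positivity
    have h4 : 0 ≤ (I.limit : ℝ) * branching I k ^ (m + 1) := by positivity
    have h5 : (0 : ℝ) ≤ D := Nat.cast_nonneg D
    have h6 := mul_le_mul_of_nonneg_left h1 ht
    nlinarith [mul_nonneg h5 h3, mul_nonneg (by linarith : (0 : ℝ) ≤ k - D) h4]
  · simp only [lt_irrefl, if_false]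
    have := mul_nonneg (Real.exp_pos 4).le h.eps_nonneg
    simpa using this
  · simp only [hD, if_true, zero_add]
    have : 1 ≤ branching I k ^ (k - D) := one_le_pow₀ hB
    nlinarith

/-- If `branching` were `1 / λ`, the fraction would be the geometric sum of `(1 / λ) ^ i` over `i ≤
k - D`, the solution of `X (m + 1) = 1 + X m / λ` with `X 0 = 1`. From stage `k` on `a` stays at
`limit`, and the upkeep `1 + limit / λ` has to come from the drift `c ε`; this forces `c` of order
`1 / ε`. -/
lemma Admissible.isPotential_work {k : ℕ} (h : Admissible I k) (heps : 0 < I.eps) :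
    IsPotential I 1 k (fun D => I.limit * ((branching I k ^ (k - D) - I.lam) / (1 - I.lam)))
      (Real.exp 4 + (1 + I.limit / I.lam) / I.eps) := by
  have hB := h.one_le_branching
  have hk := h.lt_size
  have hL0 : 0 < I.lam * I.t := lt_of_le_of_lt (Nat.cast_nonneg _) hk
  have hlim : (1 : ℝ) ≤ I.limit := by exact_mod_cast h.limit_pos
  have ht : (0 : ℝ) ≤ I.t := Nat.cast_nonneg _
  have hlam0 := h.lam_mem.1
  have hlam1 := h.lam_mem.2
  have hx : ∀ m : ℕ, 1 ≤ (branching I k ^ m - I.lam) / (1 - I.lam) := by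
    intro m
    rw [one_le_div (by linarith)]
    linarith [one_le_pow₀ hB (n := m)]
  have hc : 0 ≤ (1 + I.limit / I.lam) / I.eps := by positivity
  refine ⟨hk, zero_le_one, by linarith [Real.one_le_exp (by norm_num : (0 : ℝ) ≤ 4)], fun D => ?_,
    fun D hD => ?_, fun D hD => ?_, ?_, fun D hD => ?_, h.heavy_le (by linarith)⟩
  · nlinarith [hx (k - D)]
  · simp [Nat.sub_eq_zero_of_le hD]
  · have hDk : (D : ℝ) < k := by exact_mod_cast hD
    obtain ⟨m, hm⟩ : ∃ m, k - D = m + 1 := ⟨k - D - 1, by omega⟩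
    rw [hm, show k - (D + 1) = m by omega]
    have h2 : (I.t : ℝ) * branching I k ^ m =
        (I.lam * I.t - k) * branching I k ^ (m + 1) := by
      rw [pow_succ]
      linear_combination (-(branching I k ^ m)) * h.sub_mul_branching
    set X := (branching I k ^ (m + 1) - I.lam) / (1 - I.lam) with hX
    set Y := (branching I k ^ m - I.lam) / (1 - I.lam) with hY
    have h3 : I.lam * I.t + I.t * Y ≤ (I.lam * I.t - k) * X := by
      have hX' : X * (1 - I.lam) = branching I k ^ (m + 1) - I.lam := by
        rw [hX]; field_simp [(by linarith : (1 : ℝ) - I.lam ≠ 0)]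
      have hY' : Y * (1 - I.lam) = branching I k ^ m - I.lam := by
        rw [hY]; field_simp [(by linarith : (1 : ℝ) - I.lam ≠ 0)]
      have : (I.lam * I.t + I.t * Y) * (1 - I.lam) ≤ ((I.lam * I.t - k) * X) * (1 - I.lam) := by
        have e1 : (I.lam * I.t + I.t * Y) * (1 - I.lam) =
            I.lam * I.t * (1 - I.lam) + I.t * branching I k ^ m - I.t * I.lam := by
          rw [add_mul, mul_assoc (I.t : ℝ), hY']; ring
        have e2 : ((I.lam * I.t - k) * X) * (1 - I.lam) =
            I.t * branching I k ^ m - (I.lam * I.t - k) * I.lam := by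
          rw [mul_assoc, hX', h2]; ring
        rw [e1, e2]
        nlinarith [mul_nonneg (Nat.cast_nonneg (α := ℝ) k) hlam0.le]
      exact le_of_mul_le_mul_right this (by linarith)
    have hX1 := hx (m + 1)
    have hY1 := hx m
    rw [← hX] at hX1
    rw [← hY] at hY1
    have h5 : (0 : ℝ) ≤ D := Nat.cast_nonneg D
    rw [← le_sub_iff_add_le', div_le_iff₀ hL0]
    have h6 : 0 ≤ (k - D : ℝ) * X := mul_nonneg (by linarith) (by linarith)
    have h7 : 0 ≤ D * Y := mul_nonneg h5 (by linarith)
    have h8 : D * X + (I.t - D) * Y ≤ I.lam * I.t * X - I.lam * I.t := by linarith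
    have h9 := mul_le_mul_of_nonneg_left h8 (by linarith : (0 : ℝ) ≤ I.limit)
    nlinarith
  · simp only [Nat.sub_self, pow_zero, div_self (by linarith : (1 : ℝ) - I.lam ≠ 0), mul_one]
    have : (Real.exp 4 + (1 + I.limit / I.lam) / I.eps) * I.eps =
        Real.exp 4 * I.eps + (1 + I.limit / I.lam) := by
      field_simp
    rw [this]
    have := mul_nonneg (Real.exp_pos 4).le heps.le
    linarith
  · nlinarith [hx (k - D)]

/-! ### The depth of the recursion -/

lemma orderedPairs_eq_sum {S : List ι} (hS : S.Nodup) :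
    (orderedPairs S : ℝ) = ∑ x ∈ S.toFinset, ∑ _y ∈ S.toFinset.erase x, (1 : ℝ) := by
  rw [Finset.sum_congr rfl (g := fun _ => (S.length : ℝ) - 1)]
  · rw [Finset.sum_const, List.toFinset_card_of_nodup hS, nsmul_eq_mul, orderedPairs]
    rcases S.length with _ | l <;> simp
  · intro x hx
    rw [Finset.sum_const, nsmul_eq_mul, mul_one, card_toFinset_erase hS (List.mem_toFinset.1 hx)]

lemma orderedPairs_mono {S T : List ι} (h : S.length ≤ T.length) :
    orderedPairs S ≤ orderedPairs T :=
  Nat.mul_le_mul h (Nat.sub_le_sub_right h 1)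

/-- The expected number of pairs that are together at depth `K` decays geometrically. -/
theorem lintegral_orderedPairs_le (hI : I.Regular) (hl : 1 ≤ I.limit) (hlt : 1 ≤ I.lam * I.t)
    (i K : ℕ) {S : List ι} (hS : S.Nodup) :
    ∫⁻ ω, (treeCost I (fun _ => 0) orderedPairs (seedHash i ω) K [] S : ℝ≥0∞) ∂(seedMeasure τ) ≤
      ENNReal.ofReal (max (1 - I.eps) 0 ^ K * orderedPairs S) := by
  -- For small `n` the value of `ε` can exceed `1`; the maximum keeps the rate nonnegative.
  set ρ := max (1 - I.eps) 0 with hρ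
  have hρ0 : 0 ≤ ρ := le_max_right _ _
  have hL0 : 0 < I.lam * I.t := by linarith
  refine lintegral_treeCost_le hI hlt (fun _ => 0) orderedPairs
    (fun k _ S => ρ ^ k * orderedPairs S) (fun k p S => by positivity)
    (fun p S _ => by simp) ?_ i K [] S ⟨hS, by simp⟩
  intro k p S h
  obtain ⟨hsub, hval⟩ := bruteForce_val hI h.1
  have hS' := hI.nodup_bruteForce h.1
  have hmono : (orderedPairs (bruteForce I S).val : ℝ) ≤ orderedPairs S := by
    exact_mod_cast orderedPairs_mono hsub.length_le
  generalize (bruteForce I S).val = T at *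
  rw [← Finset.mul_sum, Nat.cast_zero, zero_add]
  -- An ordered pair lies in as many buckets as it has common tokens.
  have e : ∑ j ∈ I.tokensOf T, (orderedPairs (I.bucket T j) : ℝ) =
      ∑ x ∈ T.toFinset, ∑ y ∈ T.toFinset.erase x, (I.overlap x y : ℝ) := by
    simp only [orderedPairs_eq_sum (Input.nodup_bucket hS' _)]
    rw [sum_tokensOf_bucket T fun j x => ∑ _y ∈ (I.bucket T j).toFinset.erase x, (1 : ℝ)]
    refine Finset.sum_congr rfl fun x hx => ?_
    rw [Finset.sum_comm' (t' := T.toFinset.erase x) (s' := fun y => I.tokens x ∩ I.tokens y)]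
    · simp [Input.overlap]
    · intro j y
      have := List.mem_toFinset.1 hx
      simp only [Finset.mem_erase, List.mem_toFinset, Input.mem_bucket, Finset.mem_inter,
        Input.mem_tokens]
      tauto
  have hb : ∑ x ∈ T.toFinset, ∑ y ∈ T.toFinset.erase x, (I.overlap x y : ℝ) ≤
      (I.lam * I.t) * (ρ * orderedPairs T) := by
    rw [orderedPairs_eq_sum hS', Finset.mul_sum, Finset.mul_sum]
    refine Finset.sum_le_sum fun x hx => ?_
    have hx := List.mem_toFinset.1 hx
    rcases hval with rfl | ⟨hlen, hh⟩
    · simp at hx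
    · have h1 := sum_overlap_le_of_not_heavy hL0 (by omega) (hh x hx)
      rw [div_le_iff₀ hL0] at h1
      rw [Finset.sum_const, nsmul_eq_mul, mul_one, card_toFinset_erase hS' hx]
      have h2 : (0 : ℝ) ≤ T.length - 1 := by
        have : (1 : ℝ) ≤ T.length := by exact_mod_cast List.length_pos_of_mem hx
        linarith
      have h3 := mul_le_mul_of_nonneg_right (le_max_left (1 - I.eps) 0) h2
      nlinarith
  rw [e]
  calc 1 / (I.lam * I.t) * (ρ ^ k * ∑ x ∈ T.toFinset, ∑ y ∈ T.toFinset.erase x,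
        (I.overlap x y : ℝ))
      ≤ 1 / (I.lam * I.t) * (ρ ^ k * ((I.lam * I.t) * (ρ * orderedPairs T))) := by gcongr
    _ = ρ ^ (k + 1) * orderedPairs T := by
        rw [pow_succ]
        generalize I.lam * (I.t : ℝ) = L at hL0
        field_simp
    _ ≤ _ := by gcongr

/-- Markov's inequality: a weight in `ℕ` that is not zero is at least `1`. -/
lemma seedMeasure_treeCost_ne_zero_le (hI : I.Regular) (hl : 1 ≤ I.limit) (hlt : 1 ≤ I.lam * I.t)
    (i K : ℕ) {S : List ι} (hS : S.Nodup) :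
    seedMeasure τ {ω | treeCost I (fun _ => 0) orderedPairs (seedHash i ω) K [] S ≠ 0} ≤
      ENNReal.ofReal (max (1 - I.eps) 0 ^ K * orderedPairs S) := by
  refine le_trans ?_ (lintegral_orderedPairs_le hI hl hlt i K hS)
  have hm : Measurable fun ω : Seeds τ =>
      (treeCost I (fun _ => 0) orderedPairs (seedHash i ω) K [] S : ℝ≥0∞) :=
    (measurable_of_countable _).comp (measurable_treeCost _ _ _ _ _ _)
  have := mul_meas_ge_le_lintegral (μ := seedMeasure τ) hm 1
  rw [one_mul] at this
  refine le_trans (measure_mono fun ω hω => ?_) this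
  simp only [Set.mem_ofPred_eq] at hω ⊢
  exact_mod_cast Nat.one_le_iff_ne_zero.2 hω

/-! ### Independent events -/

lemma dependsOn_indicator {κ U : Type*} {A : Set (κ → U)} {B : Set κ} (h : DependsOn (· ∈ A) B) :
    DependsOn (A.indicator (1 : (κ → U) → ℝ≥0∞)) B := by
  intro x y hxy
  have := h hxy
  simp only at this
  simp only [Set.indicator, this, Pi.one_apply]

section Independent

variable {κ U : Type*} [MeasurableSpace U] (μ : Measure U) [IsProbabilityMeasure μ]

lemma measure_inter_of_dependsOn {B C : Set κ} (hBC : Disjoint B C) {A A' : Set (κ → U)}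
    (hA : MeasurableSet A) (hA' : MeasurableSet A') (hAB : DependsOn (· ∈ A) B)
    (hAC : DependsOn (· ∈ A') C) :
    Measure.infinitePi (fun _ => μ) (A ∩ A') =
      Measure.infinitePi (fun _ => μ) A * Measure.infinitePi (fun _ => μ) A' := by
  have := lintegral_mul_of_dependsOn μ hBC (measurable_one.indicator hA)
    (measurable_one.indicator hA') (dependsOn_indicator hAB) (dependsOn_indicator hAC)
  rw [lintegral_indicator_one hA, lintegral_indicator_one hA'] at this
  rw [← this, ← lintegral_indicator_one (hA.inter hA')]
  refine lintegral_congr fun ω => ?_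
  rw [Set.inter_indicator_one]
  rfl

lemma measure_biInter_of_dependsOn {J : Type*} (s : Finset J) {B : J → Set κ}
    (hB : ∀ i ∈ s, ∀ j ∈ s, i ≠ j → Disjoint (B i) (B j)) {A : J → Set (κ → U)}
    (hA : ∀ j ∈ s, MeasurableSet (A j)) (hAB : ∀ j ∈ s, DependsOn (· ∈ A j) (B j)) :
    Measure.infinitePi (fun _ => μ) (⋂ j ∈ s, A j) =
      ∏ j ∈ s, Measure.infinitePi (fun _ => μ) (A j) := by
  have := lintegral_prod_of_dependsOn μ s hB
    (f := fun j => (A j).indicator (1 : (κ → U) → ℝ≥0∞))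
    (fun j hj => measurable_one.indicator (hA j hj)) (fun j hj => dependsOn_indicator (hAB j hj))
  rw [Finset.prod_congr rfl fun j hj => lintegral_indicator_one (hA j hj)] at this
  rw [← this, ← lintegral_indicator_one (s.measurableSet_biInter hA)]
  refine lintegral_congr fun ω => ?_
  by_cases h : ω ∈ ⋂ j ∈ s, A j
  · rw [Set.indicator_of_mem h]
    refine (Finset.prod_eq_one fun j hj => ?_).symm
    exact Set.indicator_of_mem (Set.mem_iInter₂.1 h j hj) _
  · rw [Set.indicator_of_notMem h]
    simp only [Set.mem_iInter, not_forall] at h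
    obtain ⟨j, hj, h⟩ := h
    exact (Finset.prod_eq_zero hj (Set.indicator_of_notMem h _)).symm

end Independent

/-! ### Recall -/

lemma dependsOn_mem_cpsJoin_out (hI : I.Regular) (q : ι × ι) (i k : ℕ) (p : List τ) (S : List ι) :
    DependsOn (fun ω : Seeds τ => q ∈ (cpsJoin I (seedHash i ω) k p S).out)
      (subtreeSeeds i p) := by
  induction k generalizing p S with
  | zero => intro x y _; rfl
  | succ k ih =>
    intro x y h
    simp only [mem_cpsJoin_out_succ hI]
    have h1 : ∀ j, seedHash i x p j = seedHash i y p j := fun j => by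
      simp only [seedHash]; rw [h (i, p, j) ⟨rfl, List.prefix_refl p⟩]
    have h2 := fun j => ih (p ++ [j]) (I.bucket (bruteForce I S).val j)
      (fun s hs => h s (subtreeSeeds_append_subset i p [j] hs))
    simp only at h2
    simp only [h1, h2]

lemma measurableSet_mem_cpsJoin_out (hI : I.Regular) (q : ι × ι) (i k : ℕ) (p : List τ)
    (S : List ι) :
    MeasurableSet {ω : Seeds τ | q ∈ (cpsJoin I (seedHash i ω) k p S).out} := by
  induction k generalizing p S with
  | zero => simp [cpsJoin]
  | succ k ih =>
    have e : {ω : Seeds τ | q ∈ (cpsJoin I (seedHash i ω) (k + 1) p S).out} =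
        {_ω | q ∈ (bruteForce I S).out} ∪
        ⋃ j ∈ I.tokensOf (bruteForce I S).val, {ω | seedHash i ω p j < 1 / (I.lam * I.t)} ∩
          {ω | q ∈ (cpsJoin I (seedHash i ω) k (p ++ [j])
            (I.bucket (bruteForce I S).val j)).out} := by
      ext ω
      simp only [mem_cpsJoin_out_succ hI, Set.mem_union, Set.mem_ofPred_eq, Set.mem_iUnion,
        Set.mem_inter_iff, exists_prop]
    rw [e]
    exact (MeasurableSet.const _).union (Finset.measurableSet_biUnion _ fun j _ =>
      (measurableSet_seedHash_lt i p j _).inter (ih _ _))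

/-- The pair `q` has not been reported by the first `k + 1` levels of the recursion although no
call at depth `k` has two points. -/
def missed (I : Input ι τ) (q : ι × ι) (i k : ℕ) (p : List τ) (S : List ι) : Set (Seeds τ) :=
  {ω | q ∉ (cpsJoin I (seedHash i ω) (k + 1) p S).out ∧
    treeCost I (fun _ => 0) orderedPairs (seedHash i ω) k p S = 0}

lemma measurableSet_missed (hI : I.Regular) (q : ι × ι) (i k : ℕ) (p : List τ) (S : List ι) :
    MeasurableSet (missed I q i k p S) :=
  (measurableSet_mem_cpsJoin_out hI q i (k + 1) p S).compl.inter
    ((measurable_treeCost _ _ i k p S) (measurableSet_singleton 0))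

lemma dependsOn_missed (hI : I.Regular) (q : ι × ι) (i k : ℕ) (p : List τ) (S : List ι) :
    DependsOn (· ∈ missed I q i k p S) (subtreeSeeds i p) := by
  intro x y h
  have h1 := dependsOn_mem_cpsJoin_out hI q i (k + 1) p S h
  have h2 := treeCost_dependsOn (I := I) (fun _ => 0) orderedPairs i k p S h
  simp only [missed, Set.mem_ofPred_eq] at h1 h2 ⊢
  rw [h1, h2]

/-- One generation of the survival recursion. With `z = β ^ (k + 1) / (k + 1)`, use `exp (-z) ≤ 1 /
(1 + z)`; then `β ^ (k + 1) ≤ 1` turns the denominator `k + 1 + β ^ (k + 1)` into `k + 2`. -/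
lemma survival_step {β : ℝ} (h0 : 0 < β) (h1 : β ≤ 1) (k : ℕ) :
    Real.exp (-(β * (β ^ k / (k + 1)))) ≤ 1 - β ^ (k + 1) / ((k + 1 : ℕ) + 1) := by
  have hp : 0 < β ^ (k + 1) := by positivity
  have hp1 : β ^ (k + 1) ≤ 1 := pow_le_one₀ h0.le h1
  have hk : (0 : ℝ) ≤ k := Nat.cast_nonneg k
  have e : β * (β ^ k / (k + 1)) = β ^ (k + 1) / (k + 1) := by ring
  rw [e, Real.exp_neg]
  set z := β ^ (k + 1) / (k + 1 : ℝ) with hz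
  have hz0 : 0 < z := by positivity
  calc (Real.exp z)⁻¹ ≤ (1 + z)⁻¹ := by
        gcongr
        linarith [Real.add_one_le_exp z]
    _ = 1 - β ^ (k + 1) / (k + 1 + β ^ (k + 1)) := by
        rw [hz]; field_simp; ring
    _ ≤ _ := by
        push_cast
        gcongr

/-- Two records with at least `β λ t` common tokens are missed with probability at most
`1 - β ^ k / (k + 1)`: the calls that contain both form a nearly critical branching process. -/
theorem seedMeasure_missed_le (hI : I.Regular) (hl : 1 ≤ I.limit) (hlt : 1 ≤ I.lam * I.t)
    {x y : ι} (hxy : I.lam ≤ I.sim x y) (hyx : I.lam ≤ I.sim y x) {β : ℝ} (h0 : 0 < β)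
    (h1 : β ≤ 1) (hβ : β * (I.lam * I.t) ≤ I.overlap x y) (i k : ℕ) (p : List τ) {S : List ι}
    (hS : S.Nodup) (hx : x ∈ S) (hy : y ∈ S) :
    (seedMeasure τ).real (missed I (x, y) i k p S) ≤ 1 - β ^ k / (k + 1) := by
  have hL0 : 0 < I.lam * I.t := by linarith
  have hc0 : 0 ≤ 1 / (I.lam * I.t) := by positivity
  have hc1 : 1 / (I.lam * I.t) ≤ 1 := by rw [div_le_one hL0]; exact hlt
  induction k generalizing p S with
  | zero =>
    -- The weight condition leaves at most one point, so `x = y` and the call reports the pair.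
    have : missed I (x, y) i 0 p S = ∅ := by
      ext ω
      simp only [missed, Set.mem_ofPred_eq, Set.mem_empty_iff_false, iff_false, not_and]
      intro hout htc
      have hS1 : S.length ≤ 1 := by
        simp only [treeCost, orderedPairs, mul_eq_zero] at htc
        omega
      refine hout ((mem_cpsJoin_out_succ hI _ _ _ _ _).2 (Or.inl ?_))
      rcases bruteForce_out_complete hI hS hx hy hxy hyx with h | h
      · exact h
      · rw [bruteForce_val_eq_nil hI hl hS hS1] at h
        simp at h
    simp [this]
  | succ k ih =>
    have hpos : 0 < β ^ (k + 1) / ((k + 1 : ℕ) + 1 : ℝ) := by positivity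
    have hle1 : β ^ (k + 1) / ((k + 1 : ℕ) + 1 : ℝ) ≤ 1 := by
      rw [div_le_one (by positivity)]
      have : β ^ (k + 1) ≤ 1 := pow_le_one₀ h0.le h1
      have hk : (0 : ℝ) ≤ (k + 1 : ℕ) := Nat.cast_nonneg _
      linarith
    rcases bruteForce_out_complete hI hS hx hy hxy hyx with h | ⟨hx', hy'⟩
    · have : missed I (x, y) i (k + 1) p S = ∅ := by
        ext ω
        simp only [missed, Set.mem_ofPred_eq, Set.mem_empty_iff_false, iff_false, not_and]
        intro hout
        exact absurd ((mem_cpsJoin_out_succ hI _ _ _ _ _).2 (Or.inl h)) hout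
      rw [this, measureReal_empty]
      linarith
    · set T := (bruteForce I S).val with hT
      have hTn : T.Nodup := hI.nodup_bruteForce hS
      set J := I.tokens x ∩ I.tokens y with hJ
      have hJT : ∀ j ∈ J, j ∈ I.tokensOf T ∧ x ∈ I.bucket T j ∧ y ∈ I.bucket T j := by
        intro j hj
        rw [hJ, Finset.mem_inter] at hj
        have hjx := Input.mem_tokens.1 hj.1
        have hjy := Input.mem_tokens.1 hj.2
        exact ⟨Finset.mem_biUnion.2 ⟨x, List.mem_toFinset.2 hx', hj.1⟩,
          Input.mem_bucket.2 ⟨hx', hjx⟩, Input.mem_bucket.2 ⟨hy', hjy⟩⟩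
      set c := 1 / (I.lam * I.t) with hc
      set M : τ → Set (Seeds τ) := fun j => missed I (x, y) i k (p ++ [j]) (I.bucket T j) with hM
      set H : τ → Set (Seeds τ) := fun j => {ω | seedHash i ω p j < c} with hH
      have hMm : ∀ j, MeasurableSet (M j) := fun j => measurableSet_missed hI _ _ _ _ _
      have hHm : ∀ j, MeasurableSet (H j) := fun j => measurableSet_seedHash_lt i p j c
      have hMd : ∀ j, DependsOn (· ∈ (M j)ᶜ) (subtreeSeeds i (p ++ [j])) := fun j u v huv => by
        have := dependsOn_missed hI (x, y) i k (p ++ [j]) (I.bucket T j) huv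
        simp only [Set.mem_compl_iff, hM] at this ⊢
        rw [this]
      have hHd : ∀ j, DependsOn (· ∈ H j) {(i, p, j)} := fun j u v huv =>
        dependsOn_seedHash i p j c huv
      -- In a miss every common token is either not drawn or leads to a miss in its child. These
      -- events use disjoint sets of seeds, hence are independent.
      have hsub : missed I (x, y) i (k + 1) p S ⊆ ⋂ j ∈ J, (H j ∩ (M j)ᶜ)ᶜ := by
        rintro ω ⟨hout, htc⟩
        refine Set.mem_iInter₂.2 fun j hj hcon => ?_
        obtain ⟨hjT, -, -⟩ := hJT j hj
        refine hcon.2 ⟨fun ho => hout ?_, treeCost_orderedPairs_eq_zero htc hjT hcon.1⟩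
        exact (mem_cpsJoin_out_succ hI _ _ _ _ _).2 (Or.inr ⟨j, hjT, hcon.1, ho⟩)
      have hprod : (seedMeasure τ).real (⋂ j ∈ J, (H j ∩ (M j)ᶜ)ᶜ) =
          ∏ j ∈ J, (seedMeasure τ).real (H j ∩ (M j)ᶜ)ᶜ := by
        simp only [Measure.real]
        rw [← ENNReal.toReal_prod]
        congr 1
        refine measure_biInter_of_dependsOn (volume : Measure unitInterval) J
          (B := fun j => {(i, p, j)} ∪ subtreeSeeds i (p ++ [j])) ?_
          (fun j _ => ((hHm j).inter (hMm j).compl).compl) ?_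
        · intro j _ j' _ hjj'
          simp only [Set.disjoint_union_left, Set.disjoint_union_right]
          exact ⟨⟨by simpa using hjj', (disjoint_singleton_subtreeSeeds i p j' j).symm⟩,
            disjoint_singleton_subtreeSeeds i p j j', disjoint_subtreeSeeds i p hjj'⟩
        · intro j _ u v huv
          have e1 := hMd j (fun s hs => huv s (Or.inr hs))
          have e2 := hHd j (fun s hs => huv s (Or.inl hs))
          simp only [Set.mem_compl_iff, Set.mem_inter_iff] at e1 e2 ⊢
          rw [e1, e2]
      have hone : ∀ j ∈ J, (seedMeasure τ).real (H j ∩ (M j)ᶜ)ᶜ ≤ 1 - c * (β ^ k / (k + 1)) := by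
        intro j hj
        obtain ⟨-, hxj, hyj⟩ := hJT j hj
        have hih := ih (p ++ [j]) (Input.nodup_bucket hTn j) hxj hyj
        rw [probReal_compl_eq_one_sub ((hHm j).inter (hMm j).compl)]
        have e : (seedMeasure τ).real (H j ∩ (M j)ᶜ) = c * (1 - (seedMeasure τ).real (M j)) := by
          rw [← probReal_compl_eq_one_sub (hMm j)]
          simp only [Measure.real]
          have := measure_inter_of_dependsOn (volume : Measure unitInterval)
            (disjoint_singleton_subtreeSeeds i p j j) (hHm j) (hMm j).compl (hHd j) (hMd j)
          rw [seedMeasure, this, ← seedMeasure, ENNReal.toReal_mul,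
            seedMeasure_seedHash_lt i p j hc0 hc1, ENNReal.toReal_ofReal hc0]
        rw [e]
        have : c * (β ^ k / (k + 1)) ≤ c * (1 - (seedMeasure τ).real (M j)) := by
          gcongr
          linarith
        linarith
      have hfac : 0 ≤ 1 - c * (β ^ k / (k + 1)) := by
        have h2 : β ^ k / (k + 1) ≤ 1 := by
          rw [div_le_one (by positivity)]
          have : β ^ k ≤ 1 := pow_le_one₀ h0.le h1
          have hk : (0 : ℝ) ≤ k := Nat.cast_nonneg _
          linarith
        have h3 : 0 ≤ β ^ k / (k + 1) := by positivity
        nlinarith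
      -- There are at least `β L` common tokens, and each succeeds with probability at least `1 / L`
      -- times `β ^ k / (k + 1)`.
      calc (seedMeasure τ).real (missed I (x, y) i (k + 1) p S)
          ≤ (seedMeasure τ).real (⋂ j ∈ J, (H j ∩ (M j)ᶜ)ᶜ) := measureReal_mono hsub
        _ ≤ (1 - c * (β ^ k / (k + 1))) ^ J.card := by
            rw [hprod, ← Finset.prod_const]
            exact Finset.prod_le_prod (fun _ _ => measureReal_nonneg) hone
        _ ≤ Real.exp (-(c * (β ^ k / (k + 1)))) ^ J.card := by
            gcongr
            exact Real.one_sub_le_exp_neg _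
        _ ≤ Real.exp (-(β * (β ^ k / (k + 1)))) := by
            rw [← Real.exp_nat_mul]
            refine Real.exp_le_exp.2 ?_
            have h2 : β ≤ J.card * c := by
              rw [hc, mul_one_div, le_div_iff₀ hL0]
              exact hβ
            have h3 : 0 ≤ β ^ k / (k + 1) := by positivity
            nlinarith [mul_le_mul_of_nonneg_right h2 h3]
        _ ≤ _ := survival_step h0 h1 k

/-- Failure probability of a number of independent repetitions. -/
theorem seedMeasure_not_reported_le (hI : I.Regular) (hl : 1 ≤ I.limit) (hlt : 1 ≤ I.lam * I.t)
    {x y : ι} (hxy : I.lam ≤ I.sim x y) (hyx : I.lam ≤ I.sim y x) {β : ℝ} (h0 : 0 < β)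
    (h1 : β ≤ 1) (hβ : β * (I.lam * I.t) ≤ I.overlap x y) (R K : ℕ) {S : List ι}
    (hS : S.Nodup) (hx : x ∈ S) (hy : y ∈ S) :
    (seedMeasure τ).real {ω | ∀ i < R, (x, y) ∉ (cpsJoin I (seedHash i ω) (K + 1) [] S).out} ≤
      (1 - β ^ K / (K + 1) + max (1 - I.eps) 0 ^ K * orderedPairs S) ^ R := by
  set A : ℕ → Set (Seeds τ) := fun i =>
    {ω | (x, y) ∉ (cpsJoin I (seedHash i ω) (K + 1) [] S).out} with hA
  have hAm : ∀ i, MeasurableSet (A i) := fun i =>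
    (measurableSet_mem_cpsJoin_out hI (x, y) i (K + 1) [] S).compl
  have e : {ω : Seeds τ | ∀ i < R, (x, y) ∉ (cpsJoin I (seedHash i ω) (K + 1) [] S).out} =
      ⋂ i ∈ Finset.range R, A i := by
    ext ω; simp [hA]
  have hprod : (seedMeasure τ).real (⋂ i ∈ Finset.range R, A i) =
      ∏ i ∈ Finset.range R, (seedMeasure τ).real (A i) := by
    simp only [Measure.real]
    rw [← ENNReal.toReal_prod]
    congr 1
    refine measure_biInter_of_dependsOn (volume : Measure unitInterval) _
      (B := fun i => subtreeSeeds i []) ?_ (fun i _ => hAm i) ?_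
    · intro i _ j _ hij
      rw [Set.disjoint_left]
      rintro s ⟨h1, -⟩ ⟨h2, -⟩
      exact hij (h1.symm.trans h2)
    · intro i _ u v huv
      have := dependsOn_mem_cpsJoin_out hI (x, y) i (K + 1) [] S huv
      simp only [hA, Set.mem_ofPred_eq] at this ⊢
      rw [this]
  rw [e, hprod]
  nth_rewrite 2 [← Finset.card_range R]
  rw [← Finset.prod_const]
  refine Finset.prod_le_prod (fun _ _ => measureReal_nonneg) fun i _ => ?_
  -- A repetition without report is a miss unless some call at depth `K` still has two points.
  have hsub : A i ⊆ missed I (x, y) i K [] S ∪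
      {ω | treeCost I (fun _ => 0) orderedPairs (seedHash i ω) K [] S ≠ 0} := by
    intro ω hω
    by_cases h : treeCost I (fun _ => 0) orderedPairs (seedHash i ω) K [] S = 0
    · exact Or.inl ⟨hω, h⟩
    · exact Or.inr h
  refine (measureReal_mono hsub).trans ((measureReal_union_le _ _).trans (add_le_add
    (seedMeasure_missed_le hI hl hlt hxy hyx h0 h1 hβ i K [] hS hx hy) ?_))
  exact ENNReal.toReal_le_of_le_ofReal (by positivity)
    (seedMeasure_treeCost_ne_zero_le hI hl hlt i K hS)

/-! ### The embedding -/

section Embedding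

variable {H : Type*}

/-- The number of samples that fall into a set. -/
def hits {t : ℕ} (A : Set H) (g : Fin t → H) : ℕ := (Finset.univ.filter fun i => g i ∈ A).card

/-- The binomial coefficient counts the `k`-sets of indices whose samples all fall into `A`; each
such set has probability `ν A ^ k`. -/
lemma choose_hits {t : ℕ} (A : Set H) (k : ℕ) (g : Fin t → H) :
    ((hits A g).choose k : ℝ≥0∞) = ∑ T ∈ Finset.powersetCard k (Finset.univ : Finset (Fin t)),
      {g : Fin t → H | ∀ i ∈ T, g i ∈ A}.indicator 1 g := by
  rw [hits, ← Finset.card_powersetCard]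
  simp only [Set.indicator, Set.mem_ofPred_eq, Pi.one_apply]
  rw [Finset.sum_boole]
  congr 2
  ext T
  simp only [Finset.mem_powersetCard, Finset.mem_filter, true_and,
    Finset.subset_iff, Finset.mem_univ, implies_true]
  tauto

/-- Expresses the square through the factorial moments, so that the variance follows from them. -/
lemma sq_hits_sub {t : ℕ} (A : Set H) (g : Fin t → H) (c : ℝ) :
    ((hits A g : ℝ) - c) ^ 2 = 2 * ((hits A g).choose 2 : ℝ) +
      (1 - 2 * c) * ((hits A g).choose 1 : ℝ) + c ^ 2 := by
  rw [Nat.cast_choose_two, Nat.choose_one_right]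
  ring


variable [MeasurableSpace H] (ν : Measure H) [IsProbabilityMeasure ν]

lemma measurableSet_forall_mem {t : ℕ} {A : Set H} (hA : MeasurableSet A) (T : Finset (Fin t)) :
    MeasurableSet {g : Fin t → H | ∀ i ∈ T, g i ∈ A} := by
  have : {g : Fin t → H | ∀ i ∈ T, g i ∈ A} = Set.pi (T : Set (Fin t)) fun _ => A := by
    ext g; simp [Set.mem_pi]
  rw [this]
  exact MeasurableSet.pi T.countable_toSet fun _ _ => hA

lemma measurable_choose_hits {t : ℕ} {A : Set H} (hA : MeasurableSet A) (k : ℕ) :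
    Measurable fun g : Fin t → H => ((hits A g).choose k : ℝ≥0∞) := by
  simp only [choose_hits]
  exact Finset.measurable_sum _ fun T _ => measurable_one.indicator (measurableSet_forall_mem hA T)

/-- Factorial moments of the binomial distribution. -/
lemma lintegral_choose_hits {t : ℕ} {A : Set H} (hA : MeasurableSet A) (k : ℕ) :
    ∫⁻ g : Fin t → H, ((hits A g).choose k : ℝ≥0∞) ∂(Measure.pi fun _ => ν) =
      (t.choose k : ℝ≥0∞) * ν A ^ k := by
  simp only [choose_hits]
  rw [lintegral_finsetSum _ fun T _ => measurable_one.indicator (measurableSet_forall_mem hA T)]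
  rw [Finset.sum_congr rfl (g := fun _ => ν A ^ k)]
  · rw [Finset.sum_const, Finset.card_powersetCard, Finset.card_fin, nsmul_eq_mul]
  · intro T hT
    rw [lintegral_indicator_one (measurableSet_forall_mem hA T)]
    have : {g : Fin t → H | ∀ i ∈ T, g i ∈ A} =
        Set.pi Set.univ fun i => if i ∈ T then A else Set.univ := by
      ext g
      simp only [Set.mem_ofPred_eq, Set.mem_pi, Set.mem_univ, true_implies]
      refine forall_congr' fun i => ?_
      split_ifs with h <;> simp [h]
    rw [this, Measure.pi_pi]
    simp only [apply_ite ν, measure_univ]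
    rw [Finset.prod_ite_mem, Finset.univ_inter, Finset.prod_const, (Finset.mem_powersetCard.1 hT).2]

lemma integrable_choose_hits {t : ℕ} {A : Set H} (hA : MeasurableSet A) (k : ℕ) :
    Integrable (fun g : Fin t → H => ((hits A g).choose k : ℝ)) (Measure.pi fun _ => ν) := by
  have := integrable_toReal_of_lintegral_ne_top
    (μ := Measure.pi fun _ : Fin t => ν) (measurable_choose_hits hA k).aemeasurable (by
      rw [lintegral_choose_hits ν hA]
      exact ENNReal.mul_ne_top (by simp) (ENNReal.pow_ne_top (measure_ne_top ν A)))
  simpa using this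

lemma integral_choose_hits {t : ℕ} {A : Set H} (hA : MeasurableSet A) (k : ℕ) :
    ∫ g : Fin t → H, ((hits A g).choose k : ℝ) ∂(Measure.pi fun _ => ν) =
      t.choose k * ν.real A ^ k := by
  have := integral_toReal (μ := Measure.pi fun _ : Fin t => ν)
    (measurable_choose_hits hA k).aemeasurable (by simp)
  rw [lintegral_choose_hits ν hA] at this
  simpa [Measure.real] using this

/-- Chebyshev's inequality for the number of hits. -/
lemma measure_hits_le {t : ℕ} {A : Set H} (hA : MeasurableSet A) {δ : ℝ} (hδ : 0 < δ) :
    (Measure.pi fun _ : Fin t => ν).real {g | (hits A g : ℝ) ≤ t * ν.real A - δ} ≤ t / δ ^ 2 := by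
  set s := ν.real A
  have hs1 : s ≤ 1 := measureReal_le_one
  have hs0 : 0 ≤ s := measureReal_nonneg
  have hvar : ∫ g : Fin t → H, ((hits A g : ℝ) - t * s) ^ 2 ∂(Measure.pi fun _ => ν) =
      t * s * (1 - s) := by
    simp only [sq_hits_sub]
    have h2 := (integrable_choose_hits (t := t) ν hA 2).const_mul 2
    have h1 := (integrable_choose_hits (t := t) ν hA 1).const_mul (1 - 2 * (t * s))
    rw [integral_add (show Integrable (fun g => _ + _) _ from h2.add h1) (integrable_const _),
      integral_add h2 h1, integral_const_mul, integral_const_mul,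
      integral_choose_hits ν hA, integral_choose_hits ν hA, integral_const]
    simp only [probReal_univ, smul_eq_mul, one_mul, Nat.choose_one_right, Nat.cast_choose_two,
      pow_one]
    change 2 * (t * (t - 1) / 2 * s ^ 2) + (1 - 2 * (t * s)) * (t * s) + (t * s) ^ 2 = _
    ring
  have hintegrable : Integrable (fun g : Fin t → H => ((hits A g : ℝ) - t * s) ^ 2)
      (Measure.pi fun _ => ν) := by
    simp only [sq_hits_sub]
    exact (((integrable_choose_hits ν hA 2).const_mul _).add
      ((integrable_choose_hits ν hA 1).const_mul _)).add (integrable_const _)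
  have hmk := mul_meas_ge_le_integral_of_nonneg (Filter.Eventually.of_forall fun g => sq_nonneg _)
    hintegrable (δ ^ 2)
  rw [hvar] at hmk
  rw [le_div_iff₀ (by positivity), mul_comm]
  have hsub : {g : Fin t → H | (hits A g : ℝ) ≤ t * s - δ} ⊆
      {g | δ ^ 2 ≤ ((hits A g : ℝ) - t * s) ^ 2} := by
    intro g hg
    simp only [Set.mem_ofPred_eq] at hg ⊢
    nlinarith
  have ht : (0 : ℝ) ≤ t := Nat.cast_nonneg t
  calc δ ^ 2 * (Measure.pi fun _ : Fin t => ν).real {g | (hits A g : ℝ) ≤ t * s - δ}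
      ≤ δ ^ 2 * (Measure.pi fun _ : Fin t => ν).real
        {g | δ ^ 2 ≤ ((hits A g : ℝ) - t * s) ^ 2} :=
        mul_le_mul_of_nonneg_left (measureReal_mono hsub) (by positivity)
    _ ≤ _ := hmk.trans (by
        have : s * (1 - s) ≤ 1 := by nlinarith
        nlinarith [mul_le_mul_of_nonneg_left this ht])

/-- The numerator is a falling factorial, so `m` enters only through `m.choose k`, whose expectation
is explicit. -/
lemma pairWeight_zero_eq (L : ℝ) (k m : ℕ) :
    pairWeight L k 0 m =
      (m.choose k : ℝ) * (k.factorial / ∏ j ∈ Finset.range k, (L - j)) := by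
  rw [pairWeight, ← Finset.range_eq_Ico, Finset.prod_div_distrib, ← Nat.cast_prod,
    ← Nat.descFactorial_eq_prod_range, Nat.descFactorial_eq_factorial_mul_choose]
  push_cast
  ring

lemma measurable_pairWeight_hits {t : ℕ} {A : Set H} (hA : MeasurableSet A) (L : ℝ) (k : ℕ) :
    Measurable fun g : Fin t → H => pairWeight L k 0 (hits A g) := by
  simp only [pairWeight_zero_eq]
  have := (measurable_choose_hits (t := t) hA k).ennreal_toReal
  simp only [ENNReal.toReal_natCast] at this
  exact this.mul_const _

/-- Taking expectations replaces `m.choose k` by `t.choose k` times the `k`-th power of the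
collision probability, and each factor `(t - j) / (L - j)` is at most `t / (L - k)`. -/
lemma lintegral_pairWeight_hits_le {t : ℕ} {A : Set H} (hA : MeasurableSet A) {L : ℝ} {k : ℕ}
    (hk : (k : ℝ) < L) :
    ∫⁻ g : Fin t → H, ENNReal.ofReal (pairWeight L k 0 (hits A g)) ∂(Measure.pi fun _ => ν) ≤
      ENNReal.ofReal ((t / (L - k)) ^ k * ν.real A ^ k) := by
  have hpos : ∀ j ∈ Finset.range k, 0 < L - (j : ℝ) := fun j hj => by
    have : (j : ℝ) < k := by exact_mod_cast Finset.mem_range.1 hj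
    linarith
  have hP : 0 ≤ (k.factorial : ℝ) / ∏ j ∈ Finset.range k, (L - j) :=
    div_nonneg (by positivity) (Finset.prod_nonneg fun j hj => (hpos j hj).le)
  have e : ∀ g : Fin t → H, ENNReal.ofReal (pairWeight L k 0 (hits A g)) =
      ((hits A g).choose k : ℝ≥0∞) *
        ENNReal.ofReal (k.factorial / ∏ j ∈ Finset.range k, (L - j)) := by
    intro g
    rw [pairWeight_zero_eq, ENNReal.ofReal_mul (by positivity), ENNReal.ofReal_natCast]
  simp only [e]
  rw [lintegral_mul_const _ (measurable_choose_hits hA k), lintegral_choose_hits ν hA]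
  have hν : ν A = ENNReal.ofReal (ν.real A) := by simp [Measure.real]
  have hs : (0 : ℝ) ≤ ν.real A ^ k := pow_nonneg measureReal_nonneg _
  rw [hν, ← ENNReal.ofReal_pow measureReal_nonneg, ← ENNReal.ofReal_natCast,
    ← ENNReal.ofReal_mul (by positivity), ← ENNReal.ofReal_mul (by positivity)]
  refine ENNReal.ofReal_le_ofReal ?_
  rw [mul_right_comm, ← pairWeight_zero_eq]
  gcongr
  rw [pairWeight, ← Finset.range_eq_Ico]
  calc ∏ j ∈ Finset.range k, ((t - j : ℕ) : ℝ) / (L - j)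
      ≤ ∏ j ∈ Finset.range k, (t : ℝ) / (L - k) := by
        refine Finset.prod_le_prod (fun j hj => div_nonneg (Nat.cast_nonneg _) (hpos j hj).le)
          fun j hj => ?_
        have : (j : ℝ) < k := by exact_mod_cast Finset.mem_range.1 hj
        exact div_le_div₀ (Nat.cast_nonneg _) (by exact_mod_cast Nat.sub_le t j) (by linarith)
          (by linarith)
    _ = _ := by rw [Finset.prod_const, Finset.card_range]

end Embedding

section Join

variable {X H β : Type*} {hash : H → X → β} {sim : X → X → ℝ} {lam : ℝ} {limit : ℕ} {n t : ℕ}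
  {pts : Fin n → X}

lemma embeddedInput_regular (g : Fin t → H) :
    (embeddedInput hash sim lam limit pts g).Regular := by
  refine ⟨fun x => by simp [embeddedInput], fun x => ?_⟩
  refine List.Nodup.map (fun i j h => (Prod.ext_iff.1 h).1) (List.nodup_finRange t)

/-- Tokens carry their index, so common tokens correspond to the indices at which the hash values
agree. -/
lemma embeddedInput_overlap (g : Fin t → H) (x y : Fin n) :
    (embeddedInput hash sim lam limit pts g).overlap x y =
      hits {h | hash h (pts x) = hash h (pts y)} g := by
  rw [Input.overlap, hits, ← Finset.card_map
    ⟨fun i => (i, hash (g i) (pts x)), fun i j h => (Prod.ext_iff.1 h).1⟩]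
  congr 1
  ext ⟨i, b⟩
  simp only [Finset.mem_inter, Input.mem_tokens, embeddedInput, List.mem_map, List.mem_finRange,
    true_and, Prod.mk.injEq, exists_eq_left, Finset.mem_map, Finset.mem_filter, Finset.mem_univ,
    Set.mem_ofPred_eq]
  constructor
  · rintro ⟨h1, h2⟩; exact ⟨i, h1.trans h2.symm, Prod.ext rfl h1⟩
  · rintro ⟨j, h1, h2⟩
    obtain ⟨rfl, h3⟩ := Prod.mk.inj h2
    exact ⟨h3, h1.symm.trans h3⟩

lemma mem_totalOut_simJoin {R : ℕ} {g : Fin t → H} {ω : Seeds (Fin t × β)} {q : Fin n × Fin n} :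
    q ∈ totalOut (simJoin hash sim lam limit R pts g ω) ↔ ∃ k, ∃ i < R,
      q ∈ (cpsJoin (embeddedInput hash sim lam limit pts g) (seedHash i ω) k []
        (List.finRange n)).out := by
  simp only [totalOut, Set.mem_iUnion, simJoin, hold_out, bind_out, ticks_out, Set.empty_union,
    mem_forEach_out, List.mem_range]
  rfl

/-- Only pairs of the join are reported. -/
lemma totalOut_subset_joinSet [MeasurableSpace H] {ν : Measure H} [IsProbabilityMeasure ν]
    (h : IsLSHFamily ν hash sim) (hlam : lam ≤ 1) (R : ℕ) (g : Fin t → H)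
    (ω : Seeds (Fin t × β)) :
    totalOut (simJoin hash sim lam limit R pts g ω) ⊆ joinSet sim lam pts := by
  intro q hq
  obtain ⟨k, i, -, hq⟩ := mem_totalOut_simJoin.1 hq
  have hsymm : ∀ x y, sim x y = sim y x := fun x y => by
    rw [← (h x y).2, ← (h y x).2]
    simp only [eq_comm]
  rcases cpsJoin_out_sound (embeddedInput_regular g) _ _ _ (List.nodup_finRange n) hq with
    hq | hq | hq
  -- `(x, x)` is reported without comparison; its collision event is the whole space.
  · have : sim (pts q.1) (pts q.2) = 1 := by
      rw [← (h _ _).2, hq]; simp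
    exact hlam.trans_eq this.symm
  · exact hq
  · exact (show lam ≤ sim (pts q.2) (pts q.1) from hq).trans_eq (hsymm _ _)

lemma simJoin_cmps (R : ℕ) (g : Fin t → H) (ω : Seeds (Fin t × β)) (k : ℕ) :
    (simJoin hash sim lam limit R pts g ω k).cmps = ∑ i ∈ Finset.range R,
      treeCost (embeddedInput hash sim lam limit pts g)
        (callCmps (embeddedInput hash sim lam limit pts g)) (fun _ => 0) (seedHash i ω) k []
        (List.finRange n) := by
  simp only [simJoin, hold_cmps, bind_cmps, ticks_cmps, zero_add, forEach_cmps,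
    cpsJoin_cmps (embeddedInput_regular g)]
  rw [← List.sum_toFinset _ (List.nodup_range), List.toFinset_range]
  rfl

lemma simJoin_time_le (hn : 1 ≤ n) (R : ℕ) (g : Fin t → H) (ω : Seeds (Fin t × β)) (k : ℕ) :
    (simJoin hash sim lam limit R pts g ω k).time ≤ (n * t + R) +
      (5 * t + 9) * ∑ i ∈ Finset.range R,
      treeCost (embeddedInput hash sim lam limit pts g)
        (callWork (embeddedInput hash sim lam limit pts g)) (fun _ => 0) (seedHash i ω) k []
        (List.finRange n) := by
  simp only [simJoin, hold_time, bind_time, ticks_time, forEach_time]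
  rw [← List.sum_toFinset _ (List.nodup_range), List.toFinset_range, Finset.sum_add_distrib,
    Finset.sum_const, Finset.card_range, smul_eq_mul, mul_one, Finset.mul_sum, add_assoc]
  gcongr with i hi
  exact cpsJoin_time_le (embeddedInput_regular g) (seedHash i ω) k [] (List.nodup_finRange n)
    (List.ne_nil_of_length_pos (by rw [List.length_finRange]; exact hn))

lemma simJoin_space_le (hl : 1 ≤ limit) (R : ℕ) (g : Fin t → H) (ω : Seeds (Fin t × β)) (K k : ℕ)
    (h : ∀ i < R, treeCost (embeddedInput hash sim lam limit pts g) (fun _ => 0) orderedPairs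
      (seedHash i ω) K [] (List.finRange n) = 0) :
    (simJoin hash sim lam limit R pts g ω k).space ≤
      n * t + (K + 1) * (n + 1 + 4 * (n * t)) := by
  simp only [simJoin, hold_space, bind_space, ticks_space]
  gcongr
  refine max_le (Nat.zero_le _) (forEach_space_le fun i hi => ?_)
  simp only [bind_space, ticks_space, Nat.zero_max]
  exact cpsJoin_space_le (embeddedInput_regular g) hl (seedHash i ω) n K k []
    (List.nodup_finRange n) (by simp) (h i (List.mem_range.1 hi))

/-- Monotone convergence: bounds uniform in the cut-off carry over to the recursion without cut-off.
-/
lemma lintegral_iSup_treeCost_le {ι τ : Type*} {I : Input ι τ} {node : List ι → ℕ} {S : List ι}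
    {b : ℝ≥0∞} (hb : ∀ i k, ∫⁻ ω, (treeCost I node (fun _ => 0) (seedHash i ω) k [] S : ℝ≥0∞)
      ∂(seedMeasure τ) ≤ b) (R c A : ℕ) :
    ∫⁻ ω, ⨆ k, ((c + A * ∑ i ∈ Finset.range R,
      treeCost I node (fun _ => 0) (seedHash i ω) k [] S : ℕ) : ℝ≥0∞) ∂(seedMeasure τ) ≤
      c + A * (R * b) := by
  have hm : ∀ i k, Measurable fun ω : Seeds τ =>
      (treeCost I node (fun _ => 0) (seedHash i ω) k [] S : ℝ≥0∞) := fun i k =>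
    (measurable_of_countable _).comp (measurable_treeCost _ _ _ _ _ _)
  have hm' : ∀ k, Measurable fun ω : Seeds τ => ((c + A * ∑ i ∈ Finset.range R,
      treeCost I node (fun _ => 0) (seedHash i ω) k [] S : ℕ) : ℝ≥0∞) := fun k => by
    push_cast
    exact measurable_const.add (measurable_const.mul (Finset.measurable_sum _ fun i _ => hm i k))
  rw [lintegral_iSup hm']
  · refine iSup_le fun k => ?_
    push_cast
    rw [lintegral_add_left measurable_const,
      lintegral_const_mul _ (Finset.measurable_sum _ fun i _ => hm i k),
      lintegral_finsetSum _ fun i _ => hm i k, lintegral_const, measure_univ, mul_one]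
    gcongr
    refine (Finset.sum_le_card_nsmul _ _ b fun i _ => hb i k).trans_eq ?_
    rw [Finset.card_range, nsmul_eq_mul]
  · refine monotone_nat_of_le_succ fun k ω => ?_
    simp only [Nat.cast_le]
    gcongr
    exact treeCost_mono_depth _ _ _ _ _

end Join

/-! ### Expected cost -/

section Cost

variable {X H β : Type*} {hash : H → X → β} {sim : X → X → ℝ} {lam : ℝ} {limit : ℕ} {n t : ℕ}
  {pts : Fin n → X}

/-- The cost of the stopping depth `k` for the point `x`. -/
def stopCost (sim : X → X → ℝ) (lam : ℝ) (pts : Fin n → X) (x : Fin n) (k : ℕ) : ℝ :=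
  ∑ y ∈ Finset.univ.erase x, (sim (pts x) (pts y) / lam) ^ k + (1 / lam) ^ k

lemma individualCost_eq : individualCost sim lam pts = ∑ x, ⨅ k, stopCost sim lam pts x k := rfl

lemma IsLSHFamily.nonneg [MeasurableSpace H] {ν : Measure H} (h : IsLSHFamily ν hash sim)
    (x y : X) : 0 ≤ sim x y := by
  rw [← (h x y).2]
  exact measureReal_nonneg

lemma le_stopCost (hlam : lam ∈ Set.Ioo (0 : ℝ) 1) (hsim : ∀ x y, 0 ≤ sim x y) (x : Fin n)
    (k : ℕ) : (1 / lam) ^ k ≤ stopCost sim lam pts x k := by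
  have := hlam.1
  refine le_add_of_nonneg_left (Finset.sum_nonneg fun y _ => ?_)
  have := hsim (pts x) (pts y)
  positivity

lemma one_le_inv_pow (hlam : lam ∈ Set.Ioo (0 : ℝ) 1) (k : ℕ) : 1 ≤ (1 / lam) ^ k :=
  one_le_pow₀ (one_le_one_div hlam.1 hlam.2.le)

lemma one_le_iInf_stopCost (hlam : lam ∈ Set.Ioo (0 : ℝ) 1) (hsim : ∀ x y, 0 ≤ sim x y)
    (x : Fin n) : 1 ≤ ⨅ k, stopCost sim lam pts x k :=
  le_ciInf fun k => (one_le_inv_pow hlam k).trans (le_stopCost hlam hsim x k)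

lemma le_individualCost (hlam : lam ∈ Set.Ioo (0 : ℝ) 1) (hsim : ∀ x y, 0 ≤ sim x y) :
    (n : ℝ) ≤ individualCost sim lam pts := by
  rw [individualCost_eq]
  have := Finset.card_nsmul_le_sum Finset.univ (fun x => ⨅ k, stopCost sim lam pts x k) 1
    fun x _ => one_le_iInf_stopCost hlam hsim x
  simpa using this

lemma stopCost_zero (x : Fin n) : stopCost sim lam pts x 0 = n := by
  have : 1 ≤ n := by have := x.2; omega
  simp [stopCost, Finset.card_erase_of_mem, Nat.cast_sub this]

/-- Stopping depths beyond `log n / log (1 / λ)` are never needed. -/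
lemma exists_depth (hlam : lam ∈ Set.Ioo (0 : ℝ) 1) (hsim : ∀ x y, 0 ≤ sim x y) (x : Fin n) :
    ∃ k : ℕ, (k : ℝ) * Real.log (1 / lam) ≤ Real.log n ∧
      (k = 0 ∨ (Real.log (1 / lam) / Real.log n ≤ 1 / 4 ∧
        k * (Real.log (1 / lam) / Real.log n) ≤ 1)) ∧
      stopCost sim lam pts x k ≤ 2 * (1 / lam) ^ 4 * ⨅ k, stopCost sim lam pts x k := by
  have hn : 1 ≤ n := by have := x.2; omega
  have hn' : (1 : ℝ) ≤ n := by exact_mod_cast hn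
  have hinf := one_le_iInf_stopCost (pts := pts) hlam hsim x
  have h4 := one_le_inv_pow hlam 4
  set f := stopCost sim lam pts x with hf
  have hl0 : 0 < 1 / lam := one_div_pos.2 hlam.1
  have hlog : 0 < Real.log (1 / lam) := Real.log_pos (one_lt_one_div hlam.1 hlam.2)
  -- A near-minimizer at the price of a factor `2`; whether the infimum is attained does not matter.
  obtain ⟨k, hk⟩ : ∃ k, f k < 2 * ⨅ k, f k := exists_lt_of_ciInf_lt (by linarith)
  have hfk : 1 ≤ f k := (one_le_inv_pow hlam k).trans (le_stopCost hlam hsim x k)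
  -- If `ε > 1 / 4`, then `n ≤ (1 / λ) ^ 4`; if `(1 / λ) ^ k ≥ n`, depth `k` costs at least `n`.
  -- Either way depth `0`, of cost `n`, loses at most the factor `(1 / λ) ^ 4`.
  by_cases hc : Real.log (1 / lam) / Real.log n ≤ 1 / 4 ∧ (1 / lam) ^ k < n
  · have hkl : (k : ℝ) * Real.log (1 / lam) ≤ Real.log n := by
      rw [← Real.log_pow]
      exact Real.log_le_log (by positivity) hc.2.le
    refine ⟨k, hkl, Or.inr ⟨hc.1, ?_⟩, ?_⟩
    · rw [← mul_div_assoc]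
      exact div_le_one_of_le₀ hkl (Real.log_nonneg hn')
    · nlinarith
  · refine ⟨0, by simpa using Real.log_nonneg hn', Or.inl rfl, ?_⟩
    rw [hf, stopCost_zero, ← hf]
    have hnk : (n : ℝ) ≤ (1 / lam) ^ 4 * f k := by
      by_cases h1 : Real.log (1 / lam) / Real.log n ≤ 1 / 4
      · have h2 : (n : ℝ) ≤ (1 / lam) ^ k := not_lt.1 fun h => hc ⟨h1, h⟩
        have h3 := h2.trans (le_stopCost (pts := pts) hlam hsim x k)
        rw [← hf] at h3
        nlinarith
      · rw [not_le, lt_div_iff₀ (by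
          by_contra h0
          have : Real.log n = 0 := le_antisymm (not_lt.1 h0) (Real.log_nonneg hn')
          rw [this, div_zero] at h1
          norm_num at h1)] at h1
        have h2 : Real.log n ≤ Real.log ((1 / lam) ^ 4) := by
          rw [Real.log_pow]; push_cast; linarith
        have h3 : (n : ℝ) ≤ (1 / lam) ^ 4 :=
          (Real.log_le_log_iff (by linarith) (by positivity)).1 h2
        nlinarith
    nlinarith

lemma callPotential_root (g : Fin t → H) (k : Fin n → ℕ) (a : Fin n → ℕ → ℝ) (c : Fin n → ℝ) :
    callPotential (embeddedInput hash sim lam limit pts g) k a c [] (List.finRange n) =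
      ∑ x, (a x 0 + c x * ∑ y ∈ Finset.univ.erase x,
        pairWeight (lam * t) (k x) 0 (hits {h | hash h (pts x) = hash h (pts y)} g)) := by
  unfold callPotential pointPotential
  refine Finset.sum_congr (by ext; simp) fun x _ => ?_
  have hd : distinct ([] : List (Fin t × β)) = 0 := by simp [distinct]
  rw [hd]
  congr 2
  refine Finset.sum_congr (by ext; simp) fun y _ => ?_
  rw [embeddedInput_overlap]
  rfl

lemma admissible_embeddedInput (hlam : lam ∈ Set.Ioo (0 : ℝ) 1) (hlimit : 1 ≤ limit) (hn : 1 ≤ n)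
    {k : ℕ} (hkt : 4 * (k : ℝ) ^ 2 < lam * t)
    (hk : k = 0 ∨ (Real.log (1 / lam) / Real.log n ≤ 1 / 4 ∧
        k * (Real.log (1 / lam) / Real.log n) ≤ 1)) (g : Fin t → H) :
    Admissible (embeddedInput hash sim lam limit pts g) k := by
  refine ⟨hlam, hlimit, ?_, hkt, hk⟩
  exact div_nonneg (Real.log_nonneg (one_le_one_div hlam.1 hlam.2.le))
    (Real.log_nonneg (by exact_mod_cast hn))

variable [MeasurableSpace H] {ν : Measure H} [IsProbabilityMeasure ν]

/-- Expectation of the potential of the root over the embedding. -/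
lemma lintegral_callPotential_le (h : IsLSHFamily ν hash sim) (hlam : lam ∈ Set.Ioo (0 : ℝ) 1)
    {k : Fin n → ℕ} {a : Fin n → ℕ → ℝ} {c : Fin n → ℝ} (ha : ∀ x, 0 ≤ a x 0) (hc : ∀ x, 0 ≤ c x)
    (hk : ∀ x, (k x : ℝ) < lam * t)
    (hb : ∀ x, (t / (lam * t - k x)) ^ k x ≤ 2 * (1 / lam) ^ k x) :
    ∫⁻ g : Fin t → H, ENNReal.ofReal (callPotential (embeddedInput hash sim lam limit pts g)
      k a c [] (List.finRange n)) ∂(Measure.pi fun _ => ν) ≤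
      ENNReal.ofReal (∑ x, (a x 0 + c x * ∑ y ∈ Finset.univ.erase x,
        2 * (sim (pts x) (pts y) / lam) ^ k x)) := by
  have hmeas : ∀ x y, MeasurableSet {h | hash h (pts x) = hash h (pts y)} := fun x y =>
    (h (pts x) (pts y)).1
  have hm : ∀ x y, Measurable fun g : Fin t → H => ENNReal.ofReal (pairWeight (lam * t) (k x) 0
      (hits {h | hash h (pts x) = hash h (pts y)} g)) := fun x y =>
    (measurable_pairWeight_hits (hmeas x y) _ _).ennreal_ofReal
  have hw : ∀ x m, 0 ≤ pairWeight (lam * t) (k x) 0 m := fun x m => pairWeight_nonneg (hk x) 0 m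
  have hsim := h.nonneg
  have hl := hlam.1
  have e : ∀ g : Fin t → H, ENNReal.ofReal (callPotential
      (embeddedInput hash sim lam limit pts g) k a c [] (List.finRange n)) =
      ∑ x, (ENNReal.ofReal (a x 0) + ENNReal.ofReal (c x) * ∑ y ∈ Finset.univ.erase x,
        ENNReal.ofReal (pairWeight (lam * t) (k x) 0
          (hits {h | hash h (pts x) = hash h (pts y)} g))) := by
    intro g
    rw [callPotential_root, ENNReal.ofReal_sum_of_nonneg fun x _ => add_nonneg (ha x)
      (mul_nonneg (hc x) (Finset.sum_nonneg fun y _ => hw x _))]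
    refine Finset.sum_congr rfl fun x _ => ?_
    rw [ENNReal.ofReal_add (ha x) (mul_nonneg (hc x) (Finset.sum_nonneg fun y _ => hw x _)),
      ENNReal.ofReal_mul (hc x), ENNReal.ofReal_sum_of_nonneg fun y _ => hw x _]
  have e' : ENNReal.ofReal (∑ x, (a x 0 + c x * ∑ y ∈ Finset.univ.erase x,
        2 * (sim (pts x) (pts y) / lam) ^ k x)) =
      ∑ x, (ENNReal.ofReal (a x 0) + ENNReal.ofReal (c x) * ∑ y ∈ Finset.univ.erase x,
        ENNReal.ofReal (2 * (sim (pts x) (pts y) / lam) ^ k x)) := by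
    have hp : ∀ x y, 0 ≤ 2 * (sim (pts x) (pts y) / lam) ^ k x := fun x y => by
      have := hsim (pts x) (pts y)
      positivity
    rw [ENNReal.ofReal_sum_of_nonneg fun x _ => add_nonneg (ha x)
      (mul_nonneg (hc x) (Finset.sum_nonneg fun y _ => hp x y))]
    refine Finset.sum_congr rfl fun x _ => ?_
    rw [ENNReal.ofReal_add (ha x) (mul_nonneg (hc x) (Finset.sum_nonneg fun y _ => hp x y)),
      ENNReal.ofReal_mul (hc x), ENNReal.ofReal_sum_of_nonneg fun y _ => hp x y]
  simp only [e]
  rw [e', lintegral_finsetSum _ fun x _ => (show Measurable fun g => _ + _ from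
    measurable_const.add ((Finset.measurable_sum _ fun y _ => hm x y).const_mul _))]
  refine Finset.sum_le_sum fun x _ => ?_
  rw [lintegral_add_left measurable_const, lintegral_const, measure_univ, mul_one,
    lintegral_const_mul _ (Finset.measurable_sum _ fun y _ => hm x y),
    lintegral_finsetSum _ fun y _ => hm x y]
  gcongr with y hy
  refine (lintegral_pairWeight_hits_le ν (hmeas x y) (hk x)).trans
    (ENNReal.ofReal_le_ofReal ?_)
  rw [(h (pts x) (pts y)).2]
  have h1 : 0 ≤ sim (pts x) (pts y) ^ k x := pow_nonneg (hsim _ _) _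
  calc _ ≤ 2 * (1 / lam) ^ k x * sim (pts x) (pts y) ^ k x := by
        gcongr
        exact hb x
    _ = _ := by rw [div_pow, div_pow, one_pow]; ring

/-- The expected number of comparisons. -/
theorem expect_totalCmps_le (h : IsLSHFamily ν hash sim) (hlam : lam ∈ Set.Ioo (0 : ℝ) 1)
    (hlimit : 1 ≤ limit) (hn : 1 ≤ n) (ht : 1 ≤ lam * t)
    (hsize : ∀ k : ℕ, (k : ℝ) * Real.log (1 / lam) ≤ Real.log n → 4 * (k : ℝ) ^ 2 < lam * t)
    (R : ℕ) :
    expect ν t (Fin t × β) (fun g ω => totalCmps (simJoin hash sim lam limit R pts g ω)) ≤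
      ENNReal.ofReal (R * ((2 * limit + 2 * Real.exp 4) * (2 * (1 / lam) ^ 4) *
        individualCost sim lam pts)) := by
  have hsim := h.nonneg
  choose k hk1 hk2 hk3 using fun x => exists_depth (pts := pts) hlam hsim x
  have hadm := fun (g : Fin t → H) x => admissible_embeddedInput (hash := hash) (sim := sim)
    (pts := pts) hlam hlimit hn (hsize _ (hk1 x)) (hk2 x) g
  set B : Fin n → ℝ := fun x => t / (lam * t - k x) with hB
  set a : Fin n → ℕ → ℝ := fun x D => if D < k x then limit * B x ^ (k x - D) else 0 with ha
  -- The bounds on `k x` do not involve the hash functions, so any sample serves to extract them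
  -- from `hadm`.
  obtain ⟨g₀⟩ : Nonempty (Fin t → H) := by
    have := nonempty_of_isProbabilityMeasure ν
    infer_instance
  have hkt : ∀ x, (k x : ℝ) < lam * t := fun x => (hadm g₀ x).lt_size
  have hB2 : ∀ x, B x ^ k x ≤ 2 * (1 / lam) ^ k x := fun x => (hadm g₀ x).branching_pow_le
  have hB0 : ∀ x, 0 ≤ B x := fun x => div_nonneg (Nat.cast_nonneg t) (by linarith [hkt x])
  have ha0 : ∀ x, 0 ≤ a x 0 := fun x => by
    have := hB0 x
    simp only [ha]
    split_ifs <;> positivity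
  have hpt : ∀ x, a x 0 + Real.exp 4 * ∑ y ∈ Finset.univ.erase x,
      2 * (sim (pts x) (pts y) / lam) ^ k x ≤
      (2 * limit + 2 * Real.exp 4) * (2 * (1 / lam) ^ 4) * ⨅ k, stopCost sim lam pts x k := by
    intro x
    have h1 : a x 0 ≤ 2 * limit * (1 / lam) ^ k x := by
      simp only [ha, Nat.sub_zero]
      split_ifs
      · nlinarith [mul_le_mul_of_nonneg_left (hB2 x) (Nat.cast_nonneg (α := ℝ) limit)]
      · have := hlam.1
        positivity
    have h2 : 0 ≤ ∑ y ∈ Finset.univ.erase x, (sim (pts x) (pts y) / lam) ^ k x :=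
      Finset.sum_nonneg fun y _ => pow_nonneg (div_nonneg (hsim _ _) hlam.1.le) _
    have h3 := one_le_inv_pow hlam (k x)
    have h4 := hk3 x
    have h5 : a x 0 + Real.exp 4 * ∑ y ∈ Finset.univ.erase x,
        2 * (sim (pts x) (pts y) / lam) ^ k x ≤
        (2 * limit + 2 * Real.exp 4) * stopCost sim lam pts x (k x) := by
      rw [← Finset.mul_sum, stopCost]
      have := Real.exp_pos 4
      have h6 : 0 ≤ (limit : ℝ) * ∑ y ∈ Finset.univ.erase x, (sim (pts x) (pts y) / lam) ^ k x := by
        positivity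
      have h7 : 0 ≤ Real.exp 4 * (1 / lam) ^ k x := by positivity
      linarith
    refine h5.trans ?_
    rw [mul_assoc (2 * (limit : ℝ) + 2 * Real.exp 4)]
    gcongr
  have hinner : ∀ g : Fin t → H, ∫⁻ ω, totalCmps (simJoin hash sim lam limit R pts g ω)
      ∂(seedMeasure (Fin t × β)) ≤ R * ENNReal.ofReal (callPotential
        (embeddedInput hash sim lam limit pts g) k a (fun _ => Real.exp 4) [] (List.finRange n)) := by
    intro g
    have := lintegral_iSup_treeCost_le (fun i d => lintegral_treeCost_le_callPotential
      (embeddedInput_regular g) hlimit ht (hadm g ⟨0, hn⟩).eps_nonneg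
      (fun x => (hadm g x).isPotential_cmps)
      (node := callCmps (embeddedInput hash sim lam limit pts g))
      (fun S => by rw [zero_mul, zero_add]; rfl) i d (List.nodup_finRange n)) R 0 1
    simp only [Nat.cast_zero, zero_add, Nat.cast_one, one_mul] at this
    refine le_trans (le_of_eq ?_) this
    simp only [totalCmps, simJoin_cmps]
  refine (lintegral_mono hinner).trans ?_
  -- The primed version asks for a finite constant instead of measurability of the potential in `g`.
  rw [lintegral_const_mul' _ _ (by simp), ENNReal.ofReal_mul (by positivity),
    ENNReal.ofReal_natCast, individualCost_eq, Finset.mul_sum]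
  gcongr
  refine (lintegral_callPotential_le h hlam ha0 (fun _ => (Real.exp_pos 4).le) hkt hB2).trans
    (ENNReal.ofReal_le_ofReal (Finset.sum_le_sum fun x _ => hpt x))

/-- Serves `n = 1`: there `log n = 0`, so `ε = 0` by the convention for division, and
`isPotential_work` is not available. -/
lemma treeCost_callWork_le_one {ι τ : Type*} {I : Input ι τ} (hI : I.Regular) (hl : 1 ≤ I.limit)
    (r : List τ → τ → ℝ) (k : ℕ) (p : List τ) {S : List ι} (hS : S.Nodup) (h1 : S.length ≤ 1) :
    treeCost I (callWork I) (fun _ => 0) r k p S ≤ 1 := by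
  cases k with
  | zero => simp [treeCost]
  | succ k =>
    have hc : (bruteForce I S).cmps = 0 := by
      have := bruteForce_induction hI (motive := fun S e => S.length ≤ 1 → e.cmps = 0) ?_ ?_ ?_ S hS
      · exact this h1
      · intro S hS _ h1
        simp only [bind_cmps, ticks_cmps, bruteForcePairs_cmps hS, ret_cmps, zero_add, add_zero,
          mul_eq_zero]
        omega
      · intro S _ hlt _ h1
        omega
      · intro S x e _ hlt _ _ _ h1
        omega
    rw [treeCost, bruteForce_val_eq_nil hI hl hS h1, callWork, hc]
    simpa [Input.tokensOf] using h1

/-- The expected running time. -/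
theorem expect_totalTime_le (h : IsLSHFamily ν hash sim) (hlam : lam ∈ Set.Ioo (0 : ℝ) 1)
    (hlimit : 1 ≤ limit) (hn : 1 ≤ n) (ht : 1 ≤ lam * t)
    (hsize : ∀ k : ℕ, (k : ℝ) * Real.log (1 / lam) ≤ Real.log n → 4 * (k : ℝ) ^ 2 < lam * t)
    (R : ℕ) :
    expect ν t (Fin t × β) (fun g ω => totalTime (simJoin hash sim lam limit R pts g ω)) ≤
      ENNReal.ofReal ((n * t + R) + (5 * t + 9) * (R *
        ((2 * limit / (1 - lam) + 2 * Real.exp 4 + 2 * (1 + limit / lam) / Real.log (1 / lam)) *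
          (1 + Real.log n) * (2 * (1 / lam) ^ 4) * individualCost sim lam pts))) := by
  have hsim := h.nonneg
  have hl0 := hlam.1
  have hl1 : 0 < 1 - lam := by linarith [hlam.2]
  have hn' : (1 : ℝ) ≤ n := by exact_mod_cast hn
  have hlogn : 0 ≤ Real.log n := Real.log_nonneg hn'
  have hell : 0 < Real.log (1 / lam) := Real.log_pos (one_lt_one_div hlam.1 hlam.2)
  set M := 2 * limit / (1 - lam) + 2 * Real.exp 4 + 2 * (1 + limit / lam) / Real.log (1 / lam)
    with hM
  have hW := le_individualCost (pts := pts) hlam hsim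
  have hM1 : 1 ≤ M := by
    have h1 := Real.one_le_exp (by norm_num : (0 : ℝ) ≤ 4)
    have h2 : 0 ≤ 2 * (limit : ℝ) / (1 - lam) := by positivity
    have h3 : 0 ≤ 2 * (1 + limit / lam) / Real.log (1 / lam) := by positivity
    linarith
  have h4 := one_le_inv_pow hlam 4
  set Q := M * (1 + Real.log n) * (2 * (1 / lam) ^ 4) * individualCost sim lam pts with hQ
  have hQ1 : 1 ≤ Q := by
    have a1 : 1 ≤ M * (1 + Real.log n) := one_le_mul_of_one_le_of_one_le hM1 (by linarith)
    have a2 : 1 ≤ M * (1 + Real.log n) * (2 * (1 / lam) ^ 4) :=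
      one_le_mul_of_one_le_of_one_le a1 (by linarith)
    exact one_le_mul_of_one_le_of_one_le a2 (hn'.trans hW)
  -- The bound `b g` per sample is kept abstract so that `n = 1` and `n ≥ 2` share the summation
  -- over repetitions.
  suffices hb : ∃ b : (Fin t → H) → ℝ≥0∞, (∀ g i d, ∫⁻ ω,
      (treeCost (embeddedInput hash sim lam limit pts g)
        (callWork (embeddedInput hash sim lam limit pts g)) (fun _ => 0) (seedHash i ω) d []
        (List.finRange n) : ℝ≥0∞) ∂(seedMeasure (Fin t × β)) ≤ b g) ∧
      ∫⁻ g, b g ∂(Measure.pi fun _ => ν) ≤ ENNReal.ofReal Q by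
    obtain ⟨b, hb1, hb2⟩ := hb
    have hinner : ∀ g : Fin t → H, ∫⁻ ω, totalTime (simJoin hash sim lam limit R pts g ω)
        ∂(seedMeasure (Fin t × β)) ≤ (n * t + R : ℕ) + (5 * t + 9 : ℕ) * (R * b g) := by
      intro g
      refine le_trans (lintegral_mono fun ω => ?_)
        (lintegral_iSup_treeCost_le (hb1 g) R (n * t + R) (5 * t + 9))
      refine iSup_mono fun d => ?_
      exact_mod_cast simJoin_time_le hn R g ω d
    refine (lintegral_mono hinner).trans ?_
    rw [lintegral_add_left measurable_const, lintegral_const, measure_univ, mul_one,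
      lintegral_const_mul' _ _ (ENNReal.natCast_ne_top _),
      lintegral_const_mul' _ _ (ENNReal.natCast_ne_top _),
      ENNReal.ofReal_add (by positivity) (by positivity), ENNReal.ofReal_mul (by positivity),
      ENNReal.ofReal_mul (by positivity)]
    have e1 : ENNReal.ofReal ((n : ℝ) * t + R) = ((n * t + R : ℕ) : ℝ≥0∞) := by
      rw [← ENNReal.ofReal_natCast]; push_cast; rfl
    have e2 : ENNReal.ofReal ((5 : ℝ) * t + 9) = ((5 * t + 9 : ℕ) : ℝ≥0∞) := by
      rw [← ENNReal.ofReal_natCast]; push_cast; rfl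
    rw [e1, e2, ENNReal.ofReal_natCast]
    gcongr
  rcases hn.eq_or_lt with rfl | hn2
  · refine ⟨fun _ => 1, fun g i d => ?_, ?_⟩
    · refine (lintegral_mono fun ω => ?_).trans_eq
        ((lintegral_const 1).trans (by rw [measure_univ, mul_one]))
      have := treeCost_callWork_le_one (embeddedInput_regular (hash := hash) (sim := sim)
        (lam := lam) (limit := limit) (pts := pts) g) hlimit (seedHash i ω) d []
        (List.nodup_finRange 1) (by simp)
      exact (Nat.cast_le.2 this).trans_eq Nat.cast_one
    · rw [lintegral_const, measure_univ, mul_one]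
      simpa using hQ1
  choose k hk1 hk2 hk3 using fun x => exists_depth (pts := pts) hlam hsim x
  have hadm := fun (g : Fin t → H) x => admissible_embeddedInput (hash := hash) (sim := sim)
    (pts := pts) hlam hlimit hn (hsize _ (hk1 x)) (hk2 x) g
  have hlogpos : 0 < Real.log n := Real.log_pos (by exact_mod_cast hn2)
  have heps : 0 < Real.log (1 / lam) / Real.log n := by positivity
  set B : Fin n → ℝ := fun x => t / (lam * t - k x) with hB
  set a : Fin n → ℕ → ℝ := fun x D => limit * ((B x ^ (k x - D) - lam) / (1 - lam)) with ha
  set c : ℝ := Real.exp 4 + (1 + limit / lam) / (Real.log (1 / lam) / Real.log n) with hc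
  obtain ⟨g₀⟩ : Nonempty (Fin t → H) := by
    have := nonempty_of_isProbabilityMeasure ν
    infer_instance
  have hkt : ∀ x, (k x : ℝ) < lam * t := fun x => (hadm g₀ x).lt_size
  have hB2 : ∀ x, B x ^ k x ≤ 2 * (1 / lam) ^ k x := fun x => (hadm g₀ x).branching_pow_le
  have hB1 : ∀ x, 1 ≤ B x := fun x => (hadm g₀ x).one_le_branching
  have ha0 : ∀ x, 0 ≤ a x 0 := fun x => by
    have : 0 ≤ B x ^ (k x - 0) - lam := by linarith [one_le_pow₀ (hB1 x) (n := k x - 0), hlam.2]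
    simp only [ha]
    positivity
  have hc0 : 0 ≤ c := by positivity
  refine ⟨fun g => ENNReal.ofReal (callPotential (embeddedInput hash sim lam limit pts g) k a
    (fun _ => c) [] (List.finRange n)), fun g i d => ?_, ?_⟩
  · exact lintegral_treeCost_le_callPotential (embeddedInput_regular g) hlimit ht
      (hadm g ⟨0, hn⟩).eps_nonneg (fun x => (hadm g x).isPotential_work heps)
      (node := callWork (embeddedInput hash sim lam limit pts g))
      (fun S => by rw [one_mul, callWork]; push_cast; rfl) i d (List.nodup_finRange n)
  refine (lintegral_callPotential_le h hlam ha0 (fun _ => hc0) hkt hB2).trans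
    (ENNReal.ofReal_le_ofReal ?_)
  rw [hQ, individualCost_eq, Finset.mul_sum]
  refine Finset.sum_le_sum fun x _ => ?_
  have h1 : a x 0 ≤ 2 * limit / (1 - lam) * (1 / lam) ^ k x := by
    simp only [ha, Nat.sub_zero]
    calc (limit : ℝ) * ((B x ^ k x - lam) / (1 - lam))
        ≤ limit * ((2 * (1 / lam) ^ k x) / (1 - lam)) := by
          gcongr
          linarith [hB2 x]
      _ = _ := by ring
  have h2 : 0 ≤ ∑ y ∈ Finset.univ.erase x, (sim (pts x) (pts y) / lam) ^ k x :=
    Finset.sum_nonneg fun y _ => pow_nonneg (div_nonneg (hsim _ _) hlam.1.le) _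
  have h3 := one_le_inv_pow hlam (k x)
  have hcM : 2 * limit / (1 - lam) + 2 * c ≤ M * (1 + Real.log n) := by
    have e : (1 + (limit : ℝ) / lam) / (Real.log (1 / lam) / Real.log n) =
        (1 + limit / lam) / Real.log (1 / lam) * Real.log n := by
      field_simp
    have p1 : 0 ≤ 2 * (limit : ℝ) / (1 - lam) := by positivity
    have p2 : 0 ≤ (1 + (limit : ℝ) / lam) / Real.log (1 / lam) := by positivity
    have e3 : 2 * (1 + (limit : ℝ) / lam) / Real.log (1 / lam) =
      2 * ((1 + (limit : ℝ) / lam) / Real.log (1 / lam)) := by ring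
    rw [hc, hM, e, e3]
    have p3 := (Real.exp_pos 4).le
    nlinarith [mul_nonneg p1 hlogn, mul_nonneg p3 hlogn, mul_nonneg p2 hlogn]
  have h5 : a x 0 + c * ∑ y ∈ Finset.univ.erase x, 2 * (sim (pts x) (pts y) / lam) ^ k x ≤
      (M * (1 + Real.log n)) * stopCost sim lam pts x (k x) := by
    refine le_trans ?_ (mul_le_mul_of_nonneg_right hcM
      ((zero_le_one.trans h3).trans (le_stopCost hlam hsim x (k x))))
    rw [← Finset.mul_sum, stopCost]
    have p1 : 0 ≤ 2 * (limit : ℝ) / (1 - lam) := by positivity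
    have h6 := mul_nonneg p1 h2
    have h7 : 0 ≤ c * (1 / lam) ^ k x := by positivity
    linarith
  refine h5.trans ?_
  rw [mul_assoc (M * (1 + Real.log n))]
  gcongr
  exact hk3 x

end Cost

/-! ### Recall and space of the join -/

section Guarantees

variable {X H β : Type*} {hash : H → X → β} {sim : X → X → ℝ} {lam : ℝ} {limit : ℕ} {n t : ℕ}
  {pts : Fin n → X} [MeasurableSpace H] {ν : Measure H} [IsProbabilityMeasure ν]

lemma orderedPairs_finRange (n : ℕ) :
    (orderedPairs (List.finRange n) : ℝ) = n * (n - 1) := by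
  rw [orderedPairs, List.length_finRange]
  cases n <;> simp

/-- Every pair of the join is reported with probability at least `φ`. -/
theorem le_prob_mem_totalOut (h : IsLSHFamily ν hash sim) (hlam : lam ∈ Set.Ioo (0 : ℝ) 1)
    (hlimit : 1 ≤ limit) (ht : 1 ≤ lam * t) {φ : ℝ} (hφ : φ ∈ Set.Ioo (0 : ℝ) 1) {R K : ℕ}
    (hK : 2 ≤ K) (hKt : 2 * (K : ℝ) ^ 2 ≤ lam ^ 2 * (1 - φ) * t)
    (hdeep : max (1 - Real.log (1 / lam) / Real.log n) 0 ^ K * ((n : ℝ) * (n - 1)) ≤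
      Real.exp (-2) / (2 * (K + 1)))
    (hR : Real.log (2 / (1 - φ)) ≤ R * (Real.exp (-2) / (2 * (K + 1))))
    {q : Fin n × Fin n} (hq : q ∈ joinSet sim lam pts) :
    ENNReal.ofReal φ ≤ prob ν t (Fin t × β)
      (fun g ω => q ∈ totalOut (simJoin hash sim lam limit R pts g ω)) := by
  obtain ⟨x, y⟩ := q
  have hxy : lam ≤ sim (pts x) (pts y) := hq
  have hyx : lam ≤ sim (pts y) (pts x) := by
    rw [← (h _ _).2] at hxy ⊢
    simpa only [eq_comm] using hxy
  have hK' : (2 : ℝ) ≤ K := by exact_mod_cast hK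
  have hl0 := hlam.1
  have hφ1 : 0 < 1 - φ := by linarith [hφ.2]
  have ht0 : (0 : ℝ) < t := by
    rcases Nat.eq_zero_or_pos t with rfl | h
    · norm_num at ht
    · exact_mod_cast h
  -- Half of the allowed failure probability goes to the embedding and half to the repetitions: `(1
  -- - η)² ≥ 1 - 2 η = φ`.
  set η := (1 - φ) / 2 with hη
  set A := {h | hash h (pts x) = hash h (pts y)} with hA
  have hAm : MeasurableSet A := (h (pts x) (pts y)).1
  have hAs : ν.real A = sim (pts x) (pts y) := (h (pts x) (pts y)).2
  -- The overlap may fall short of `λ t` by this factor, since its `K`-th power is still at least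
  -- `exp (-2)`.
  set b : ℝ := 1 - 1 / K with hb
  have hKinv : (1 : ℝ) / K ≤ 1 / 2 := by gcongr
  have hKinv0 : 0 < (1 : ℝ) / K := by positivity
  set G : Set (Fin t → H) := {g | b * (lam * t) ≤ hits A g} with hG
  have hGm : MeasurableSet G := by
    have := (measurable_choose_hits (t := t) hAm 1).ennreal_toReal
    simp only [ENNReal.toReal_natCast, Nat.choose_one_right] at this
    exact measurableSet_le measurable_const this
  -- Chebyshev's inequality with deviation `λ t / K` gives `K² / (λ² t)`, at most `η` by `hKt`.
  have hGc : (Measure.pi fun _ : Fin t => ν).real Gᶜ ≤ η := by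
    have hδ : 0 < lam * t / K := by positivity
    refine (measureReal_mono (fun g hg => ?_)).trans ((measure_hits_le ν hAm hδ).trans ?_)
    · simp only [hG, Set.mem_compl_iff, Set.mem_ofPred_eq, not_le] at hg ⊢
      rw [hAs]
      have e : b * (lam * t) = lam * t - lam * t / K := by rw [hb]; ring
      rw [e] at hg
      nlinarith
    · rw [div_le_iff₀ (by positivity), hη, div_pow, mul_pow, ← mul_div_assoc,
        le_div_iff₀ (by positivity)]
      nlinarith [mul_le_mul_of_nonneg_right hKt ht0.le]
  have hgood : ∀ g ∈ G, ENNReal.ofReal (1 - η) ≤ seedMeasure (Fin t × β)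
      {ω | (x, y) ∈ totalOut (simJoin hash sim lam limit R pts g ω)} := by
    intro g hg
    have hov : b * (lam * t) ≤ (embeddedInput hash sim lam limit pts g).overlap x y := by
      rw [embeddedInput_overlap]; exact hg
    have hfail := seedMeasure_not_reported_le (embeddedInput_regular (hash := hash) (sim := sim)
      (lam := lam) (limit := limit) (pts := pts) g) hlimit ht hxy hyx
      (by rw [hb]; linarith : 0 < b) (by rw [hb]; linarith) hov R K (List.nodup_finRange n)
      (List.mem_finRange x) (List.mem_finRange y)
    rw [orderedPairs_finRange] at hfail
    set δ := Real.exp (-2) / (2 * ((K : ℝ) + 1)) with hδ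
    have hbK : Real.exp (-2) ≤ b ^ K := by
      calc Real.exp (-2) = Real.exp (-(2 * (1 / K))) ^ K := by
            rw [← Real.exp_nat_mul]; congr 1; field_simp
        _ ≤ _ := by
            gcongr
            exact exp_neg_two_mul_le hKinv0.le hKinv
    have hfac : 1 - b ^ K / (K + 1) + max (1 - Real.log (1 / lam) / Real.log n) 0 ^ K *
        ((n : ℝ) * (n - 1)) ≤ Real.exp (-δ) := by
      have h1 : 2 * δ ≤ b ^ K / (K + 1) := by
        have : 2 * δ = Real.exp (-2) / (K + 1) := by rw [hδ]; field_simp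
        rw [this]
        gcongr
      have := Real.one_sub_le_exp_neg δ
      linarith
    have hpos : 0 ≤ 1 - b ^ K / (K + 1) + max (1 - Real.log (1 / lam) / Real.log n) 0 ^ K *
        ((n : ℝ) * (n - 1)) := by
      have h1 : b ^ K ≤ 1 := pow_le_one₀ (by rw [hb]; linarith) (by rw [hb]; linarith)
      have h2 : b ^ K / (K + 1) ≤ 1 := by
        rw [div_le_one (by positivity)]; linarith
      have h3 : (0 : ℝ) ≤ n * (n - 1) := by
        rw [← orderedPairs_finRange]; positivity
      have h4 : 0 ≤ max (1 - Real.log (1 / lam) / Real.log n) 0 ^ K * ((n : ℝ) * (n - 1)) :=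
        mul_nonneg (pow_nonneg (le_max_right _ _) _) h3
      linarith
    have hfail2 : (seedMeasure (Fin t × β)).real {ω | ∀ i < R, (x, y) ∉
        (cpsJoin (embeddedInput hash sim lam limit pts g) (seedHash i ω) (K + 1) []
          (List.finRange n)).out} ≤ η := by
      refine hfail.trans ((pow_le_pow_left₀ hpos hfac R).trans ?_)
      rw [← Real.exp_nat_mul]
      have : Real.exp (R * -δ) ≤ Real.exp (-Real.log (2 / (1 - φ))) :=
        Real.exp_le_exp.2 (by linarith)
      refine this.trans_eq ?_
      rw [Real.exp_neg, Real.exp_log (by positivity), inv_div]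
    -- Subadditivity in place of complements, so no measurability of the output event is used.
    have hcover : (1 : ℝ≥0∞) ≤ seedMeasure (Fin t × β)
        {ω | (x, y) ∈ totalOut (simJoin hash sim lam limit R pts g ω)} +
        seedMeasure (Fin t × β) {ω | ∀ i < R, (x, y) ∉
        (cpsJoin (embeddedInput hash sim lam limit pts g) (seedHash i ω) (K + 1) []
          (List.finRange n)).out} := by
      rw [← measure_univ (μ := seedMeasure (Fin t × β))]
      refine (measure_mono fun ω _ => ?_).trans (measure_union_le _ _)
      by_cases hω : ∀ i < R, (x, y) ∉ (cpsJoin (embeddedInput hash sim lam limit pts g)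
        (seedHash i ω) (K + 1) [] (List.finRange n)).out
      · exact Or.inr hω
      · push Not at hω
        obtain ⟨i, hi, ho⟩ := hω
        exact Or.inl (mem_totalOut_simJoin.2 ⟨K + 1, i, hi, ho⟩)
    rw [ENNReal.ofReal_sub _ (by positivity), ENNReal.ofReal_one, tsub_le_iff_right]
    refine hcover.trans ?_
    gcongr
    exact (ENNReal.le_ofReal_iff_toReal_le (measure_ne_top _ _) (by positivity)).2 hfail2
  have hGp : ENNReal.ofReal (1 - η) ≤ (Measure.pi fun _ : Fin t => ν) G := by
    rw [probReal_compl_eq_one_sub hGm] at hGc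
    rw [← ENNReal.ofReal_toReal (measure_ne_top (Measure.pi fun _ : Fin t => ν) G)]
    exact ENNReal.ofReal_le_ofReal (by change 1 - η ≤ (Measure.pi fun _ : Fin t => ν).real G; linarith)
  have hη1 : 0 ≤ 1 - η := by rw [hη]; linarith [hφ.1]
  calc ENNReal.ofReal φ ≤ ENNReal.ofReal ((1 - η) * (1 - η)) :=
        ENNReal.ofReal_le_ofReal (by rw [hη]; nlinarith [sq_nonneg (1 - φ)])
    _ ≤ ENNReal.ofReal (1 - η) * (Measure.pi fun _ : Fin t => ν) G := by
        rw [ENNReal.ofReal_mul hη1]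
        gcongr
    _ = ∫⁻ g, G.indicator (fun _ => ENNReal.ofReal (1 - η)) g ∂(Measure.pi fun _ => ν) := by
        rw [lintegral_indicator_const hGm]
    _ ≤ _ := lintegral_mono fun g => by
        by_cases hg : g ∈ G
        · rw [Set.indicator_of_mem hg]; exact hgood g hg
        · rw [Set.indicator_of_notMem hg]; exact zero_le

/-- The working space is bounded by the depth of the recursion. -/
theorem prob_lt_totalSpace_le (hlimit : 1 ≤ limit) (ht : 1 ≤ lam * t) (R K : ℕ) {s b : ℝ}
    (hs : (n : ℝ) * t + (K + 1) * (n + 1 + 4 * (n * t)) ≤ s)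
    (hb : R * (max (1 - Real.log (1 / lam) / Real.log n) 0 ^ K * ((n : ℝ) * (n - 1))) ≤ b) :
    prob ν t (Fin t × β) (fun g ω =>
      ENNReal.ofReal s < totalSpace (simJoin hash sim lam limit R pts g ω)) ≤
      ENNReal.ofReal b := by
  have hinner : ∀ g : Fin t → H, seedMeasure (Fin t × β) {ω |
      ENNReal.ofReal s < totalSpace (simJoin hash sim lam limit R pts g ω)} ≤
      ENNReal.ofReal b := by
    intro g
    set I := embeddedInput hash sim lam limit pts g with hI
    calc _ ≤ seedMeasure (Fin t × β) (⋃ i ∈ Finset.range R, {ω | treeCost I (fun _ => 0)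
          orderedPairs (seedHash i ω) K [] (List.finRange n) ≠ 0}) := by
          refine measure_mono fun ω hω => ?_
          by_contra hcon
          simp only [Set.mem_iUnion, Finset.mem_range, Set.mem_ofPred_eq, exists_prop, not_exists,
            not_and, not_not] at hcon
          change ENNReal.ofReal s < _ at hω
          refine absurd hω (not_lt.2 (iSup_le fun k => ?_))
          have h1 := simJoin_space_le (hash := hash) (sim := sim) (lam := lam) (pts := pts)
            hlimit R g ω K k hcon
          rw [← ENNReal.ofReal_natCast]
          refine ENNReal.ofReal_le_ofReal (le_trans ?_ hs)
          exact_mod_cast h1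
      _ ≤ ∑ i ∈ Finset.range R, ENNReal.ofReal
          (max (1 - I.eps) 0 ^ K * orderedPairs (List.finRange n)) :=
          (measure_biUnion_finset_le _ _).trans (Finset.sum_le_sum fun i _ =>
            seedMeasure_treeCost_ne_zero_le (embeddedInput_regular g) hlimit ht i K
              (List.nodup_finRange n))
      _ ≤ _ := by
          rw [Finset.sum_const, Finset.card_range, nsmul_eq_mul, orderedPairs_finRange,
            ← ENNReal.ofReal_natCast, ← ENNReal.ofReal_mul (by positivity)]
          exact ENNReal.ofReal_le_ofReal hb
  refine (lintegral_mono hinner).trans_eq ?_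
  rw [lintegral_const, measure_univ, mul_one]

end Guarantees

/-- At depth `B (1 + log n) ^ 2` all pairs have been separated with high probability. -/
lemma depth_bound {lam : ℝ} (hlam : lam ∈ Set.Ioo (0 : ℝ) 1) {n : ℕ} (hn : 1 ≤ n) {B : ℝ}
    (hB : 0 ≤ B) {K : ℕ} (hK : B * (1 + Real.log n) ^ 2 ≤ K) :
    max (1 - Real.log (1 / lam) / Real.log n) 0 ^ K * ((n : ℝ) * (n - 1)) ≤
      Real.exp ((2 - Real.log (1 / lam) * B) * (1 + Real.log n)) := by
  rcases hn.eq_or_lt with rfl | hn2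
  · simp [Real.exp_nonneg]
  have hell : 0 < Real.log (1 / lam) := Real.log_pos (one_lt_one_div hlam.1 hlam.2)
  have hn' : (1 : ℝ) < n := by exact_mod_cast hn2
  have hlog : 0 < Real.log n := Real.log_pos hn'
  set l := Real.log (1 / lam)
  set v := Real.log n with hv
  have h1 : max (1 - l / v) 0 ≤ Real.exp (-(l / v)) :=
    max_le (Real.one_sub_le_exp_neg _) (Real.exp_pos _).le
  have h2 : (n : ℝ) * (n - 1) ≤ Real.exp (2 * v) := by
    have : Real.exp (2 * v) = n * n := by
      rw [two_mul, Real.exp_add, hv, Real.exp_log (by linarith)]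
    rw [this]
    nlinarith
  calc _ ≤ Real.exp (-(l / v)) ^ K * Real.exp (2 * v) := by
        have : (0 : ℝ) ≤ n * (n - 1) := mul_nonneg (by linarith) (by linarith)
        gcongr
    _ = Real.exp (K * -(l / v) + 2 * v) := by rw [← Real.exp_nat_mul, ← Real.exp_add]
    _ ≤ _ := by
        refine Real.exp_le_exp.2 ?_
        have h3 : l * B * (1 + v) ≤ K * (l / v) := by
          rw [← mul_div_assoc, le_div_iff₀ hlog]
          have h4 : B * (1 + v) * v ≤ K := by nlinarith [mul_nonneg hB (by linarith : 0 ≤ 1 + v)]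
          nlinarith
        linarith

/-! ### Choice of the parameters -/

/-- A larger `B` separates pairs exponentially faster but lowers the survival probability, through
`K`, only by a factor of order `1 / B`; in logarithms, `log B` loses to `l * B`. -/
lemma exists_depth_constant {l : ℝ} (hl : 0 < l) :
    ∃ B : ℝ, 2 ≤ B ∧ 6 + Real.log (6 * B) ≤ l * B := by
  have h1 := (Real.isLittleO_log_id_atTop.bound (c := l / 12) (by positivity))
  have h2 : ∀ᶠ x : ℝ in Filter.atTop, 12 ≤ x ∧ 12 * 6 / l ≤ x :=
    (Filter.eventually_ge_atTop _).and (Filter.eventually_ge_atTop _)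
  obtain ⟨x, hx1, hx2, hx3⟩ := (h1.and h2).exists
  refine ⟨x / 6, by linarith, ?_⟩
  rw [mul_div_cancel₀ _ (by norm_num)]
  have h3 : Real.log x ≤ l / 12 * x := by
    have := (le_abs_self _).trans hx1
    rwa [Real.norm_eq_abs, id, abs_of_nonneg (by linarith)] at this
  rw [div_le_iff₀ hl] at hx3
  linarith

/-- The bound of `depth_bound` beats the survival probability of a similar pair. -/
lemma exp_depth_le {l B u : ℝ} (hB : 2 ≤ B) (hlB : 6 + Real.log (6 * B) ≤ l * B) (hu : 1 ≤ u)
    {K : ℕ} (hK : (K : ℝ) + 1 ≤ 3 * B * u ^ 2) :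
    Real.exp ((2 - l * B) * u) ≤ Real.exp (-2) / (2 * (K + 1)) := by
  have hlog : 0 ≤ Real.log (6 * B) := Real.log_nonneg (by linarith)
  have hue : u ≤ Real.exp u := by linarith [Real.add_one_le_exp u]
  rw [le_div_iff₀ (by positivity)]
  calc Real.exp ((2 - l * B) * u) * (2 * (K + 1))
      ≤ Real.exp ((2 - l * B) * u) * (6 * B * Real.exp u ^ 2) := by
        refine mul_le_mul_of_nonneg_left ?_ (Real.exp_pos _).le
        have h1 : B * u ^ 2 ≤ B * Real.exp u ^ 2 := by gcongr
        linarith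
    _ = Real.exp ((2 - l * B) * u + (Real.log (6 * B) + 2 * u)) := by
        rw [Real.exp_add, Real.exp_add, Real.exp_log (by linarith), ← Real.exp_nat_mul]
        norm_num
    _ ≤ Real.exp (-2) := Real.exp_le_exp.2 (by nlinarith)

/-- With `B = (log c + 4 + a) / l` the bound of `depth_bound`, summed over all repetitions, is at
most `n ^ (-a)`. -/
lemma exp_space_le {l c a : ℝ} (hl : 0 < l) (hc : 1 ≤ c) (ha : 0 < a) {n : ℕ} (hn : 1 ≤ n) {R : ℕ}
    (hR : (R : ℝ) ≤ c * (1 + Real.log n) ^ 2) :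
    R * Real.exp ((2 - l * ((Real.log c + 4 + a) / l)) * (1 + Real.log n)) ≤ (n : ℝ) ^ (-a) := by
  have hn' : (1 : ℝ) ≤ n := by exact_mod_cast hn
  have hlog : 0 ≤ Real.log n := Real.log_nonneg hn'
  have hlogc : 0 ≤ Real.log c := Real.log_nonneg hc
  rw [mul_div_cancel₀ _ hl.ne', Real.rpow_def_of_pos (by linarith)]
  set u := 1 + Real.log n with hu
  clear_value u
  have hu1 : 1 ≤ u := by linarith
  have hue : u ≤ Real.exp u := by linarith [Real.add_one_le_exp u]
  calc R * Real.exp ((2 - (Real.log c + 4 + a)) * u)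
      ≤ (c * Real.exp u ^ 2) * Real.exp ((2 - (Real.log c + 4 + a)) * u) := by
        gcongr
        refine hR.trans ?_
        gcongr
    _ = Real.exp (Real.log c + 2 * u + (2 - (Real.log c + 4 + a)) * u) := by
        rw [Real.exp_add, Real.exp_add, Real.exp_log (by linarith), two_mul, Real.exp_add u, sq]
    _ ≤ _ := Real.exp_le_exp.2 (by nlinarith)

lemma ceil_le_mul {c u : ℝ} (hc : 0 ≤ c) (hu : 1 ≤ u) : (⌈c * u⌉₊ : ℝ) ≤ (c + 1) * u := by
  have := Nat.ceil_lt_add_one (mul_nonneg hc (by linarith : 0 ≤ u))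
  nlinarith

lemma space_bound_le {n t K T b u : ℝ} (hn : 1 ≤ n) (hu : 1 ≤ u) (hT : 0 ≤ T) (ht0 : 0 ≤ t)
    (ht : t ≤ (T + 1) * u ^ 4) (hK0 : 0 ≤ K) (hK : K ≤ (b + 1) * u ^ 2) :
    n * t + (K + 1) * (n + 1 + 4 * (n * t)) ≤ ((T + 1) + (b + 2) * (6 + 4 * T)) * n * u ^ 7 := by
  have hu2 : 1 ≤ u ^ 2 := one_le_pow₀ hu
  have hu4 : 1 ≤ u ^ 4 := one_le_pow₀ hu
  have h1 : n + 1 + 4 * (n * t) ≤ n * ((6 + 4 * T) * u ^ 4) := by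
    nlinarith [mul_le_mul_of_nonneg_left ht (by linarith : 0 ≤ n),
      mul_le_mul_of_nonneg_left hu4 (by linarith : 0 ≤ n)]
  have h2 : K + 1 ≤ (b + 2) * u ^ 2 := by linarith
  have h3 : (K + 1) * (n + 1 + 4 * (n * t)) ≤
      ((b + 2) * u ^ 2) * (n * ((6 + 4 * T) * u ^ 4)) :=
    mul_le_mul h2 h1 (by positivity) (by linarith)
  have hb : 0 ≤ b + 2 := by
    by_contra hb
    nlinarith
  have h6 : u ^ 6 ≤ u ^ 7 := pow_le_pow_right₀ hu (by norm_num)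
  have h4 : u ^ 4 ≤ u ^ 7 := pow_le_pow_right₀ hu (by norm_num)
  calc _ ≤ n * ((T + 1) * u ^ 4) + ((b + 2) * u ^ 2) * (n * ((6 + 4 * T) * u ^ 4)) :=
        add_le_add (mul_le_mul_of_nonneg_left ht (by linarith)) h3
    _ = (n * (T + 1)) * u ^ 4 + ((b + 2) * n * (6 + 4 * T)) * u ^ 6 := by ring
    _ ≤ (n * (T + 1)) * u ^ 7 + ((b + 2) * n * (6 + 4 * T)) * u ^ 7 := by gcongr
    _ = _ := by ring

lemma time_bound_le {n t R T c M W u : ℝ} (hn : 1 ≤ n) (hnW : n ≤ W) (hu : 1 ≤ u) (hT : 0 ≤ T)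
    (ht0 : 0 ≤ t) (ht : t ≤ (T + 1) * u ^ 4) (hR0 : 0 ≤ R) (hc : 0 ≤ c) (hR : R ≤ c * u ^ 2)
    (hM : 0 ≤ M) :
    (n * t + R) + (5 * t + 9) * (R * (M * u * W)) ≤
      ((T + 1) + c + (5 * T + 14) * c * M) * u ^ 7 * W := by
  have hW : 0 ≤ W := by linarith
  have hu4 : 1 ≤ u ^ 4 := one_le_pow₀ hu
  have h4 : u ^ 4 ≤ u ^ 7 := pow_le_pow_right₀ hu (by norm_num)
  have h2 : u ^ 2 ≤ u ^ 7 := pow_le_pow_right₀ hu (by norm_num)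
  have h7 : 0 ≤ u ^ 7 := by positivity
  have e1 : n * t ≤ (T + 1) * u ^ 7 * W := by
    calc n * t ≤ W * ((T + 1) * u ^ 4) := by gcongr
      _ ≤ W * ((T + 1) * u ^ 7) := by gcongr
      _ = _ := by ring
  have e2 : R ≤ c * u ^ 7 * W := by
    calc R ≤ c * u ^ 2 := hR
      _ ≤ c * u ^ 7 := by gcongr
      _ ≤ c * u ^ 7 * W := le_mul_of_one_le_right (by positivity) (by linarith)
  have e3 : (5 * t + 9) * (R * (M * u * W)) ≤ (5 * T + 14) * c * M * u ^ 7 * W := by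
    calc (5 * t + 9) * (R * (M * u * W))
        ≤ ((5 * T + 14) * u ^ 4) * ((c * u ^ 2) * (M * u * W)) := by
          gcongr
          linarith
      _ = _ := by ring
  linarith

end CPSJoin

end

/-! ### The theorem: fixing the constants -/

theorem theorem1 (lam φ : ℝ) (hlam : lam ∈ Set.Ioo (0 : ℝ) 1) (hφ : φ ∈ Set.Ioo (0 : ℝ) 1)
    (limit : ℕ) (hlimit : 1 ≤ limit) :
    ∃ (t R : ℕ → ℕ) (C : ℝ) (D : ℝ → ℝ) (c : ℕ),
      (∀ n : ℕ, 1 ≤ n →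
        1 ≤ t n ∧ (t n : ℝ) ≤ C * (1 + Real.log n) ^ c ∧
        (R n : ℝ) ≤ C * (1 + Real.log n) ^ 2) ∧
      ∀ (X : Type*) (H : Type*) (β : Type*) [MeasurableSpace H] (ν : Measure H)
        [IsProbabilityMeasure ν] (hash : H → X → β) (sim : X → X → ℝ),
        CPSJoin.IsLSHFamily ν hash sim →
        ∀ (n : ℕ), 1 ≤ n → ∀ pts : Fin n → X, Function.Injective pts →
          let run := fun (g : Fin (t n) → H) (ω : CPSJoin.Seeds (Fin (t n) × β)) =>
            CPSJoin.simJoin hash sim lam limit (R n) pts g ω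
          (∀ g ω, CPSJoin.totalOut (run g ω) ⊆ CPSJoin.joinSet sim lam pts) ∧
          (∀ q ∈ CPSJoin.joinSet sim lam pts,
            ENNReal.ofReal φ ≤ CPSJoin.prob ν (t n) (Fin (t n) × β)
              (fun g ω => q ∈ CPSJoin.totalOut (run g ω))) ∧
          CPSJoin.expect ν (t n) (Fin (t n) × β) (fun g ω => CPSJoin.totalTime (run g ω)) ≤
            ENNReal.ofReal
              (C * (1 + Real.log n) ^ c * CPSJoin.individualCost sim lam pts) ∧
          CPSJoin.expect ν (t n) (Fin (t n) × β) (fun g ω => CPSJoin.totalCmps (run g ω)) ≤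
            ENNReal.ofReal (C * R n * CPSJoin.individualCost sim lam pts) ∧
          ∀ a : ℝ, 0 < a →
            CPSJoin.prob ν (t n) (Fin (t n) × β)
              (fun g ω => ENNReal.ofReal (D a * n * (1 + Real.log n) ^ c) <
                CPSJoin.totalSpace (run g ω)) ≤ ENNReal.ofReal ((n : ℝ) ^ (-a)) := by
  have hl0 := hlam.1
  have hl1 : 0 < 1 - lam := by linarith [hlam.2]
  have hφ1 : 0 < 1 - φ := by linarith [hφ.2]
  have hell : 0 < Real.log (1 / lam) := Real.log_pos (one_lt_one_div hlam.1 hlam.2)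
  set l := Real.log (1 / lam) with hl
  obtain ⟨B, hB, hlB⟩ := CPSJoin.exists_depth_constant hell
  have hlr : 0 < Real.log (2 / (1 - φ)) :=
    Real.log_pos ((one_lt_div hφ1).2 (by linarith [hφ.1]))
  -- With `u = 1 + log n`, `R` has to reach `log (2 / (1 - φ)) * 2 (K + 1) * exp 2`, where `K + 1 ≤
  -- 3 B u²`.
  set r := 6 * Real.exp 2 * B * Real.log (2 / (1 - φ)) with hr
  have hr0 : 0 ≤ r := by positivity
  -- The first two terms give `4 k² < λ t` for `k ≤ log n / l` and `1 ≤ λ t`. The third gives `2 K²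
  -- ≤ λ² (1 - φ) t` for `K ≤ 2 B u²` and is the reason for the fourth power of `u` in `t`.
  set T := 4 / (lam * l ^ 2) + 1 / lam + 8 * B ^ 2 / (lam ^ 2 * (1 - φ)) with hT
  have hT1 : 0 ≤ 4 / (lam * l ^ 2) := by positivity
  have hT2 : 0 ≤ 1 / lam := by positivity
  have hT3 : 0 ≤ 8 * B ^ 2 / (lam ^ 2 * (1 - φ)) := by positivity
  have hT0 : 0 ≤ T := by positivity
  set M := (2 * limit / (1 - lam) + 2 * Real.exp 4 + 2 * (1 + limit / lam) / l) *
    (2 * (1 / lam) ^ 4) with hM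
  have hM0 : 0 ≤ M := by positivity
  set N := (2 * limit + 2 * Real.exp 4) * (2 * (1 / lam) ^ 4) with hN
  have hN0 : 0 ≤ N := by positivity
  have hP0 : 0 ≤ (5 * T + 14) * (r + 1) * M := by positivity
  have hu : ∀ n : ℕ, 1 ≤ n → 1 ≤ 1 + Real.log n := fun n hn => by
    have : (1 : ℝ) ≤ n := by exact_mod_cast hn
    linarith [Real.log_nonneg this]
  have htge : ∀ n : ℕ, T * (1 + Real.log n) ^ 4 ≤ (⌈T * (1 + Real.log n) ^ 4⌉₊ : ℝ) :=
    fun n => Nat.le_ceil _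
  have htle : ∀ n : ℕ, 1 ≤ n →
      (⌈T * (1 + Real.log n) ^ 4⌉₊ : ℝ) ≤ (T + 1) * (1 + Real.log n) ^ 4 :=
    fun n hn => CPSJoin.ceil_le_mul hT0 (one_le_pow₀ (hu n hn))
  have hRle : ∀ n : ℕ, 1 ≤ n →
      (⌈r * (1 + Real.log n) ^ 2⌉₊ : ℝ) ≤ (r + 1) * (1 + Real.log n) ^ 2 :=
    fun n hn => CPSJoin.ceil_le_mul hr0 (one_le_pow₀ (hu n hn))
  -- The exponent `7` is `2 + 4 + 1`, from `R`, `t` and `1 / ε` in the running time; depth times `t`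
  -- in the space needs only `2 + 4`. The dependence on `a` enters `D a` through the depth constant
  -- `(log (r + 1) + 4 + a) / l`.
  refine ⟨fun n => ⌈T * (1 + Real.log n) ^ 4⌉₊, fun n => ⌈r * (1 + Real.log n) ^ 2⌉₊,
    (T + 1) + (r + 1) + (5 * T + 14) * (r + 1) * M + N,
    fun a => (T + 1) + ((Real.log (r + 1) + 4 + a) / l + 2) * (6 + 4 * T), 7,
    fun n hn => ⟨?_, ?_, ?_⟩, ?_⟩
  · refine Nat.one_le_iff_ne_zero.2 (Nat.ceil_pos.2 ?_).ne'
    have h1 : 0 < 1 / lam := by positivity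
    have h2 : 0 < T := by linarith
    have h3 := hu n hn
    positivity
  · refine (htle n hn).trans ?_
    have h1 := hu n hn
    exact mul_le_mul (by linarith) (pow_le_pow_right₀ h1 (by norm_num)) (by positivity)
      (by linarith)
  · exact (hRle n hn).trans (mul_le_mul_of_nonneg_right (by linarith) (sq_nonneg _))
  intro X H β _ ν _ hash sim hLSH n hn pts _ run
  have hn' : (1 : ℝ) ≤ n := by exact_mod_cast hn
  have hu1 := hu n hn
  have hlogn : 0 ≤ Real.log n := by linarith
  have htg := htge n
  have htl := htle n hn
  have hRl := hRle n hn
  have hRg : r * (1 + Real.log n) ^ 2 ≤ (⌈r * (1 + Real.log n) ^ 2⌉₊ : ℝ) := Nat.le_ceil _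
  simp only [run]
  generalize ⌈T * (1 + Real.log n) ^ 4⌉₊ = t at *
  generalize ⌈r * (1 + Real.log n) ^ 2⌉₊ = R at *
  set u := 1 + Real.log n with hudef
  have hu2 : 1 ≤ u ^ 2 := one_le_pow₀ hu1
  have hu4 : 1 ≤ u ^ 4 := one_le_pow₀ hu1
  have hlamt : (4 / l ^ 2 + 1) * u ^ 4 ≤ lam * t := by
    have e : lam * (4 / (lam * l ^ 2) + 1 / lam) = 4 / l ^ 2 + 1 := by field_simp
    calc (4 / l ^ 2 + 1) * u ^ 4 = lam * ((4 / (lam * l ^ 2) + 1 / lam) * u ^ 4) := by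
          rw [← mul_assoc, e]
      _ ≤ lam * (T * u ^ 4) := by
          gcongr
          linarith
      _ ≤ lam * t := by gcongr
  have h4l : 0 ≤ 4 / l ^ 2 := by positivity
  have ht1 : 1 ≤ lam * t :=
    (hu4.trans (le_mul_of_one_le_left (by positivity) (by linarith))).trans hlamt
  have hsize : ∀ k : ℕ, (k : ℝ) * l ≤ Real.log n → 4 * (k : ℝ) ^ 2 < lam * t := by
    intro k hk
    have h1 : (k : ℝ) ≤ u / l := by rw [le_div_iff₀ hell]; linarith
    have h2 : 4 * (k : ℝ) ^ 2 ≤ 4 / l ^ 2 * u ^ 4 := by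
      calc 4 * (k : ℝ) ^ 2 ≤ 4 * (u / l) ^ 2 := by gcongr
        _ = 4 / l ^ 2 * u ^ 2 := by ring
        _ ≤ 4 / l ^ 2 * u ^ 4 :=
            mul_le_mul_of_nonneg_left (pow_le_pow_right₀ hu1 (by norm_num)) h4l
    linarith
  have hW := CPSJoin.le_individualCost (pts := pts) hlam hLSH.nonneg
  have hW0 : 0 ≤ CPSJoin.individualCost sim lam pts := by linarith
  refine ⟨fun g ω => CPSJoin.totalOut_subset_joinSet hLSH hlam.2.le R g ω, fun q hq => ?_, ?_, ?_,
    fun a ha => ?_⟩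
  · have hKg : B * u ^ 2 ≤ (⌈B * u ^ 2⌉₊ : ℝ) := Nat.le_ceil _
    have hKl : (⌈B * u ^ 2⌉₊ : ℝ) < B * u ^ 2 + 1 := Nat.ceil_lt_add_one (by positivity)
    generalize ⌈B * u ^ 2⌉₊ = K at hKg hKl
    have hBu : 2 ≤ B * u ^ 2 := hB.trans (le_mul_of_one_le_right (by linarith) hu2)
    have hK2 : 2 ≤ K := by exact_mod_cast hBu.trans hKg
    have hK3 : (K : ℝ) + 1 ≤ 3 * B * u ^ 2 := by linarith
    refine CPSJoin.le_prob_mem_totalOut hLSH hlam hlimit ht1 hφ hK2 ?_ ?_ ?_ hq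
    · have h1 : (K : ℝ) ^ 2 ≤ (2 * B * u ^ 2) ^ 2 := by
        gcongr
        linarith
      calc 2 * (K : ℝ) ^ 2 ≤ 2 * (2 * B * u ^ 2) ^ 2 := by gcongr
        _ = lam ^ 2 * (1 - φ) * (8 * B ^ 2 / (lam ^ 2 * (1 - φ)) * u ^ 4) := by
            field_simp
            ring
        _ ≤ lam ^ 2 * (1 - φ) * (T * u ^ 4) := by
            gcongr
            linarith
        _ ≤ lam ^ 2 * (1 - φ) * t := by gcongr
    · exact (CPSJoin.depth_bound hlam hn (by linarith) hKg).trans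
        (CPSJoin.exp_depth_le hB hlB hu1 hK3)
    · rw [← mul_div_assoc, le_div_iff₀ (by positivity), Real.exp_neg, ← div_eq_mul_inv,
        le_div_iff₀ (Real.exp_pos 2)]
      refine le_trans ?_ hRg
      calc Real.log (2 / (1 - φ)) * (2 * (K + 1)) * Real.exp 2
          ≤ Real.log (2 / (1 - φ)) * (2 * (3 * B * u ^ 2)) * Real.exp 2 := by gcongr
        _ = r * u ^ 2 := by rw [hr]; ring
  · refine (CPSJoin.expect_totalTime_le hLSH hlam hlimit hn ht1 hsize R).trans
      (ENNReal.ofReal_le_ofReal ?_)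
    have h1 := CPSJoin.time_bound_le hn' hW hu1 hT0 (Nat.cast_nonneg t) htl (Nat.cast_nonneg R)
      (by linarith) hRl hM0
    have e : (2 * (limit : ℝ) / (1 - lam) + 2 * Real.exp 4 + 2 * (1 + limit / lam) / l) * u *
        (2 * (1 / lam) ^ 4) * CPSJoin.individualCost sim lam pts =
        M * u * CPSJoin.individualCost sim lam pts := by rw [hM]; ring
    rw [e]
    exact h1.trans (mul_le_mul_of_nonneg_right
      (mul_le_mul_of_nonneg_right (by linarith) (by positivity)) hW0)
  · refine (CPSJoin.expect_totalCmps_le hLSH hlam hlimit hn ht1 hsize R).trans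
      (ENNReal.ofReal_le_ofReal ?_)
    rw [← hN, ← mul_assoc, mul_comm (R : ℝ)]
    gcongr
    linarith
  · have hb0 : 0 ≤ (Real.log (r + 1) + 4 + a) / l := by
      have := Real.log_nonneg (by linarith : 1 ≤ r + 1)
      positivity
    refine CPSJoin.prob_lt_totalSpace_le hlimit ht1 R
      ⌈(Real.log (r + 1) + 4 + a) / l * u ^ 2⌉₊
      (CPSJoin.space_bound_le hn' hu1 hT0 (Nat.cast_nonneg t) htl (Nat.cast_nonneg _)
        (CPSJoin.ceil_le_mul hb0 hu2)) ?_
    refine le_trans ?_ (CPSJoin.exp_space_le hell (by linarith) ha hn hRl)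
    gcongr
    exact CPSJoin.depth_bound hlam hn hb0 (Nat.le_ceil _)
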